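/- **Setting.** Let $\alpha,\beta>-1$ and let $n\ge 1$ be an integer. Put $w_{\alpha,\beta}(t)=(1-t)^\alpha(1+t)^\beta$ on $[-1,1]$ and $c_{\alpha,\beta}=\big(\int_{-1}^1 w_{\alpha,\beta}(t)\,dt\big)^{-1}$. Let $P_m^{(\alpha,\beta)}$ be the Jacobi polynomials, $p_m^{(\alpha,\beta)}=(h_m^{(\alpha,\beta)})^{-1/2}P_m^{(\alpha,\beta)}$ with $h_m^{(\alpha,\beta)}=c_{\alpha,\beta}\int_{-1}^1 (P_m^{(\alpha,\beta)})^2w_{\alpha,\beta}$ the orthonormal ones, and $k_m^{(\alpha,\beta)}(s,t)=\sum_{i=0}^m p_i^{(\alpha,\beta)}(s)p_i^{(\alpha,\beta)}(t)$ the Jacobi reproducing kernels ($k_{-1}^{(\alpha,\beta)}=0$). Let $\Pi_m^2$ be the space of real polynomials in two variables of total degree at most $m$. On $[-1,1]^2$ consider the weight function $$\mathcal W_{\alpha,\beta}(x_1,x_2)=c_{\alpha,\beta}^2\,\frac{|x_1-x_2|^{2\alpha+1}|x_1+x_2|^{2\beta+1}}{\sqrt{1-x_1^2}\sqrt{1-x_2^2}}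 .$$ For $x=(\cos\theta_1,\cos\theta_2)$ and $y=(\cos\phi_1,\cos\phi_2)$ in $[-1,1]^2$, with all angles in $[0,\pi]$, put $$K_m^{\alpha,\beta}(x,y)=\tfrac12\big[k_m^{(\alpha,\beta)}(\cos(\theta_1-\theta_2),\cos(\phi_1-\phi_2))\,k_m^{(\alpha,\beta)}(\cos(\theta_1+\theta_2),\cos(\phi_1+\phi_2))+k_m^{(\alpha,\beta)}(\cos(\theta_1-\theta_2),\cos(\phi_1+\phi_2))\,k_m^{(\alpha,\beta)}(\cos(\theta_1+\theta_2),\cos(\phi_1-\phi_2))\big],$$ $d^{(i,j)}_{\alpha,\beta}=c_{\alpha+i,\beta+j}^2/c_{\alpha,\beta}^2$, $$\begin{aligned}\mathcal K_{2n-1}^{\alpha,\beta}(x,y)={}&K_{n-1}^{\alpha,\beta}(x,y)+d^{(1,1)}_{\alpha,\beta}(x_1^2-x_2^2)(y_1^2-y_2^2)K_{n-2}^{\alpha+1,\beta+1}(x,y)\\&+d^{(0,1)}_{\alpha,\beta}(x_1+x_2)(y_1+y_2)K_{n-1}^{\alpha,\beta+1}(x,y)+d^{(1,0)}_{\alpha,\beta}(x_1-x_2)(y_1-y_2)K_{n-1}^{\alpha+1,\beta}(x,y),\end{aligned}$$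 and, for $0\le k\le n-1$, $$Q_k(x)=\epsilon_k\frac{c_{\alpha+1,\beta+1}}{\sqrt2\,c_{\alpha,\beta}}(x_1^2-x_2^2)\big[q_{n-1}(\cos(\theta_1-\theta_2))q_k(\cos(\theta_1+\theta_2))+q_k(\cos(\theta_1-\theta_2))q_{n-1}(\cos(\theta_1+\theta_2))\big],$$ where $q_i=p_i^{(\alpha+1,\beta+1)}$, $\epsilon_k=1$ for $k\le n-2$ and $\epsilon_{n-1}=\tfrac{\sqrt2}{2}$. Each $Q_k$ is (the restriction to $[-1,1]^2$ of) a polynomial; let $\Pi^*_{2n}=\Pi^2_{2n-1}+\operatorname{span}\{Q_k:0\le k\le n-1\}$. For real numbers $b=(b_0,\dots,b_{n-1})$ put $$\mathcal K^{b}_{2n}(x,y)=\mathcal K^{\alpha,\beta}_{2n-1}(x,y)+\sum_{k=0}^{n-1}b_kQ_k(x)Q_k(y).$$ **Theorem.** (a) $P_n^{(\alpha,\beta)}$ has $n$ distinct zeros $x_k=\cos\theta_k$, $0<\theta_k<\pi$, $1\le k\le n$. Number them in any order. Let $\lambda_k=[k_n^{(\alpha,\beta)}(x_k,x_k)]^{-1}$,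 $s_{j,k}=\cos\frac{\theta_j-\theta_k}2$, $t_{j,k}=\cos\frac{\theta_j+\theta_k}2$, and for $1\le j\le k\le n$ $$\mathbf x^{(1)}_{j,k}=(s_{j,k},t_{j,k}),\quad \mathbf x^{(2)}_{j,k}=(t_{j,k},s_{j,k}),\quad \mathbf x^{(3)}_{j,k}=-\mathbf x^{(1)}_{j,k},\quad \mathbf x^{(4)}_{j,k}=-\mathbf x^{(2)}_{j,k};$$ let $\mu_{j,k}=\frac12\lambda_j\lambda_k$ for $j<k$ and $\mu_{k,k}=\frac14\lambda_k^2$. (b) $\mathcal K_{2n-1}^{\alpha,\beta}$ is the reproducing kernel of $\Pi^2_{2n-1}$ in $L^2([-1,1]^2,\mathcal W_{\alpha,\beta})$. The points $\mathbf x^{(i)}_{j,k}$ are pairwise distinct points of $[-1,1]^2$; their number is $\dim\Pi^2_{2n-1}+n$ (the lower bound for the number of nodes of a cubature rule of degree $4n-1$ for a centrally symmetric weight), and with the nonzero weights $\mu_{j,k}$ they form a cubature rule for $\mathcal W_{\alpha,\beta}$ of precision $4n-1$: $\int_{[-1,1]^2}f\,\mathcal W_{\alpha,\beta}=\sum_{j\le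 k}\mu_{j,k}\sum_{i=1}^4f(\mathbf x^{(i)}_{j,k})$ for all $f\in\Pi^2_{4n-1}$, but not for all $f\in\Pi^2_{4n}$. (c) There is exactly one $b\in\mathbb R^n$ such that $\mu_{j,k}=[\mathcal K^b_{2n}(\mathbf x^{(i)}_{j,k},\mathbf x^{(i)}_{j,k})]^{-1}$ for all $i$ and all $j\le k$, namely $$b_{k,n}=\frac{1+\alpha+\beta+n}{1+\alpha+\beta+2n}\quad(0\le k\le n-2),\qquad b_{n-1,n}=\Big(\frac{1+\alpha+\beta+n}{1+\alpha+\beta+2n}\Big)^2 .$$ Write $\mathcal K^*_{2n}$ for the kernel $\mathcal K_{2n}^b$ with these coefficients. (d) For all $x,y\in[-1,1]^2$, $$\begin{aligned}\mathcal K^*_{2n}(x,y)={}&\mathcal K^{\alpha,\beta}_{2n-1}(x,y)+\frac{1+\alpha+\beta+n}{1+\alpha+\beta+2n}\,d^{(1,1)}_{\alpha,\beta}(x_1^2-x_2^2)(y_1^2-y_2^2)\big[K_{n-1}^{\alpha+1,\beta+1}(x,y)-K_{n-2}^{\alpha+1,\beta+1}(x,y)\big]\\&-\frac{n(1+\alpha+\beta+n)}{(1+\alpha+\beta+2n)^2}\,Q_{n-1}(x)Q_{n-1}(y).\end{aligned}$$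 (e) For every real-valued function $f$ there is exactly one polynomial $\mathcal L_nf\in\Pi^*_{2n}$ with $\mathcal L_nf(\mathbf x^{(i)}_{j,k})=f(\mathbf x^{(i)}_{j,k})$ for $1\le i\le 4$, $1\le j\le k\le n$, and on $[-1,1]^2$ it is given by $$\mathcal L_nf(x)=\sum_{k=1}^n\sum_{j=1}^k\sum_{i=1}^4 f(\mathbf x^{(i)}_{j,k})\,\ell^{(i)}_{j,k}(x),\qquad \ell^{(i)}_{j,k}(x)=\mu_{j,k}\,\mathcal K^*_{2n}(x,\mathbf x^{(i)}_{j,k}),$$ that is, $\ell^{(i)}_{j,k}=\frac12\lambda_j\lambda_k\mathcal K_{2n}^*(\cdot,\mathbf x^{(i)}_{j,k})$, with $\frac12$ replaced by $\frac14$ when $j=k$. -/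

import Mathlib

open MeasureTheory

noncomputable section

namespace MinCub

/-! ### One variable: Jacobi polynomials -/

/-- The Jacobi weight `(1-t)^α (1+t)^β` on `[-1,1]`. -/
def jacobiWeight (α β t : ℝ) : ℝ := (1 - t) ^ α * (1 + t) ^ β

/-- The normalization constant `c_{α,β}`, so that `c_{α,β} ∫_{-1}^1 w_{α,β} = 1`. -/
def jacobiConst (α β : ℝ) : ℝ := (∫ t in (-1 : ℝ)..1, jacobiWeight α β t)⁻¹

/-- The Jacobi polynomial `P_n^{(α,β)}`, that is
`(α+1)_n / n! * ₂F₁(-n, n+α+β+1; α+1; (1-X)/2)`. -/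
def jacobi (α β : ℝ) (n : ℕ) : Polynomial ℝ :=
  ∑ k ∈ Finset.range (n + 1),
    Polynomial.C
        ((ascPochhammer ℝ n).eval (α + 1) / (n.factorial : ℝ) *
          ((ascPochhammer ℝ k).eval (-(n : ℝ)) * (ascPochhammer ℝ k).eval (n + α + β + 1) /
            ((ascPochhammer ℝ k).eval (α + 1) * (k.factorial : ℝ)))) *
      (Polynomial.C (1 / 2) * (1 - Polynomial.X)) ^ k

/-- `h_n^{(α,β)} = c_{α,β} ∫_{-1}^1 (P_n^{(α,β)})^2 w_{α,β}`. -/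
def jacobiNormSq (α β : ℝ) (n : ℕ) : ℝ :=
  jacobiConst α β * ∫ t in (-1 : ℝ)..1, (jacobi α β n).eval t ^ 2 * jacobiWeight α β t

/-- The orthonormal Jacobi polynomial `p_n^{(α,β)} = (h_n^{(α,β)})^{-1/2} P_n^{(α,β)}`. -/
def jacobiON (α β : ℝ) (n : ℕ) (t : ℝ) : ℝ :=
  (jacobi α β n).eval t / √(jacobiNormSq α β n)

/-- The reproducing kernel `∑_{k < N} p_k(s) p_k(t)` of the polynomials of degree **less than**
`N`; the kernel usually written `k_m^{(α,β)}` is `jacobiKernel α β (m + 1)`, and `k_{-1} = 0` is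
`jacobiKernel α β 0`. -/
def jacobiKernel (α β : ℝ) (N : ℕ) (s t : ℝ) : ℝ :=
  ∑ k ∈ Finset.range N, jacobiON α β k s * jacobiON α β k t

/-- The angles `θ_1, …, θ_n ∈ (0, π)` (in any order) for which `cos θ_k` are the `n` zeros of
`P_n^{(α,β)}`. -/
def IsZeroAngles (α β : ℝ) (n : ℕ) (θ : Fin n → ℝ) : Prop :=
  Function.Injective θ ∧
    ∀ k, θ k ∈ Set.Ioo 0 Real.pi ∧ (jacobi α β n).IsRoot (Real.cos (θ k))

/-- The Gaussian weight `λ_k^{(α,β)} = [k_n^{(α,β)}(x_k, x_k)]⁻¹` at `x_k = cos θ_k`. -/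
def gaussWeight (α β : ℝ) (n : ℕ) (θ : Fin n → ℝ) (k : Fin n) : ℝ :=
  (jacobiKernel α β (n + 1) (Real.cos (θ k)) (Real.cos (θ k)))⁻¹

/-! ### Polynomials and cubature in two variables -/

/-- The square `[-1,1]^2`. -/
def square : Set (ℝ × ℝ) := Set.Icc (-1) 1 ×ˢ Set.Icc (-1) 1

/-- The value of a polynomial in two variables at a point of the plane. -/
def evalAt (p : MvPolynomial (Fin 2) ℝ) (z : ℝ × ℝ) : ℝ := MvPolynomial.eval ![z.1, z.2] p

/-- `Π_m^2`, the polynomials in two variables of total degree at most `m`. -/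
abbrev polys (m : ℕ) : Submodule ℝ (MvPolynomial (Fin 2) ℝ) :=
  MvPolynomial.restrictTotalDegree (Fin 2) ℝ m

/-- The finite sum `∑ ν, wt ν * f (node ν)` is a cubature rule with pairwise distinct nodes in the
square, nonzero weights, and precision `s` for the weight function `W` on the square: it is exact on
`Π_s^2`, and not exact on `Π_{s+1}^2`. -/
structure IsCubatureRule (W : ℝ × ℝ → ℝ) (s : ℕ) {ι : Type} [Fintype ι]
    (node : ι → ℝ × ℝ) (wt : ι → ℝ) : Prop where
  injective : Function.Injective node
  mem_square : ∀ ν, node ν ∈ square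
  weight_ne_zero : ∀ ν, wt ν ≠ 0
  exact_of_mem : ∀ p ∈ polys s, IntegrableOn (fun z => evalAt p z * W z) square ∧
    ∫ z in square, evalAt p z * W z = ∑ ν, wt ν * evalAt p (node ν)
  exists_not_exact : ∃ p ∈ polys (s + 1), IntegrableOn (fun z => evalAt p z * W z) square ∧
    ∫ z in square, evalAt p z * W z ≠ ∑ ν, wt ν * evalAt p (node ν)

/-- `K` is, on the square, the reproducing kernel of `Π_m^2` in `L^2(W)`. -/
structure IsReproducingKernel (W : ℝ × ℝ → ℝ) (m : ℕ) (K : ℝ × ℝ → ℝ × ℝ → ℝ) : Prop where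
  polynomial : ∀ z ∈ square, ∃ q ∈ polys m, ∀ w ∈ square, K z w = evalAt q w
  reproducing : ∀ p ∈ polys m, ∀ z ∈ square,
    IntegrableOn (fun w => K z w * evalAt p w * W w) square ∧
      ∫ w in square, K z w * evalAt p w * W w = evalAt p z

/-! ### The weight function `𝒲_{α,β}`, its polynomials and kernels -/

/-- The weight function `𝒲_{α,β}` on the square, normalized to have integral `1`. -/
def weight (α β : ℝ) (z : ℝ × ℝ) : ℝ :=
  jacobiConst α β ^ 2 * (|z.1 - z.2| ^ (2 * α + 1) * |z.1 + z.2| ^ (2 * β + 1)) /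
    (√(1 - z.1 ^ 2) * √(1 - z.2 ^ 2))

/-- `cos (θ - φ)` at the point `(cos θ, cos φ)`, `0 ≤ θ, φ ≤ π`, of the square. -/
def cosDiff (z : ℝ × ℝ) : ℝ := Real.cos (Real.arccos z.1 - Real.arccos z.2)

/-- `cos (θ + φ)` at the point `(cos θ, cos φ)`, `0 ≤ θ, φ ≤ π`, of the square. -/
def cosSum (z : ℝ × ℝ) : ℝ := Real.cos (Real.arccos z.1 + Real.arccos z.2)

/-- With `k = k_{N-1}^{(α,β)}`, the kernel `K_{N-1}^{α,β}` (polynomials of degree **less than** `N`;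
it is `0` for `N = 0`), as a function of the points `z`, `w` of the square:
`½ [k(cos(θ₁-θ₂), cos(φ₁-φ₂)) k(cos(θ₁+θ₂), cos(φ₁+φ₂))
  + k(cos(θ₁-θ₂), cos(φ₁+φ₂)) k(cos(θ₁+θ₂), cos(φ₁-φ₂))]`
for `z = (cos θ₁, cos θ₂)`, `w = (cos φ₁, cos φ₂)`. -/
def kernelK (α β : ℝ) (N : ℕ) (z w : ℝ × ℝ) : ℝ :=
  1 / 2 *
    (jacobiKernel α β N (cosDiff z) (cosDiff w) * jacobiKernel α β N (cosSum z) (cosSum w) +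
      jacobiKernel α β N (cosDiff z) (cosSum w) * jacobiKernel α β N (cosSum z) (cosDiff w))

/-- `d_{α,β}^{(i,j)} = c_{α+i,β+j}^2 / c_{α,β}^2`. -/
def dConst (α β : ℝ) (i j : ℕ) : ℝ := jacobiConst (α + i) (β + j) ^ 2 / jacobiConst α β ^ 2

/-- The closed formula for the kernel `𝒦_{2n-1}^{α,β}`, for `n ≥ 1`; its four terms contain
`K_{n-1}^{α,β}`, `K_{n-2}^{α+1,β+1}`, `K_{n-1}^{α,β+1}` and `K_{n-1}^{α+1,β}`. -/
def kernelOdd (α β : ℝ) (n : ℕ) (z w : ℝ × ℝ) : ℝ :=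
  kernelK α β n z w +
    dConst α β 1 1 * (z.1 ^ 2 - z.2 ^ 2) * (w.1 ^ 2 - w.2 ^ 2) *
      kernelK (α + 1) (β + 1) (n - 1) z w +
    dConst α β 0 1 * (z.1 + z.2) * (w.1 + w.2) * kernelK α (β + 1) n z w +
    dConst α β 1 0 * (z.1 - z.2) * (w.1 - w.2) * kernelK (α + 1) β n z w

/-- The orthonormal polynomial `₂Q_{k,2n}^{(α,β)}`, `0 ≤ k ≤ n - 1`, as a function on the square;
there is an additional factor `√2 / 2` when `k = n - 1`. -/
def Q₂ (α β : ℝ) (n k : ℕ) (z : ℝ × ℝ) : ℝ :=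
  (if k + 1 = n then √2 / 2 else 1) *
    (jacobiConst (α + 1) (β + 1) / (√2 * jacobiConst α β)) * (z.1 ^ 2 - z.2 ^ 2) *
    (jacobiON (α + 1) (β + 1) (n - 1) (cosDiff z) * jacobiON (α + 1) (β + 1) k (cosSum z) +
      jacobiON (α + 1) (β + 1) k (cosDiff z) * jacobiON (α + 1) (β + 1) (n - 1) (cosSum z))

/-- `Π*_{2n}`, the sum of `Π_{2n-1}^2` and the span of the polynomials `₂Q_{k,2n}`,
`0 ≤ k ≤ n - 1` (a polynomial is determined by its values on the square). -/
def piStar (α β : ℝ) (n : ℕ) : Submodule ℝ (MvPolynomial (Fin 2) ℝ) :=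
  polys (2 * n - 1) ⊔
    Submodule.span ℝ {q | ∃ k < n, ∀ z ∈ square, evalAt q z = Q₂ α β n k z}

/-- The kernel `𝒦_{2n-1}^{α,β}(z,w) + ∑_{k<n} b_k ₂Q_{k,2n}(z) ₂Q_{k,2n}(w)`. -/
def kernelStar (α β : ℝ) (n : ℕ) (b : Fin n → ℝ) (z w : ℝ × ℝ) : ℝ :=
  kernelOdd α β n z w + ∑ k : Fin n, b k * Q₂ α β n k z * Q₂ α β n k w

/-- The coefficients `b_{k,n}`: with `r = (1+α+β+n)/(1+α+β+2n)`, they are `r` for `k ≤ n - 2` and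
`r^2` for `k = n - 1`. -/
def bCoeff (α β : ℝ) (n : ℕ) (k : Fin n) : ℝ :=
  if (k : ℕ) + 1 = n then ((1 + α + β + n) / (1 + α + β + 2 * n)) ^ 2
  else (1 + α + β + n) / (1 + α + β + 2 * n)

/-! ### The nodes -/

/-- The index `((j, k), i)` with `j ≤ k` of the node `𝐱_{j,k}^{(i+1)}`. -/
abbrev NodeIndex (n : ℕ) : Type := {p : Fin n × Fin n // p.1 ≤ p.2} × Fin 4

/-- The nodes `(s,t)`, `(t,s)`, `(-s,-t)`, `(-t,-s)` with `s = cos ((θ_j-θ_k)/2)`,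
`t = cos ((θ_j+θ_k)/2)`. -/
def node {n : ℕ} (θ : Fin n → ℝ) (ν : NodeIndex n) : ℝ × ℝ :=
  let s : ℝ := Real.cos ((θ ν.1.1.1 - θ ν.1.1.2) / 2)
  let t : ℝ := Real.cos ((θ ν.1.1.1 + θ ν.1.1.2) / 2)
  (![(s, t), (t, s), (-s, -t), (-t, -s)] : Fin 4 → ℝ × ℝ) ν.2

/-- The weight `½ λ_j λ_k` of a node, with `½` replaced by `¼` when `j = k`. -/
def nodeWeight (α β : ℝ) {n : ℕ} (θ : Fin n → ℝ) (ν : NodeIndex n) : ℝ :=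
  (if ν.1.1.1 = ν.1.1.2 then 1 / 4 else 1 / 2) *
    gaussWeight α β n θ ν.1.1.1 * gaussWeight α β n θ ν.1.1.2

/-- The fundamental interpolation polynomial `½ λ_j λ_k 𝒦*_{2n}(·, 𝐱_{j,k}^{(i)})` (with `¼` for `½`
when `j = k`). -/
def fundamental (α β : ℝ) {n : ℕ} (θ : Fin n → ℝ) (ν : NodeIndex n) (z : ℝ × ℝ) : ℝ :=
  nodeWeight α β θ ν * kernelStar α β n (bCoeff α β n) z (node θ ν)

end MinCub

end

open MinCub

/-!
The point `(cos θ₁, cos θ₂)` of the square is described by `u = cos (θ₁ - θ₂)` and `v = cos (θ₁ +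
θ₂)`. Symmetric polynomials in `u` and `v` are polynomials in `x₁` and `x₂`
(`exists_symm_polynomial`), and `(x₁ ± x₂)^2 = (1 ± u) * (1 ± v)`. The polynomials in two
variables are spanned by the products `(x₁ + x₂)^a * (x₁ - x₂)^b` (`polys_le_span_sumDiff`), which
fall into four classes by the parities of the exponents. Within a class, integrals, kernels and
sums over the nodes factor into their counterparts in one variable, for the Jacobi weight
multiplied by `1 - t` or `1 + t` where the exponent is odd.

*Integrals.* The endomorphism `(a, b) ↦ (a + b, a - b)` of the torus preserves Haar measure
(`lintegral_addCircle_add_mul_sub`), so the total mass of the weight on the square is a square.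
Even powers of `x₁ ± x₂` only shift its parameters, so each even moment is the square of a moment
of the Jacobi weight (`integral_even_moment`); the other moments vanish by symmetry.

*Cubature.* At the four nodes belonging to a pair of zeros, `{u, v}` is this pair, and the signs
of `x₁ + x₂` and `x₁ - x₂` take all four combinations. So the sum over the nodes of an even
product is the square of a Gauss sum, and the other sums vanish. Gauss quadrature is exact in
degree `2n - 1`, which gives precision `4n - 1` (`cubature_exact`); in degree `2n` it has the
error computed in `gauss_error`, which does not vanish (`cubature_not_exact`).

*Reproducing kernel.* `𝒦_{2n-1}(z, ·) p` has degree at most `4n - 2`, so its integral is a sum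
over the nodes. Only the part of the kernel with the parities of `p` contributes, and its
contribution factors into Gauss sums that reproduce polynomials in one variable
(`sum_nodes_parityKernel_mul_sumDiff`, `discrete_reproducing`).

*The coefficients.* The kernel in one variable with shifts `(i, j)`, inserted in the Gauss sum,
has to reproduce the polynomials of degree `n - 1`, since a discrete reproducing kernel for as
many dimensions as points is diagonal at these points (`kernel_eq_ite_of_reproducing`). For three
of the classes Gauss quadrature is exact. For `(1, 1)` it fails on the products of
`p_{n-1}^{(α+1,β+1)}` with polynomials of degree `n - 1`. By the ratio of leading coefficients
(`leadingCoeff_ratio`, from the fact that `(P_n^{(α,β)})'` is a multiple of `P_{n-1}^{(α+1,β+1)}`,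
and from the differential equation), the Gauss sum is `(1+α+β+2n)/(1+α+β+n)` times the integral
(`sum_gaussWeight_mul_last`), so the last term of the kernel has to be multiplied by the inverse
of this factor (`discrete_reproducing_star`). The symmetrized product of the modified kernel with
itself is the `(1, 1)` part of `𝒦*_{2n}` (`kernelStar_eq`), and this is where the coefficients
come from.

*Interpolation.* As all four kernels are diagonal at the zeros, orthogonality of characters of a
group of order four makes `𝒦*_{2n}` diagonal at the nodes, with the inverse weights on the
diagonal (`nodeWeight_mul_kernelStar`). Hence the nodes are distinct, the fundamental polynomials
interpolate, and interpolation is unique because the dimension of `Π*_{2n}` is at most the number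
of nodes (`finrank_piStar_le`, `card_nodeIndex`). The coefficients are unique because the squares
of the `Q_k` are linearly independent on the nodes
(`IsOrthonormalSeq.eq_zero_of_sum_mul_sq_eq_zero`).
-/

noncomputable section

namespace MinCub

section OneVariable

open Polynomial

/-! ### Orthonormal polynomials and Gauss quadrature for a linear functional -/

/-- `p i` has degree `i` and `(p i)` is orthonormal for the bilinear form `(f, g) ↦ L (f * g)`. -/
structure IsOrthonormalSeq (L : ℝ[X] →ₗ[ℝ] ℝ) (p : ℕ → ℝ[X]) : Prop where
  natDegree_eq : ∀ i, (p i).natDegree = i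
  apply_mul : ∀ i j, L (p i * p j) = if i = j then 1 else 0

theorem degree_mul_lt_add {f g : ℝ[X]} {m n : ℕ} (hf : f.degree < m) (hg : g.degree < n) :
    (f * g).degree < ((m + n : ℕ) : WithBot ℕ) := by
  by_cases hf0 : f = 0
  · simp [hf0]
  by_cases hg0 : g = 0
  · simp [hg0]
  rw [← natDegree_lt_iff_degree_lt (mul_ne_zero hf0 hg0), natDegree_mul hf0 hg0]
  exact add_lt_add ((natDegree_lt_iff_degree_lt hf0).mpr hf)
    ((natDegree_lt_iff_degree_lt hg0).mpr hg)

theorem apply_C_mul (L : ℝ[X] →ₗ[ℝ] ℝ) (c : ℝ) (q : ℝ[X]) : L (C c * q) = c * L q := by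
  rw [← smul_eq_C_mul, map_smul, smul_eq_mul]

/-- If a discrete form reproduces the polynomials of degree `< n` from their values at `n` points
with the help of a kernel `K`, then the matrix of `K` at these points is diagonal. -/
theorem kernel_eq_ite_of_reproducing {n : ℕ} {x : Fin n → ℝ}
    (hx : Function.Injective x) {v : Fin n → ℝ} {K : ℝ → ℝ → ℝ}
    (h : ∀ q : ℝ[X], q.degree < n → ∀ t, ∑ k, v k * K t (x k) * q.eval (x k) = q.eval t)
    (j k : Fin n) : v k * K (x j) (x k) = if j = k then 1 else 0 := by
  have h1 := h (Lagrange.basis Finset.univ x k) (by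
    rw [Lagrange.degree_basis hx.injOn (Finset.mem_univ k)]
    have : 0 < n := k.pos
    simp
    omega) (x j)
  rw [Finset.sum_eq_single k] at h1
  · rw [Lagrange.eval_basis_self hx.injOn (Finset.mem_univ k), mul_one] at h1
    rw [h1]
    split_ifs with hjk
    · rw [hjk, Lagrange.eval_basis_self hx.injOn (Finset.mem_univ k)]
    · exact Lagrange.eval_basis_of_ne (Ne.symm hjk) (Finset.mem_univ j)
  · intro i _ hi
    rw [Lagrange.eval_basis_of_ne hi.symm (Finset.mem_univ i), mul_zero]
  · simp

namespace IsOrthonormalSeq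

variable {L : ℝ[X] →ₗ[ℝ] ℝ} {p : ℕ → ℝ[X]} (hp : IsOrthonormalSeq L p)
include hp

theorem ne_zero (i : ℕ) : p i ≠ 0 := by
  intro h
  have := hp.apply_mul i i
  simp [h] at this

theorem degree_eq (i : ℕ) : (p i).degree = i := by
  rw [degree_eq_natDegree (hp.ne_zero i), hp.natDegree_eq]

theorem coeff_ne_zero (i : ℕ) : (p i).coeff i ≠ 0 := by
  have := leadingCoeff_ne_zero.mpr (hp.ne_zero i)
  rwa [leadingCoeff, hp.natDegree_eq] at this

/-- Subtracting a multiple of `p N` removes the coefficient of degree `N`. -/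
theorem degree_sub_lt {N : ℕ} {q : ℝ[X]} (hq : q.degree < (N + 1 : ℕ)) :
    (q - C (q.coeff N / (p N).coeff N) * p N).degree < N := by
  rw [degree_lt_iff_coeff_zero]
  intro m hm
  rcases hm.eq_or_lt with rfl | hm
  · simp [div_mul_cancel₀ _ (hp.coeff_ne_zero N)]
  · have h1 : q.coeff m = 0 := (degree_lt_iff_coeff_zero _ _).mp hq m hm
    have h2 : (p N).coeff m = 0 :=
      coeff_eq_zero_of_natDegree_lt (by rw [hp.natDegree_eq]; exact hm)
    simp [h1, h2]

theorem degree_sum_C_mul_lt (N : ℕ) (a : ℕ → ℝ) :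
    (∑ i ∈ Finset.range N, C (a i) * p i).degree < N := by
  refine (degree_lt_iff_coeff_zero _ _).mpr fun m hm => ?_
  rw [finsetSum_coeff]
  refine Finset.sum_eq_zero fun i hi => ?_
  rw [coeff_C_mul, coeff_eq_zero_of_natDegree_lt, mul_zero]
  rw [hp.natDegree_eq]; exact (Finset.mem_range.mp hi).trans_le hm

theorem exists_eq_sum {N : ℕ} : ∀ {q : ℝ[X]}, q.degree < N →
    ∃ a : ℕ → ℝ, q = ∑ i ∈ Finset.range N, C (a i) * p i := by
  induction N with
  | zero =>
    intro q hq
    refine ⟨0, ?_⟩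
    have : q = 0 := by
      rw [← degree_eq_bot]
      exact Nat.WithBot.lt_zero_iff.mp (by simpa using hq)
    simp [this]
  | succ N ih =>
    intro q hq
    obtain ⟨a, ha⟩ := ih (hp.degree_sub_lt hq)
    refine ⟨Function.update a N (q.coeff N / (p N).coeff N), ?_⟩
    rw [Finset.sum_range_succ, Function.update_self, ← sub_eq_iff_eq_add, ha]
    refine Finset.sum_congr rfl fun i hi => ?_
    rw [Function.update_of_ne (Finset.mem_range.mp hi).ne]

theorem apply_mul_eq_zero {N : ℕ} {q : ℝ[X]} (hq : q.degree < N) : L (q * p N) = 0 := by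
  obtain ⟨a, rfl⟩ := hp.exists_eq_sum hq
  rw [Finset.sum_mul, map_sum]
  refine Finset.sum_eq_zero fun i hi => ?_
  rw [mul_assoc, apply_C_mul, hp.apply_mul, if_neg (Finset.mem_range.mp hi).ne, mul_zero]

/-- The expansion of a polynomial of degree `< N` in the orthonormal basis, evaluated at `t`; in
other words, `∑ i < N, p i s * p i t` is a reproducing kernel. -/
theorem sum_apply_mul_eval {N : ℕ} {q : ℝ[X]} (hq : q.degree < N) (t : ℝ) :
    ∑ i ∈ Finset.range N, L (p i * q) * (p i).eval t = q.eval t := by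
  obtain ⟨a, rfl⟩ := hp.exists_eq_sum hq
  rw [eval_finsetSum]
  refine Finset.sum_congr rfl fun i hi => ?_
  rw [Finset.mul_sum, map_sum, Finset.sum_eq_single i]
  · rw [mul_left_comm, apply_C_mul, hp.apply_mul]; simp
  · intro j _ hj
    rw [mul_left_comm, apply_C_mul, hp.apply_mul, if_neg hj.symm, mul_zero]
  · intro h; exact absurd hi h

/-- The reproducing kernel of the polynomials of degree `< N`. -/
theorem apply_kernel_mul {N : ℕ} {q : ℝ[X]} (hq : q.degree < N) (t : ℝ) :
    L ((∑ i ∈ Finset.range N, C ((p i).eval t) * p i) * q) = q.eval t := by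
  rw [← hp.sum_apply_mul_eval hq t, Finset.sum_mul, map_sum]
  refine Finset.sum_congr rfl fun i _ => ?_
  rw [mul_assoc, apply_C_mul, mul_comm]

theorem kernel_self_inv_pos {n : ℕ} (hn : 0 < n) (t : ℝ) :
    0 < (∑ i ∈ Finset.range n, (p i).eval t * (p i).eval t)⁻¹ := by
  rw [inv_pos]
  refine Finset.sum_pos' (fun i _ => mul_self_nonneg _) ⟨0, Finset.mem_range.mpr hn, ?_⟩
  rw [eq_C_of_natDegree_eq_zero (hp.natDegree_eq 0), eval_C]
  exact mul_self_pos.mpr (hp.coeff_ne_zero 0)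

section Gauss

variable {n : ℕ} {x : Fin n → ℝ} (hx : Function.Injective x) (hroot : ∀ k, (p n).eval (x k) = 0)
include hx hroot

/-- Gauss quadrature with some weights: modulo `p n`, a polynomial of degree `< 2 * n` changes
neither its image under `L` nor its values at the zeros of `p n`. -/
theorem exists_gauss : ∃ w : Fin n → ℝ, ∀ f : ℝ[X], f.degree < (2 * n : ℕ) →
    L f = ∑ k, w k * f.eval (x k) := by
  refine ⟨fun k => L (Lagrange.basis Finset.univ x k), fun f hf => ?_⟩
  have hn0 := hp.ne_zero n
  have hr : (f % p n).degree < n := by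
    rw [← hp.degree_eq n]; exact degree_mod_lt _ hn0
  have hq : (f / p n).degree < n := by
    by_cases hle : (p n).degree ≤ f.degree
    · have h1 := degree_add_div hn0 hle
      by_contra hcon
      rw [not_lt] at hcon
      have h2 : ((n : WithBot ℕ) + n) ≤ f.degree := by
        rw [← h1, hp.degree_eq]; gcongr
      have h3 := h2.trans_lt hf
      rw [two_mul] at h3
      exact absurd h3 (by simp)
    · rw [(Polynomial.div_eq_zero_iff hn0).mpr (not_le.mp hle)]
      simp
  have hev : ∀ k, (f % p n).eval (x k) = f.eval (x k) := by
    intro k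
    conv_rhs => rw [← EuclideanDomain.div_add_mod f (p n)]
    simp [hroot]
  have hL : L f = L (f % p n) := by
    conv_lhs => rw [← EuclideanDomain.div_add_mod f (p n)]
    rw [map_add, mul_comm, hp.apply_mul_eq_zero hq, zero_add]
  rw [hL, Lagrange.eq_interpolate (s := Finset.univ) (v := x) (f := f % p n) hx.injOn
    (by simpa using hr), Lagrange.interpolate_apply, map_sum]
  refine Finset.sum_congr rfl fun k _ => ?_
  rw [apply_C_mul, hev, mul_comm]

/-- Gauss quadrature, with the weights given by the reproducing kernel on the diagonal: on
polynomials of degree `< n` the quadrature inherits the reproducing property. -/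
theorem gauss {f : ℝ[X]} (hf : f.degree < (2 * n : ℕ)) :
    L f = ∑ k, (∑ i ∈ Finset.range n, (p i).eval (x k) * (p i).eval (x k))⁻¹ * f.eval (x k) := by
  obtain ⟨w, hw⟩ := hp.exists_gauss hx hroot
  rw [hw f hf]
  refine Finset.sum_congr rfl fun k _ => ?_
  have h := kernel_eq_ite_of_reproducing (v := w)
    (K := fun s t => ∑ i ∈ Finset.range n, (p i).eval s * (p i).eval t) hx (fun q hq t => by
      have h1 := hp.apply_kernel_mul hq t
      rw [hw] at h1
      · rw [← h1]
        refine Finset.sum_congr rfl fun k _ => ?_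
        simp [eval_finsetSum, mul_assoc]
      · rw [two_mul]
        exact degree_mul_lt_add (hp.degree_sum_C_mul_lt _ _) hq) k k
  simp only [if_true] at h
  rw [eq_inv_of_mul_eq_one_left h]

/-- The error of Gauss quadrature in degree `2n`, the first one in which it is not exact. -/
theorem gauss_error {f : ℝ[X]} (hf : f.natDegree ≤ 2 * n) :
    L f = ∑ k, (∑ i ∈ Finset.range n, (p i).eval (x k) * (p i).eval (x k))⁻¹ * f.eval (x k) +
      f.coeff (2 * n) / (p n).coeff n ^ 2 := by
  -- subtract the multiple of `p n ^ 2` with the same leading term: it vanishes at the nodes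
  have h0 := hp.coeff_ne_zero n
  have hc : (p n * p n).coeff (2 * n) = (p n).coeff n ^ 2 := by
    rw [two_mul, coeff_mul_add_eq_of_natDegree_le (hp.natDegree_eq n).le (hp.natDegree_eq n).le, sq]
  set c := f.coeff (2 * n) / (p n).coeff n ^ 2 with hcdef
  have hd : (f - C c * (p n * p n)).degree < (2 * n : ℕ) := by
    rw [degree_lt_iff_coeff_zero]
    intro m hm
    rcases hm.eq_or_lt with rfl | hm
    · rw [coeff_sub, coeff_C_mul, hc, hcdef, div_mul_cancel₀ _ (pow_ne_zero 2 h0), sub_self]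
    · rw [coeff_sub, coeff_C_mul, coeff_eq_zero_of_natDegree_lt (hf.trans_lt hm),
        coeff_eq_zero_of_natDegree_lt (p := p n * p n), mul_zero, sub_zero]
      refine natDegree_mul_le.trans_lt ?_
      rw [hp.natDegree_eq]; omega
  have h1 := hp.gauss hx hroot hd
  rw [map_sub, apply_C_mul, hp.apply_mul, if_pos rfl, mul_one, sub_eq_iff_eq_add] at h1
  rw [h1]
  congr 1
  refine Finset.sum_congr rfl fun k _ => ?_
  simp [hroot]

end Gauss

end IsOrthonormalSeq

/-! ### The Jacobi functional -/

theorem intervalIntegrable_jacobiWeight {α β : ℝ} (hα : -1 < α) (hβ : -1 < β) :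
    IntervalIntegrable (jacobiWeight α β) volume (-1) 1 := by
  have h1 : IntervalIntegrable (jacobiWeight α β) volume (-1) 0 := by
    have h : IntervalIntegrable (fun t : ℝ => (1 + t) ^ β) volume (-1) 0 := by
      have := (intervalIntegral.intervalIntegrable_rpow' (a := 0) (b := 1) hβ).comp_add_left 1
      simpa using this
    refine h.continuousOn_mul ?_
    refine ContinuousOn.rpow_const (by fun_prop) fun t ht => Or.inl ?_
    rw [Set.uIcc_of_le (by norm_num)] at ht
    linarith [ht.2]
  have h2 : IntervalIntegrable (jacobiWeight α β) volume 0 1 := by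
    have h : IntervalIntegrable (fun t : ℝ => (1 - t) ^ α) volume 0 1 := by
      have := (intervalIntegral.intervalIntegrable_rpow' (a := 1) (b := 0) hα).comp_sub_left 1
      simpa using this
    refine h.mul_continuousOn ?_
    refine ContinuousOn.rpow_const (by fun_prop) fun t ht => Or.inl ?_
    rw [Set.uIcc_of_le (by norm_num)] at ht
    linarith [ht.1]
  exact h1.trans h2

theorem jacobiWeight_pos (α β : ℝ) {t : ℝ} (ht : t ∈ Set.Ioo (-1 : ℝ) 1) :
    0 < jacobiWeight α β t :=
  mul_pos (Real.rpow_pos_of_pos (by linarith [ht.2]) _)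
    (Real.rpow_pos_of_pos (by linarith [ht.1]) _)

section

variable {α β : ℝ} (hα : -1 < α) (hβ : -1 < β)
include hα hβ

theorem intervalIntegrable_eval_mul_jacobiWeight (p : ℝ[X]) :
    IntervalIntegrable (fun t => p.eval t * jacobiWeight α β t) volume (-1) 1 :=
  (intervalIntegrable_jacobiWeight hα hβ).continuousOn_mul p.continuous.continuousOn

/-- A nonzero polynomial that is nonnegative on `(-1, 1)` has a positive integral. -/
theorem integral_eval_mul_jacobiWeight_pos {p : ℝ[X]} (hp : p ≠ 0)
    (h : ∀ t ∈ Set.Ioo (-1 : ℝ) 1, 0 ≤ p.eval t) :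
    0 < ∫ t in (-1 : ℝ)..1, p.eval t * jacobiWeight α β t := by
  have hae : ∀ᵐ t ∂(volume.restrict (Set.Ioc (-1 : ℝ) 1)),
      0 ≤ p.eval t * jacobiWeight α β t := by
    rw [← Measure.restrict_congr_set Ioo_ae_eq_Ioc, ae_restrict_iff' measurableSet_Ioo]
    exact Filter.Eventually.of_forall fun t ht => mul_nonneg (h t ht) (jacobiWeight_pos α β ht).le
  rw [intervalIntegral.integral_pos_iff_support_of_nonneg_ae' (by
    rw [Set.uIoc_of_le (by norm_num)]; exact hae)
    (intervalIntegrable_eval_mul_jacobiWeight hα hβ p)]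
  refine ⟨by norm_num, ?_⟩
  have hsub : Set.Ioo (-1 : ℝ) 1 \ (p.roots.toFinset : Set ℝ) ⊆
      Function.support (fun t => p.eval t * jacobiWeight α β t) ∩ Set.Ioc (-1) 1 := by
    rintro t ⟨ht, ht'⟩
    refine ⟨mul_ne_zero ?_ (jacobiWeight_pos α β ht).ne', Set.Ioo_subset_Ioc_self ht⟩
    intro h0
    apply ht'
    simp [hp, h0]
  refine lt_of_lt_of_le ?_ (measure_mono hsub)
  rw [measure_sdiff_null ((p.roots.toFinset.finite_toSet).measure_zero _), Real.volume_Ioo]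
  norm_num

theorem jacobiConst_pos : 0 < jacobiConst α β := by
  have := integral_eval_mul_jacobiWeight_pos hα hβ (one_ne_zero (α := ℝ[X]))
    (fun t _ => by simp)
  simp only [eval_one, one_mul] at this
  exact inv_pos.mpr this

end

/-- The functional `p ↦ c_{α,β} ∫_{-1}^1 p w_{α,β}` on polynomials. -/
def jacobiL {α β : ℝ} (hα : -1 < α) (hβ : -1 < β) : ℝ[X] →ₗ[ℝ] ℝ where
  toFun p := jacobiConst α β * ∫ t in (-1 : ℝ)..1, p.eval t * jacobiWeight α β t
  map_add' p q := by
    simp only [eval_add, add_mul]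
    rw [intervalIntegral.integral_add (intervalIntegrable_eval_mul_jacobiWeight hα hβ p)
      (intervalIntegrable_eval_mul_jacobiWeight hα hβ q), mul_add]
  map_smul' c p := by
    simp only [eval_smul, smul_eq_mul, mul_assoc, intervalIntegral.integral_const_mul,
      RingHom.id_apply]
    ring

section

variable {α β : ℝ} (hα : -1 < α) (hβ : -1 < β)

theorem jacobiL_apply (p : ℝ[X]) : jacobiL hα hβ p =
    jacobiConst α β * ∫ t in (-1 : ℝ)..1, p.eval t * jacobiWeight α β t := rfl

theorem jacobiL_pos {p : ℝ[X]} (hp : p ≠ 0) (h : ∀ t ∈ Set.Ioo (-1 : ℝ) 1, 0 ≤ p.eval t) :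
    0 < jacobiL hα hβ p :=
  mul_pos (jacobiConst_pos hα hβ) (integral_eval_mul_jacobiWeight_pos hα hβ hp h)

/-- Shifting the parameters of the Jacobi functional amounts to a polynomial factor. -/
theorem jacobiL_shift {i j : ℕ} {α' β' : ℝ} (hα' : -1 < α') (hβ' : -1 < β') (hi : α' = α + i)
    (hj : β' = β + j) (p : ℝ[X]) :
    jacobiL hα' hβ' p = jacobiConst α' β' / jacobiConst α β *
      jacobiL hα hβ ((1 - X) ^ i * (1 + X) ^ j * p) := by
  rw [jacobiL_apply, jacobiL_apply, ← mul_assoc,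
    div_mul_cancel₀ _ (jacobiConst_pos hα hβ).ne']
  congr 1
  rw [intervalIntegral.integral_of_le (by norm_num), intervalIntegral.integral_of_le (by norm_num),
    integral_Ioc_eq_integral_Ioo, integral_Ioc_eq_integral_Ioo]
  refine setIntegral_congr_fun measurableSet_Ioo fun t ht => ?_
  have h1 : 0 < 1 - t := by linarith [ht.2]
  have h2 : 0 < 1 + t := by linarith [ht.1]
  simp only [jacobiWeight, hi, hj, Real.rpow_add h1, Real.rpow_add h2, Real.rpow_natCast]
  simp only [eval_mul, eval_pow, eval_sub, eval_add, eval_one, eval_X]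
  ring

/-- Integration by parts: the integral of the derivative of `(1-t)^(α+1) (1+t)^(β+1) p(t)` over
`[-1,1]` vanishes. -/
theorem jacobiL_derivative (p : ℝ[X]) :
    jacobiL hα hβ ((1 - X ^ 2) * derivative p +
      (C (β - α) - C (α + β + 2) * X) * p) = 0 := by
  rw [jacobiL_apply]
  have key := intervalIntegral.integral_eq_sub_of_hasDerivAt_of_le (a := -1) (b := 1)
    (f := fun t : ℝ => (1 - t) ^ (α + 1) * (1 + t) ^ (β + 1) * p.eval t)
    (f' := fun t => ((1 - X ^ 2) * derivative p +
      (C (β - α) - C (α + β + 2) * X) * p).eval t * jacobiWeight α β t) (by norm_num)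
    ?_ ?_ (intervalIntegrable_eval_mul_jacobiWeight hα hβ _)
  · rw [key]
    simp [Real.zero_rpow (show α + 1 ≠ 0 by linarith), Real.zero_rpow (show β + 1 ≠ 0 by linarith)]
  · refine ContinuousOn.mul (ContinuousOn.mul ?_ ?_) p.continuous.continuousOn
    · exact ContinuousOn.rpow_const (by fun_prop) fun t _ => Or.inr (by linarith)
    · exact ContinuousOn.rpow_const (by fun_prop) fun t _ => Or.inr (by linarith)
  · intro t ht
    have h1 : 0 < 1 - t := by linarith [ht.2]
    have h2 : 0 < 1 + t := by linarith [ht.1]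
    have e1 : HasDerivAt (fun t : ℝ => (1 - t) ^ (α + 1)) (-1 * (α + 1) * (1 - t) ^ α) t := by
      have := ((hasDerivAt_id t).const_sub 1).rpow_const (p := α + 1) (Or.inl h1.ne')
      simpa using this
    have e2 : HasDerivAt (fun t : ℝ => (1 + t) ^ (β + 1)) (1 * (β + 1) * (1 + t) ^ β) t := by
      have := ((hasDerivAt_id t).const_add 1).rpow_const (p := β + 1) (Or.inl h2.ne')
      simpa using this
    refine ((e1.mul e2).mul (p.hasDerivAt t)).congr_deriv ?_
    rw [Pi.mul_apply]
    simp only [jacobiWeight, Real.rpow_add h1, Real.rpow_add h2, Real.rpow_one, eval_add, eval_mul,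
      eval_sub, eval_C, eval_X, eval_pow, eval_one]
    ring

end

/-! ### Jacobi polynomials -/

/-- The `k`-th coefficient of `P_n^{(α,β)}` in powers of `(1 - X) / 2`. -/
def jacobiCoeff (α β : ℝ) (n k : ℕ) : ℝ :=
  (ascPochhammer ℝ n).eval (α + 1) / (n.factorial : ℝ) *
    ((ascPochhammer ℝ k).eval (-(n : ℝ)) * (ascPochhammer ℝ k).eval (n + α + β + 1) /
      ((ascPochhammer ℝ k).eval (α + 1) * (k.factorial : ℝ)))

/-- The polynomial whose value at `(1 - X) / 2` is `P_n^{(α,β)}`. -/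
def jacobiHyp (α β : ℝ) (n : ℕ) : ℝ[X] :=
  ∑ k ∈ Finset.range (n + 1), C (jacobiCoeff α β n k) * X ^ k

theorem jacobi_eq_comp (α β : ℝ) (n : ℕ) :
    jacobi α β n = (jacobiHyp α β n).comp (C (1 / 2) * (1 - X)) := by
  simp [jacobi, jacobiHyp, jacobiCoeff, Polynomial.sum_comp]

theorem ascPochhammer_eval_neg_ne_zero {n : ℕ} : ∀ {k : ℕ}, k ≤ n →
    (ascPochhammer ℝ k).eval (-(n : ℝ)) ≠ 0
  | 0, _ => by simp
  | k + 1, h => by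
    rw [ascPochhammer_succ_eval]
    refine mul_ne_zero (ascPochhammer_eval_neg_ne_zero (by omega)) ?_
    have : (k : ℝ) < n := by exact_mod_cast h
    linarith

theorem coeff_jacobiHyp (α β : ℝ) (n k : ℕ) :
    (jacobiHyp α β n).coeff k = jacobiCoeff α β n k := by
  rw [jacobiHyp, finsetSum_coeff]
  simp only [coeff_C_mul, coeff_X_pow, mul_ite, mul_one, mul_zero, Finset.sum_ite_eq,
    Finset.mem_range]
  split_ifs with h
  · rfl
  · rw [jacobiCoeff, ascPochhammer_eval_neg_coe_nat_of_lt (by omega)]; simp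

section

variable {α β : ℝ} (hα : -1 < α)
include hα

theorem jacobiCoeff_succ (n k : ℕ) :
    jacobiCoeff α β n (k + 1) * ((k + 1) * (α + 1 + k)) =
      jacobiCoeff α β n k * ((k - n) * (k + n + α + β + 1)) := by
  have h1 : (ascPochhammer ℝ k).eval (α + 1) ≠ 0 := (ascPochhammer_pos k _ (by linarith)).ne'
  have h2 : (k.factorial : ℝ) ≠ 0 := by positivity
  have h3 : α + 1 + (k : ℝ) ≠ 0 := by have : (0 : ℝ) ≤ k := k.cast_nonneg; linarith
  have h4 : (k : ℝ) + 1 ≠ 0 := by positivity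
  simp only [jacobiCoeff, ascPochhammer_succ_eval, Nat.factorial_succ, Nat.cast_mul,
    Nat.cast_succ]
  field_simp
  ring

/-- The hypergeometric differential equation. -/
theorem jacobiHyp_ode (n : ℕ) :
    X * (1 - X) * derivative (derivative (jacobiHyp α β n)) +
      (C (α + 1) - C (α + β + 2) * X) * derivative (jacobiHyp α β n) +
      C (n * (n + α + β + 1)) * jacobiHyp α β n = 0 := by
  -- products with `X` on the left, so that the coefficients can be read off
  have e : X * (1 - X) * derivative (derivative (jacobiHyp α β n)) +
      (C (α + 1) - C (α + β + 2) * X) * derivative (jacobiHyp α β n) +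
      C (n * (n + α + β + 1)) * jacobiHyp α β n =
      X * derivative (derivative (jacobiHyp α β n)) -
        X * (X * derivative (derivative (jacobiHyp α β n))) +
      C (α + 1) * derivative (jacobiHyp α β n) -
        C (α + β + 2) * (X * derivative (jacobiHyp α β n)) +
      C (n * (n + α + β + 1)) * jacobiHyp α β n := by ring
  rw [e]
  ext k
  have hk := jacobiCoeff_succ hα (β := β) n k
  rcases k with _ | _ | k
  all_goals
    simp only [coeff_add, coeff_sub, coeff_C_mul, coeff_X_mul, coeff_X_mul_zero, coeff_derivative,
      coeff_jacobiHyp, coeff_zero, zero_add] at hk ⊢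
    push_cast at hk ⊢
    linarith

/-- The differential equation of the Jacobi polynomials. -/
theorem jacobi_ode (n : ℕ) :
    (1 - X ^ 2) * derivative (derivative (jacobi α β n)) +
      (C (β - α) - C (α + β + 2) * X) * derivative (jacobi α β n) =
      - (C (n * (n + α + β + 1)) * jacobi α β n) := by
  have hd : derivative (C (1 / 2 : ℝ) * (1 - X)) = C (-1 / 2) := by
    simp [neg_div, derivative_mul]
  have h := congrArg (fun q : ℝ[X] => q.comp (C (1 / 2) * (1 - X))) (jacobiHyp_ode hα (β := β) n)
  simp only [add_comp, mul_comp, sub_comp, X_comp, C_comp, one_comp, zero_comp] at h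
  have e1 : (C (β - α) : ℝ[X]) = C β - C α := C_sub
  have e2 : (C (α + β + 2) : ℝ[X]) = C α + C β + 2 := by rw [C_add, C_add]; rfl
  have e3 : (C (α + 1) : ℝ[X]) = C α + 1 := by rw [C_add]; rfl
  have e4 : (C (-1 / 2) : ℝ[X]) = - C (1 / 2) := by rw [← C_neg]; congr 1; ring
  have e5 : (C (1 / 2) : ℝ[X]) * 2 = 1 := by
    rw [show (2 : ℝ[X]) = C 2 from rfl, ← C_mul]; norm_num
  have d1 : derivative (jacobi α β n) =
      - C (1 / 2) * (derivative (jacobiHyp α β n)).comp (C (1 / 2) * (1 - X)) := by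
    rw [jacobi_eq_comp, derivative_comp, hd, e4]
  have d2 : derivative (derivative (jacobi α β n)) =
      C (1 / 2) ^ 2 *
        (derivative (derivative (jacobiHyp α β n))).comp (C (1 / 2) * (1 - X)) := by
    rw [d1, ← C_neg, derivative_C_mul, derivative_comp, hd, C_neg, e4]
    ring
  rw [d2, d1, jacobi_eq_comp, e1, e2]
  rw [e2, e3] at h
  generalize (derivative (derivative (jacobiHyp α β n))).comp (C (1 / 2) * (1 - X)) = F2 at *
  generalize (derivative (jacobiHyp α β n)).comp (C (1 / 2) * (1 - X)) = F1 at *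
  generalize (C (1 / 2) : ℝ[X]) = c at *
  linear_combination h + ((1 - X) * F2 * c + (C α + 1) * F1) * e5

end

/-! ### Orthonormality of Jacobi polynomials -/

section

variable {α β : ℝ} (hα : -1 < α) (hβ : -1 < β)
include hα hβ

theorem jacobiCoeff_self_ne_zero (n : ℕ) : jacobiCoeff α β n n ≠ 0 := by
  have h1 : (ascPochhammer ℝ n).eval (α + 1) ≠ 0 := (ascPochhammer_pos n _ (by linarith)).ne'
  have h2 : (n.factorial : ℝ) ≠ 0 := by positivity
  have h3 : (ascPochhammer ℝ n).eval (n + α + β + 1) ≠ 0 := by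
    rcases Nat.eq_zero_or_pos n with rfl | hn
    · simp
    · have : (1 : ℝ) ≤ n := by exact_mod_cast hn
      exact (ascPochhammer_pos n _ (by linarith)).ne'
  exact mul_ne_zero (div_ne_zero h1 h2) (div_ne_zero
    (mul_ne_zero (ascPochhammer_eval_neg_ne_zero le_rfl) h3) (mul_ne_zero h1 h2))

theorem natDegree_jacobi (n : ℕ) : (jacobi α β n).natDegree = n := by
  have h1 : (jacobiHyp α β n).natDegree = n := by
    refine natDegree_eq_of_le_of_coeff_ne_zero ?_ ?_
    · refine natDegree_sum_le_of_forall_le _ _ fun k hk => ?_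
      exact (natDegree_C_mul_X_pow_le _ _).trans (Nat.lt_succ_iff.mp (Finset.mem_range.mp hk))
    · rw [coeff_jacobiHyp]; exact jacobiCoeff_self_ne_zero hα hβ n
  have h2 : (C (1 / 2 : ℝ) * (1 - X)).natDegree = 1 := by
    rw [natDegree_C_mul (by norm_num), ← C_1, natDegree_sub_eq_right_of_natDegree_lt] <;> simp
  rw [jacobi_eq_comp, natDegree_comp, h1, h2, mul_one]

theorem jacobi_ne_zero (n : ℕ) : jacobi α β n ≠ 0 := by
  intro h0
  have := natDegree_jacobi hα hβ n
  rcases Nat.eq_zero_or_pos n with rfl | hn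
  · simp [jacobi] at h0
  · rw [h0, natDegree_zero] at this; omega

theorem degree_jacobi (n : ℕ) : (jacobi α β n).degree = n := by
  rw [degree_eq_natDegree (jacobi_ne_zero hα hβ n), natDegree_jacobi hα hβ]

/-- The differential equation in weak form. -/
theorem jacobiL_derivative_jacobi_mul (n : ℕ) (q : ℝ[X]) :
    jacobiL hα hβ ((1 - X ^ 2) * derivative (jacobi α β n) * derivative q) =
      n * (n + α + β + 1) * jacobiL hα hβ (jacobi α β n * q) := by
  have h := jacobiL_derivative hα hβ (derivative (jacobi α β n) * q)
  have e : (1 - X ^ 2) * derivative (derivative (jacobi α β n) * q) +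
      (C (β - α) - C (α + β + 2) * X) * (derivative (jacobi α β n) * q) =
      (1 - X ^ 2) * derivative (jacobi α β n) * derivative q -
        C (n * (n + α + β + 1)) * (jacobi α β n * q) := by
    rw [derivative_mul]
    linear_combination q * jacobi_ode hα (β := β) n
  rw [e, map_sub, sub_eq_zero, apply_C_mul] at h
  exact h

theorem jacobiL_jacobi_mul_jacobi {m n : ℕ} (h : m ≠ n) :
    jacobiL hα hβ (jacobi α β m * jacobi α β n) = 0 := by
  have h1 := jacobiL_derivative_jacobi_mul hα hβ m (jacobi α β n)
  have h2 := jacobiL_derivative_jacobi_mul hα hβ n (jacobi α β m)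
  rw [mul_right_comm, h1, mul_comm (jacobi α β n)] at h2
  have h3 : ((m : ℝ) - n) * (m + n + α + β + 1) *
      jacobiL hα hβ (jacobi α β m * jacobi α β n) = 0 := by linear_combination h2
  have h4 : (m : ℝ) - n ≠ 0 := sub_ne_zero.mpr (by exact_mod_cast h)
  have h5 : (1 : ℝ) ≤ m + n := by
    have : 1 ≤ m + n := by omega
    exact_mod_cast this
  have h6 : (m : ℝ) + n + α + β + 1 ≠ 0 := by linarith
  exact (mul_eq_zero.mp h3).resolve_left (mul_ne_zero h4 h6)

theorem jacobiNormSq_eq (n : ℕ) :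
    jacobiNormSq α β n = jacobiL hα hβ (jacobi α β n * jacobi α β n) := by
  simp only [jacobiNormSq, jacobiL_apply, eval_mul, sq]

theorem jacobiNormSq_pos (n : ℕ) : 0 < jacobiNormSq α β n := by
  rw [jacobiNormSq_eq hα hβ]
  refine jacobiL_pos hα hβ (mul_self_ne_zero.mpr (jacobi_ne_zero hα hβ n)) fun t _ => ?_
  rw [eval_mul]
  exact mul_self_nonneg _

end

/-- The orthonormal Jacobi polynomial as a polynomial. -/
def jacobiONPoly (α β : ℝ) (n : ℕ) : ℝ[X] := C (√(jacobiNormSq α β n))⁻¹ * jacobi α β n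

theorem eval_jacobiONPoly (α β : ℝ) (n : ℕ) (t : ℝ) :
    (jacobiONPoly α β n).eval t = jacobiON α β n t := by
  rw [jacobiONPoly, jacobiON, eval_mul, eval_C, div_eq_inv_mul]

section

variable {α β : ℝ} (hα : -1 < α) (hβ : -1 < β)

theorem isOrthonormalSeq_jacobi : IsOrthonormalSeq (jacobiL hα hβ) (jacobiONPoly α β) where
  natDegree_eq n := by
    rw [jacobiONPoly, natDegree_C_mul, natDegree_jacobi hα hβ]
    exact inv_ne_zero (Real.sqrt_ne_zero'.mpr (jacobiNormSq_pos hα hβ n))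
  apply_mul i j := by
    have e : jacobiONPoly α β i * jacobiONPoly α β j =
        C ((√(jacobiNormSq α β i))⁻¹ * (√(jacobiNormSq α β j))⁻¹) *
          (jacobi α β i * jacobi α β j) := by
      rw [jacobiONPoly, jacobiONPoly, C_mul]; ring
    rw [e, apply_C_mul]
    split_ifs with h
    · subst h
      rw [← jacobiNormSq_eq, ← mul_inv, Real.mul_self_sqrt (jacobiNormSq_pos hα hβ i).le,
        inv_mul_cancel₀ (jacobiNormSq_pos hα hβ i).ne']
    · rw [jacobiL_jacobi_mul_jacobi hα hβ h, mul_zero]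

include hα hβ

theorem jacobiL_jacobi_mul_eq_zero {n : ℕ} {q : ℝ[X]} (hq : q.degree < n) :
    jacobiL hα hβ (jacobi α β n * q) = 0 := by
  have h := (isOrthonormalSeq_jacobi hα hβ).apply_mul_eq_zero hq
  rw [jacobiONPoly, mul_left_comm, apply_C_mul, mul_comm q] at h
  exact (mul_eq_zero.mp h).resolve_left
    (inv_ne_zero (Real.sqrt_ne_zero'.mpr (jacobiNormSq_pos hα hβ n)))

/-! ### The zeros of Jacobi polynomials -/

/-- By orthogonality, a factor of a Jacobi polynomial that does not change sign on `(-1, 1)` is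
constant. -/
theorem natDegree_eq_zero_of_mul_eq_jacobi {n : ℕ} {f g : ℝ[X]} (h : f * g = jacobi α β n)
    (hf : ∀ t ∈ Set.Ioo (-1 : ℝ) 1, 0 ≤ f.eval t) : f.natDegree = 0 := by
  by_contra hdeg
  have h0 := jacobi_ne_zero hα hβ n
  rw [← h] at h0
  have hf0 := left_ne_zero_of_mul h0
  have hg0 := right_ne_zero_of_mul h0
  have hd : g.degree < n := by
    rw [← natDegree_lt_iff_degree_lt hg0, ← natDegree_jacobi hα hβ n, ← h, natDegree_mul hf0 hg0]
    omega
  have h1 := jacobiL_jacobi_mul_eq_zero hα hβ hd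
  rw [← h] at h1
  refine (jacobiL_pos hα hβ (mul_ne_zero h0 hg0) fun t ht => ?_).ne' h1
  rw [eval_mul, eval_mul, mul_assoc]
  exact mul_nonneg (hf t ht) (mul_self_nonneg _)

/-- Every nonconstant factor of a Jacobi polynomial has a zero in `(-1, 1)`, so there
are as many zeros as the degree, they are simple, and they lie in `(-1, 1)`. -/
theorem exists_root_of_mul_eq_jacobi {n : ℕ} {f g : ℝ[X]} (h : f * g = jacobi α β n)
    (hf : f.natDegree ≠ 0) : ∃ t ∈ Set.Ioo (-1 : ℝ) 1, f.eval t = 0 := by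
  by_contra! hne
  have hsign : (∀ t ∈ Set.Ioo (-1 : ℝ) 1, 0 ≤ f.eval t) ∨
      (∀ t ∈ Set.Ioo (-1 : ℝ) 1, f.eval t ≤ 0) := by
    by_contra! hcon
    obtain ⟨⟨a, ha, ha'⟩, ⟨b, hb, hb'⟩⟩ := hcon
    obtain ⟨t, ht, ht'⟩ := isPreconnected_Ioo.intermediate_value ha hb
      f.continuous.continuousOn ⟨ha'.le, hb'.le⟩
    exact hne t ht ht'
  rcases hsign with h1 | h1
  · exact hf (natDegree_eq_zero_of_mul_eq_jacobi hα hβ h h1)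
  · refine hf ?_
    rw [← natDegree_neg]
    refine natDegree_eq_zero_of_mul_eq_jacobi hα hβ (g := -g) (by rw [neg_mul_neg, h])
      fun t ht => ?_
    rw [eval_neg]; linarith [h1 t ht]

theorem card_roots_jacobi (n : ℕ) : Multiset.card (jacobi α β n).roots = n := by
  obtain ⟨g, hg, hdeg, hroots⟩ := exists_prod_multiset_X_sub_C_mul (jacobi α β n)
  have hg0 : g.natDegree = 0 := by
    by_contra hne
    obtain ⟨t, -, ht⟩ := exists_root_of_mul_eq_jacobi hα hβ ((mul_comm _ _).trans hg) hne
    have hgne : g ≠ 0 := fun h => hne (by rw [h, natDegree_zero])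
    have := (mem_roots hgne).mpr ht
    simp [hroots] at this
  rw [hg0, add_zero, natDegree_jacobi hα hβ] at hdeg
  exact hdeg

theorem nodup_roots_jacobi (n : ℕ) : (jacobi α β n).roots.Nodup := by
  classical
  rw [Multiset.nodup_iff_count_le_one]
  intro t
  rw [count_roots]
  by_contra! hcon
  obtain ⟨g, hg⟩ := (pow_dvd_pow _ hcon).trans (pow_rootMultiplicity_dvd (jacobi α β n) t)
  have := natDegree_eq_zero_of_mul_eq_jacobi hα hβ hg.symm fun s _ => by
    simp only [Nat.succ_eq_add_one, Nat.reduceAdd, eval_pow]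
    positivity
  simp at this

theorem mem_Ioo_of_isRoot_jacobi {n : ℕ} {t : ℝ} (ht : (jacobi α β n).IsRoot t) :
    t ∈ Set.Ioo (-1 : ℝ) 1 := by
  obtain ⟨g, hg⟩ := dvd_iff_isRoot.mpr ht
  obtain ⟨s, hs, hs'⟩ := exists_root_of_mul_eq_jacobi hα hβ hg.symm (by simp)
  have : s = t := by simpa [sub_eq_zero] using hs'
  rwa [← this]

theorem exists_isZeroAngles (n : ℕ) : ∃ θ : Fin n → ℝ, IsZeroAngles α β n θ := by
  classical
  have hcard : (jacobi α β n).roots.toFinset.card = n := by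
    rw [Multiset.toFinset_card_of_nodup (nodup_roots_jacobi hα hβ n),
      card_roots_jacobi hα hβ]
  let e := (Finset.equivFinOfCardEq hcard).symm
  have hroot : ∀ k, (jacobi α β n).IsRoot (e k : ℝ) := fun k => by
    have := (e k).2
    rw [Multiset.mem_toFinset] at this
    exact isRoot_of_mem_roots this
  have hIoo := fun k => mem_Ioo_of_isRoot_jacobi hα hβ (hroot k)
  have hcos : ∀ k, Real.cos (Real.arccos (e k : ℝ)) = e k := fun k =>
    Real.cos_arccos (hIoo k).1.le (hIoo k).2.le
  refine ⟨fun k => Real.arccos (e k), fun j k hjk => ?_, fun k => ⟨⟨?_, ?_⟩, ?_⟩⟩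
  · have := congrArg Real.cos hjk
    simp only [hcos] at this
    exact e.injective (Subtype.ext this)
  · exact Real.arccos_pos.mpr (hIoo k).2
  · refine lt_of_le_of_ne (Real.arccos_le_pi _) fun h => ?_
    have := Real.arccos_eq_pi.mp h
    linarith [(hIoo k).1]
  · rw [hcos]; exact hroot k

end

/-! ### Discrete reproducing kernels at the zeros of a Jacobi polynomial -/

namespace IsOrthonormalSeq

variable {L : ℝ[X] →ₗ[ℝ] ℝ} {p : ℕ → ℝ[X]}

theorem apply_mul_eq_coeff_div (hp : IsOrthonormalSeq L p) {N : ℕ} {q : ℝ[X]}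
    (hq : q.degree < (N + 1 : ℕ)) : L (p N * q) = q.coeff N / (p N).coeff N := by
  have h := hp.apply_mul_eq_zero (hp.degree_sub_lt hq)
  rw [sub_mul, map_sub, mul_assoc, apply_C_mul, hp.apply_mul, if_pos rfl, mul_one, sub_eq_zero] at h
  rw [mul_comm, h]

end IsOrthonormalSeq

section

variable {α β : ℝ} (hα : -1 < α) (hβ : -1 < β)
include hα hβ

/-- `P_{m+1}'` is orthogonal to the polynomials of degree `< m` for the weight
`(1 - t^2) w_{α,β}(t)`. -/
theorem jacobiL_derivative_jacobi_mul_eq_zero {m : ℕ} {g : ℝ[X]} (hg : g.degree < m) :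
    jacobiL hα hβ ((1 - X ^ 2) * (derivative (jacobi α β (m + 1)) * g)) = 0 := by
  have h := jacobiL_derivative hα hβ (jacobi α β (m + 1) * g)
  have hcoeff := (degree_lt_iff_coeff_zero _ _).mp hg
  have e : (1 - X ^ 2) * derivative (jacobi α β (m + 1) * g) +
      (C (β - α) - C (α + β + 2) * X) * (jacobi α β (m + 1) * g) =
      (1 - X ^ 2) * (derivative (jacobi α β (m + 1)) * g) + jacobi α β (m + 1) *
        (derivative g - X * (X * derivative g) + C (β - α) * g - C (α + β + 2) * (X * g)) := by
    rw [derivative_mul]; ring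
  rw [e, map_add, jacobiL_jacobi_mul_eq_zero hα hβ, add_zero] at h
  · exact h
  · rw [degree_lt_iff_coeff_zero]
    intro k hk
    obtain ⟨k, rfl⟩ : ∃ k', k = k' + 1 := ⟨k - 1, by omega⟩
    have h1 : g.coeff k = 0 := hcoeff k (by omega)
    have h2 : g.coeff (k + 1) = 0 := hcoeff (k + 1) (by omega)
    have h3 : g.coeff (k + 2) = 0 := hcoeff (k + 2) (by omega)
    rcases k with _ | k
    all_goals
      simp only [coeff_add, coeff_sub, coeff_C_mul, coeff_X_mul, coeff_X_mul_zero,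
        coeff_derivative, h1, h2, h3]
      simp

theorem jacobiL_shift_one_one (p : ℝ[X]) :
    jacobiL (α := α + 1) (β := β + 1) (by linarith) (by linarith) p =
      jacobiConst (α + 1) (β + 1) / jacobiConst α β * jacobiL hα hβ ((1 - X ^ 2) * p) := by
  rw [jacobiL_shift hα hβ (i := 1) (j := 1) _ _ (by simp) (by simp)]
  congr 3
  ring

/-- The ratio of the leading coefficients of `p_m^{(α+1,β+1)}` and `p_{m+1}^{(α,β)}`; the former
is a multiple of the derivative of the latter. -/
theorem leadingCoeff_ratio (m : ℕ) :
    jacobiConst (α + 1) (β + 1) / jacobiConst α β *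
      ((jacobiONPoly (α + 1) (β + 1) m).coeff m ^ 2 /
        (jacobiONPoly α β (m + 1)).coeff (m + 1) ^ 2) =
      ((m : ℝ) + 1) / (m + 1 + α + β + 1) := by
  have hα' : -1 < α + 1 := by linarith
  have hβ' : -1 < β + 1 := by linarith
  have hq := isOrthonormalSeq_jacobi hα' hβ'
  have hP := degree_jacobi hα hβ (m + 1)
  set P := jacobi α β (m + 1) with hPdef
  set q := jacobiONPoly (α + 1) (β + 1) m with hqdef
  have hc0 : P.coeff (m + 1) ≠ 0 := by
    have := leadingCoeff_ne_zero.mpr (jacobi_ne_zero hα hβ (m + 1))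
    rwa [leadingCoeff, natDegree_jacobi hα hβ] at this
  have hf : (derivative P).degree < (m + 1 : ℕ) := by
    rw [← hP]; exact degree_derivative_lt (jacobi_ne_zero hα hβ _)
  -- subtract the multiple `c q` of `q` with the leading term of `P'`: the difference is orthogonal
  -- to both `P'` and `q`, hence to itself
  have he := hq.degree_sub_lt hf
  rw [← hqdef] at he
  set c := (derivative P).coeff m / q.coeff m with hc
  have hzero : derivative P - C c * q = 0 := by
    by_contra hne
    refine (jacobiL_pos hα' hβ' (mul_self_ne_zero.mpr hne) fun t _ => by
      rw [eval_mul]; exact mul_self_nonneg _).ne' ?_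
    have h1 : jacobiL hα' hβ' (derivative P * (derivative P - C c * q)) = 0 := by
      rw [jacobiL_shift_one_one hα hβ, jacobiL_derivative_jacobi_mul_eq_zero hα hβ he, mul_zero]
    have h2 : jacobiL hα' hβ' ((derivative P - C c * q) * q) = 0 := hq.apply_mul_eq_zero he
    have e : (derivative P - C c * q) * (derivative P - C c * q) =
      derivative P * (derivative P - C c * q) - C c * ((derivative P - C c * q) * q) := by ring
    rw [e, map_sub, h1, apply_C_mul, h2]; simp
  -- compare the norms of `P'` and `c q`, using the differential equation for the former
  have hnorm : jacobiL hα' hβ' (derivative P * derivative P) = c ^ 2 := by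
    rw [sub_eq_zero.mp hzero]
    have e : C c * q * (C c * q) = C (c ^ 2) * (q * q) := by rw [C_pow]; ring
    rw [e, apply_C_mul, hq.apply_mul, if_pos rfl, mul_one]
  rw [jacobiL_shift_one_one hα hβ, ← mul_assoc, jacobiL_derivative_jacobi_mul hα hβ,
    ← jacobiNormSq_eq hα hβ] at hnorm
  have hh := jacobiNormSq_pos hα hβ (m + 1)
  have hp : (jacobiONPoly α β (m + 1)).coeff (m + 1) ^ 2 =
      P.coeff (m + 1) ^ 2 / jacobiNormSq α β (m + 1) := by
    rw [jacobiONPoly, coeff_C_mul, mul_pow, inv_pow, Real.sq_sqrt hh.le, div_eq_inv_mul]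
  have hq0 : q.coeff m ≠ 0 := hq.coeff_ne_zero m
  rw [hc, coeff_derivative] at hnorm
  rw [hp]
  push_cast at hnorm
  have hm1 : (m : ℝ) + 1 ≠ 0 := by positivity
  have hm2 : (m : ℝ) + 1 + α + β + 1 ≠ 0 := by
    have : (0 : ℝ) ≤ m := m.cast_nonneg
    linarith
  have hc1 := (jacobiConst_pos hα hβ).ne'
  field_simp at hnorm ⊢
  linear_combination hnorm

end

theorem natDegree_one_sub_X_pow_mul_le (i j : ℕ) :
    ((1 - X) ^ i * (1 + X) ^ j : ℝ[X]).natDegree ≤ i + j := by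
  have h1 : (1 - X : ℝ[X]).natDegree ≤ 1 := by compute_degree
  have h2 : (1 + X : ℝ[X]).natDegree ≤ 1 := by compute_degree
  refine natDegree_mul_le.trans (add_le_add ?_ ?_)
  · simpa using natDegree_pow_le_of_le i h1
  · simpa using natDegree_pow_le_of_le j h2

theorem natDegree_le_pred_of_degree_lt {N : ℕ} {g : ℝ[X]} (hg : g.degree < N) :
    g.natDegree ≤ N - 1 :=
  natDegree_le_iff_coeff_eq_zero.mpr fun m hm =>
    (degree_lt_iff_coeff_zero _ _).mp hg m (by omega)

theorem degree_lt_of_natDegree_lt {N : ℕ} {g : ℝ[X]} (hg : g.natDegree < N) : g.degree < N :=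
  degree_le_natDegree.trans_lt (by exact_mod_cast hg)

section ZeroAngles

variable {α β : ℝ} (hα : -1 < α) (hβ : -1 < β) {n : ℕ} {θ : Fin n → ℝ}

theorem IsZeroAngles.cos_injective (hθ : IsZeroAngles α β n θ) :
    Function.Injective fun k => Real.cos (θ k) := fun j k h =>
  hθ.1 (Real.injOn_cos (Set.Ioo_subset_Icc_self (hθ.2 j).1) (Set.Ioo_subset_Icc_self (hθ.2 k).1) h)

theorem IsZeroAngles.eval_eq_zero (hθ : IsZeroAngles α β n θ) (k : Fin n) :
    (jacobiONPoly α β n).eval (Real.cos (θ k)) = 0 := by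
  have h : (jacobi α β n).eval (Real.cos (θ k)) = 0 := (hθ.2 k).2
  rw [jacobiONPoly, eval_mul, h, mul_zero]

theorem gaussWeight_eq (hθ : IsZeroAngles α β n θ) (k : Fin n) :
    gaussWeight α β n θ k = (∑ i ∈ Finset.range n, (jacobiONPoly α β i).eval (Real.cos (θ k)) *
      (jacobiONPoly α β i).eval (Real.cos (θ k)))⁻¹ := by
  have h := hθ.eval_eq_zero k
  simp only [eval_jacobiONPoly] at h ⊢
  rw [gaussWeight, jacobiKernel, Finset.sum_range_succ, h, mul_zero, add_zero]

include hα hβ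

theorem gaussWeight_pos (hθ : IsZeroAngles α β n θ) (k : Fin n) : 0 < gaussWeight α β n θ k := by
  rw [gaussWeight_eq hθ]
  exact (isOrthonormalSeq_jacobi hα hβ).kernel_self_inv_pos k.pos _

theorem gauss_jacobi (hθ : IsZeroAngles α β n θ) {f : ℝ[X]} (hf : f.degree < (2 * n : ℕ)) :
    jacobiL hα hβ f = ∑ k, gaussWeight α β n θ k * f.eval (Real.cos (θ k)) := by
  simp only [gaussWeight_eq hθ]
  exact (isOrthonormalSeq_jacobi hα hβ).gauss hθ.cos_injective hθ.eval_eq_zero hf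

theorem gauss_jacobi_error (hθ : IsZeroAngles α β n θ) {f : ℝ[X]} (hf : f.natDegree ≤ 2 * n) :
    jacobiL hα hβ f = ∑ k, gaussWeight α β n θ k * f.eval (Real.cos (θ k)) +
      f.coeff (2 * n) / (jacobiONPoly α β n).coeff n ^ 2 := by
  simp only [gaussWeight_eq hθ]
  exact (isOrthonormalSeq_jacobi hα hβ).gauss_error hθ.cos_injective hθ.eval_eq_zero hf

/-- Inserting Gauss quadrature into the reproducing property of the kernel with shifted
parameters. -/
theorem discrete_reproducing (hθ : IsZeroAngles α β n θ) {i j N : ℕ} {α' β' : ℝ}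
    (hi : α' = α + i) (hj : β' = β + j) (hN : i + j + 2 * N ≤ 2 * n + 1) {g : ℝ[X]}
    (hg : g.degree < N) (t : ℝ) :
    ∑ k, gaussWeight α β n θ k * ((1 - Real.cos (θ k)) ^ i * (1 + Real.cos (θ k)) ^ j) *
      (jacobiConst α' β' / jacobiConst α β * jacobiKernel α' β' N t (Real.cos (θ k))) *
      g.eval (Real.cos (θ k)) = g.eval t := by
  have hα' : -1 < α' := by have : (0 : ℝ) ≤ i := i.cast_nonneg; linarith
  have hβ' : -1 < β' := by have : (0 : ℝ) ≤ j := j.cast_nonneg; linarith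
  have hq := isOrthonormalSeq_jacobi hα' hβ'
  rw [← hq.apply_kernel_mul hg t, jacobiL_shift hα hβ hα' hβ' hi hj]
  rcases Nat.eq_zero_or_pos N with rfl | hN0
  · simp [jacobiKernel]
  rw [gauss_jacobi hα hβ hθ, Finset.mul_sum]
  · refine Finset.sum_congr rfl fun k _ => ?_
    simp only [eval_mul, eval_pow, eval_sub, eval_add, eval_one, eval_X, eval_finsetSum, eval_C,
      jacobiKernel, eval_jacobiONPoly]
    ring
  · have hK := natDegree_le_pred_of_degree_lt (hq.degree_sum_C_mul_lt N
      fun l => (jacobiONPoly α' β' l).eval t)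
    have hg' := natDegree_le_pred_of_degree_lt hg
    have hA := natDegree_one_sub_X_pow_mul_le i j
    refine degree_lt_of_natDegree_lt ((natDegree_mul_le.trans (add_le_add hA
      (natDegree_mul_le.trans (add_le_add hK hg')))).trans_lt ?_)
    omega

/-- Gauss quadrature is not exact on products of `p_m^{(α+1,β+1)}` with polynomials of degree `m` at
the zeros of `P_{m+1}^{(α,β)}`, but it is exact up to a constant factor: both the integral and the
error of the quadrature depend on leading coefficients only. -/
theorem sum_gaussWeight_mul_last {m : ℕ} {θ : Fin (m + 1) → ℝ}
    (hθ : IsZeroAngles α β (m + 1) θ) {g : ℝ[X]} (hg : g.degree < (m + 1 : ℕ)) :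
    jacobiConst (α + 1) (β + 1) / jacobiConst α β *
      ∑ k, gaussWeight α β (m + 1) θ k *
        ((1 - X ^ 2) * (jacobiONPoly (α + 1) (β + 1) m * g)).eval (Real.cos (θ k)) =
      (1 + α + β + 2 * (m + 1)) / (1 + α + β + (m + 1)) *
        jacobiL (α := α + 1) (β := β + 1) (by linarith) (by linarith)
          (jacobiONPoly (α + 1) (β + 1) m * g) := by
  have hα' : -1 < α + 1 := by linarith
  have hβ' : -1 < β + 1 := by linarith
  have hq := isOrthonormalSeq_jacobi hα' hβ'
  have hr := leadingCoeff_ratio hα hβ m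
  have hL := hq.apply_mul_eq_coeff_div hg
  have hg' : g.natDegree ≤ m := natDegree_le_pred_of_degree_lt hg
  have hqd := (hq.natDegree_eq m).le
  have hX : (1 - X ^ 2 : ℝ[X]).natDegree ≤ 2 := by compute_degree
  have hqg : (jacobiONPoly (α + 1) (β + 1) m * g).natDegree ≤ 2 * m :=
    (natDegree_mul_le.trans (add_le_add hqd hg')).trans (by omega)
  have hcoef : ((1 - X ^ 2) * (jacobiONPoly (α + 1) (β + 1) m * g)).coeff (2 * (m + 1)) =
      -((jacobiONPoly (α + 1) (β + 1) m).coeff m * g.coeff m) := by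
    rw [show 2 * (m + 1) = 2 + (m + m) by ring,
      coeff_mul_add_eq_of_natDegree_le hX (hqg.trans (by omega)),
      coeff_mul_add_eq_of_natDegree_le hqd hg']
    simp [coeff_one]
  have herr := gauss_jacobi_error hα hβ hθ
    (f := (1 - X ^ 2) * (jacobiONPoly (α + 1) (β + 1) m * g))
    ((natDegree_mul_le.trans (add_le_add hX hqg)).trans (by omega))
  rw [jacobiL_shift_one_one hα hβ, herr, hcoef] at hL
  rw [jacobiL_shift_one_one hα hβ, herr, hcoef]
  have hq0 := hq.coeff_ne_zero m
  have hp0 := (isOrthonormalSeq_jacobi hα hβ).coeff_ne_zero (m + 1)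
  have hc0 := (jacobiConst_pos hα hβ).ne'
  have hm0 : (0 : ℝ) ≤ m := m.cast_nonneg
  have h1 : 1 + α + β + ((m : ℝ) + 1) ≠ 0 := by linarith
  have h2 : (m : ℝ) + 1 + α + β + 1 ≠ 0 := by linarith
  generalize (∑ k, gaussWeight α β (m + 1) θ k *
        ((1 - X ^ 2) * (jacobiONPoly (α + 1) (β + 1) m * g)).eval (Real.cos (θ k))) = S at *
  generalize jacobiConst (α + 1) (β + 1) / jacobiConst α β = κ at *
  generalize (jacobiONPoly (α + 1) (β + 1) m).coeff m = a at *
  generalize (jacobiONPoly α β (m + 1)).coeff (m + 1) = b at *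
  generalize g.coeff m = c at *
  rw [hL]
  have h3 : κ * (a * c / b ^ 2) = (m + 1) / (m + 1 + α + β + 1) * (c / a) := by
    rw [← hr]; field_simp
  have h4 : κ * S = c / a + κ * (a * c / b ^ 2) := by rw [← hL]; ring
  rw [h4, h3]
  field_simp
  ring

end ZeroAngles

/-- The kernel of degree `n - 1` for the weight `(1 - t^2) w_{α,β}(t)`, with the last term modified
so that it reproduces when the integral is replaced by the Gauss sum for `w_{α,β}`. -/
def starKernel (α β : ℝ) (n : ℕ) (s t : ℝ) : ℝ :=
  jacobiConst (α + 1) (β + 1) / jacobiConst α β *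
    (jacobiKernel (α + 1) (β + 1) (n - 1) s t +
      (1 + α + β + n) / (1 + α + β + 2 * n) *
        (jacobiON (α + 1) (β + 1) (n - 1) s * jacobiON (α + 1) (β + 1) (n - 1) t))

/-- The analogue of `discrete_reproducing` for the weight `(1 - t^2) w_{α,β}(t)` and polynomials of
degree `n - 1`, where the degree of the integrand exceeds the precision of the quadrature by one. -/
theorem discrete_reproducing_star {α β : ℝ} (hα : -1 < α) (hβ : -1 < β) {n : ℕ} {θ : Fin n → ℝ}
    (hθ : IsZeroAngles α β n θ) {g : ℝ[X]} (hg : g.degree < n) (t : ℝ) :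
    ∑ k, gaussWeight α β n θ k * ((1 - Real.cos (θ k)) ^ 1 * (1 + Real.cos (θ k)) ^ 1) *
      starKernel α β n t (Real.cos (θ k)) * g.eval (Real.cos (θ k)) = g.eval t := by
  obtain _ | m := n
  · rw [degree_lt_iff_coeff_zero] at hg
    have : g = 0 := by ext k; simpa using hg k (Nat.zero_le k)
    simp [this]
  have hα' : -1 < α + 1 := by linarith
  have hβ' : -1 < β + 1 := by linarith
  have hq := isOrthonormalSeq_jacobi hα' hβ'
  have hg' : g.natDegree ≤ m := natDegree_le_pred_of_degree_lt hg
  have hX : (1 - X ^ 2 : ℝ[X]).natDegree ≤ 2 := by compute_degree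
  have hm0 : (0 : ℝ) ≤ m := m.cast_nonneg
  have h1 : 1 + α + β + ((m : ℝ) + 1) ≠ 0 := by linarith
  have h2 : 1 + α + β + 2 * ((m : ℝ) + 1) ≠ 0 := by linarith
  rw [← hq.sum_apply_mul_eval hg t, Finset.sum_range_succ]
  have hlt : ∀ i ∈ Finset.range m, jacobiL hα' hβ' (jacobiONPoly (α + 1) (β + 1) i * g) =
      jacobiConst (α + 1) (β + 1) / jacobiConst α β * ∑ k, gaussWeight α β (m + 1) θ k *
        ((1 - X ^ 2) * (jacobiONPoly (α + 1) (β + 1) i * g)).eval (Real.cos (θ k)) := by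
    intro i hi
    rw [jacobiL_shift_one_one hα hβ, gauss_jacobi hα hβ hθ]
    refine degree_lt_of_natDegree_lt ((natDegree_mul_le.trans (add_le_add hX
      (natDegree_mul_le.trans (add_le_add (hq.natDegree_eq i).le hg')))).trans_lt ?_)
    have := Finset.mem_range.mp hi
    omega
  have hlast : jacobiL hα' hβ' (jacobiONPoly (α + 1) (β + 1) m * g) =
      (1 + α + β + (m + 1)) / (1 + α + β + 2 * (m + 1)) *
      (jacobiConst (α + 1) (β + 1) / jacobiConst α β * ∑ k, gaussWeight α β (m + 1) θ k *
        ((1 - X ^ 2) * (jacobiONPoly (α + 1) (β + 1) m * g)).eval (Real.cos (θ k))) := by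
    rw [sum_gaussWeight_mul_last hα hβ hθ hg, ← mul_assoc, div_mul_div_comm,
      mul_comm (1 + α + β + ((m : ℝ) + 1)), div_self (mul_ne_zero h2 h1), one_mul]
  rw [Finset.sum_congr rfl fun i hi => congrArg
    (· * eval t (jacobiONPoly (α + 1) (β + 1) i)) (hlt i hi), hlast]
  simp only [Finset.mul_sum, Finset.sum_mul]
  rw [Finset.sum_comm, ← Finset.sum_add_distrib]
  refine Finset.sum_congr rfl fun k _ => ?_
  simp only [eval_mul, eval_sub, eval_one, eval_pow, eval_X, eval_jacobiONPoly]
  set x := Real.cos (θ k)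
  have e : ∑ i ∈ Finset.range m, jacobiConst (α + 1) (β + 1) / jacobiConst α β *
      (gaussWeight α β (m + 1) θ k * ((1 - x ^ 2) *
        (jacobiON (α + 1) (β + 1) i x * eval x g))) * jacobiON (α + 1) (β + 1) i t =
      gaussWeight α β (m + 1) θ k * (1 - x ^ 2) * (jacobiConst (α + 1) (β + 1) / jacobiConst α β) *
        eval x g * jacobiKernel (α + 1) (β + 1) m t x := by
    rw [jacobiKernel, Finset.mul_sum]
    exact Finset.sum_congr rfl fun i _ => by ring
  rw [e, starKernel]
  simp only [Nat.add_sub_cancel, Nat.cast_succ]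
  ring

end OneVariable

section Integrals

open scoped ENNReal

/-! ### The total mass of the weight function on the square -/

/-- The substitution `t = cos φ`. -/
theorem lintegral_Ioo_mul_inv_sqrt (g : ℝ → ℝ≥0∞) :
    ∫⁻ t in Set.Ioo (-1 : ℝ) 1, g t * ENNReal.ofReal (√(1 - t ^ 2))⁻¹ =
      ∫⁻ φ in Set.Ioo 0 Real.pi, g (Real.cos φ) := by
  have himg : Real.cos '' Set.Ioo 0 Real.pi = Set.Ioo (-1) 1 := by
    ext t
    constructor
    · rintro ⟨φ, hφ, rfl⟩
      have h := Real.sin_pos_of_mem_Ioo hφ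
      constructor <;> nlinarith [Real.sin_sq_add_cos_sq φ]
    · intro ht
      refine ⟨Real.arccos t, ⟨Real.arccos_pos.mpr ht.2, ?_⟩, Real.cos_arccos ht.1.le ht.2.le⟩
      refine lt_of_le_of_ne (Real.arccos_le_pi _) fun h => ?_
      linarith [Real.arccos_eq_pi.mp h, ht.1]
  rw [← himg, lintegral_image_eq_lintegral_abs_deriv_mul measurableSet_Ioo
    (fun φ _ => (Real.hasDerivAt_cos φ).hasDerivWithinAt)
    (Real.injOn_cos.mono Set.Ioo_subset_Icc_self)]
  refine setLIntegral_congr_fun measurableSet_Ioo fun φ hφ => ?_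
  have h := Real.sin_pos_of_mem_Ioo hφ
  rw [← Real.sin_sq, Real.sqrt_sq h.le, abs_neg, abs_of_pos h, mul_left_comm,
    ← ENNReal.ofReal_mul h.le, mul_inv_cancel₀ h.ne', ENNReal.ofReal_one, mul_one]

theorem lintegral_Ioc_of_even {f : ℝ → ℝ≥0∞} (hf : ∀ t, f (-t) = f t) {a : ℝ} (ha : 0 < a) :
    ∫⁻ t in Set.Ioc (-a) a, f t = 2 * ∫⁻ t in Set.Ioo 0 a, f t := by
  have h1 : ∫⁻ t in Set.Ioc (-a) 0, f t = ∫⁻ t in Set.Ioo 0 a, f t := by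
    rw [setLIntegral_congr Ioo_ae_eq_Ioc.symm]
    have := (Measure.measurePreserving_neg (volume : Measure ℝ)).setLIntegral_comp_preimage_emb
      (MeasurableEquiv.neg ℝ).measurableEmbedding f (Set.Ioo 0 a)
    rw [← this]
    simp [hf]
  rw [← Set.Ioc_union_Ioc_eq_Ioc (b := 0) (by linarith) ha.le,
    lintegral_union measurableSet_Ioc (Set.Ioc_disjoint_Ioc_of_le le_rfl), h1,
    setLIntegral_congr Ioo_ae_eq_Ioc.symm, two_mul]

/-- The endomorphism `(a, b) ↦ (a + b, a - b)` of the torus preserves Haar measure. -/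
theorem lintegral_addCircle_add_mul_sub {T : ℝ} [Fact (0 < T)] {H : AddCircle T → ℝ≥0∞}
    (hH : Measurable H) :
    ∫⁻ a, ∫⁻ b, H (a + b) * H (a - b) = (∫⁻ a, H a) ^ 2 := by
  -- with `c = a + b`, the second argument is `2 a - c`, and doubling preserves Haar measure
  have h1 : ∀ a : AddCircle T, ∫⁻ b, H (a + b) * H (a - b) = ∫⁻ b, H b * H ((2 : ℤ) • a - b) := by
    intro a
    rw [← lintegral_add_left_eq_self (μ := volume) (fun b => H b * H ((2 : ℤ) • a - b)) a]
    refine lintegral_congr fun b => ?_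
    rw [two_zsmul, add_sub_add_left_eq_sub]
  simp_rw [h1]
  rw [lintegral_lintegral_swap]
  · have h2 : ∀ b : AddCircle T, ∫⁻ a, H b * H ((2 : ℤ) • a - b) = H b * ∫⁻ a, H a := by
      intro b
      rw [lintegral_const_mul _ (by fun_prop)]
      congr 1
      rw [(Measure.measurePreserving_zsmul (volume : Measure (AddCircle T))
        two_ne_zero).lintegral_comp
        (f := fun a => H (a - b)) (by fun_prop), lintegral_sub_right_eq_self]
    simp_rw [h2]
    rw [lintegral_mul_const _ hH, sq]
  · fun_prop

/-- For an even function the circle may be replaced by half of it. -/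
theorem lintegral_add_mul_sub {h : ℝ → ℝ≥0∞} (hm : Measurable h) (heven : ∀ t, h (-t) = h t)
    (hper : Function.Periodic h (2 * Real.pi)) :
    ∫⁻ a in Set.Ioo 0 Real.pi, ∫⁻ b in Set.Ioo 0 Real.pi, h (a + b) * h (a - b) =
      (∫⁻ a in Set.Ioo 0 Real.pi, h a) ^ 2 := by
  have : Fact (0 < 2 * Real.pi) := ⟨Real.two_pi_pos⟩
  let H : AddCircle (2 * Real.pi) → ℝ≥0∞ := hper.lift
  have hHc : ∀ t : ℝ, H t = h t := hper.lift_coe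
  have hH : Measurable H := by
    have : H = fun x => h (AddCircle.measurableEquivIoc (2 * Real.pi) 0 x) := by
      funext x
      conv_lhs => rw [← (AddCircle.measurableEquivIoc (2 * Real.pi) 0).symm_apply_apply x]
      exact hHc _
    rw [this]
    fun_prop
  have hfold : ∀ F : AddCircle (2 * Real.pi) → ℝ≥0∞, (∀ x, F (-x) = F x) →
      ∫⁻ x, F x = 2 * ∫⁻ t in Set.Ioo 0 Real.pi, F (t : ℝ) := by
    intro F hF
    rw [← lintegral_Ioc_of_even (f := fun t : ℝ => F t) (fun t => by
      rw [AddCircle.coe_neg, hF]) Real.pi_pos, ← AddCircle.lintegral_preimage _ (-Real.pi)]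
    congr 3
    ring
  have hHe : ∀ x, H (-x) = H x := by
    intro x
    induction x using QuotientAddGroup.induction_on with
    | H t =>
      change H (((-t : ℝ) : AddCircle (2 * Real.pi))) = H (t : AddCircle (2 * Real.pi))
      rw [hHc, hHc, heven]
  have key := lintegral_addCircle_add_mul_sub hH
  rw [hfold H hHe, hfold] at key
  · have h2 : ∀ a : AddCircle (2 * Real.pi), ∫⁻ b, H (a + b) * H (a - b) =
        2 * ∫⁻ t in Set.Ioo 0 Real.pi, H (a + (t : ℝ)) * H (a - (t : ℝ)) := by
      intro a
      refine hfold _ fun x => ?_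
      rw [← sub_eq_add_neg, sub_neg_eq_add, mul_comm]
    simp_rw [h2] at key
    rw [lintegral_const_mul' _ _ (by simp), ← mul_assoc, mul_pow, sq (2 : ℝ≥0∞)] at key
    rw [ENNReal.mul_right_inj (by norm_num) (by finiteness)] at key
    simp only [← AddCircle.coe_add, ← AddCircle.coe_sub, hHc] at key
    exact key
  · intro x
    rw [← lintegral_neg_eq_self]
    refine lintegral_congr fun b => ?_
    rw [← neg_add, hHe, neg_sub_neg, ← hHe (b - x), neg_sub]

theorem abs_rpow_two_mul_add_one (x e : ℝ) : |x| ^ (2 * e + 1) = (x ^ 2) ^ (e + 1 / 2) := by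
  rw [← sq_abs, ← Real.rpow_natCast, ← Real.rpow_mul (abs_nonneg x)]
  congr 1
  push_cast
  ring

/-- The mass of the weight function on the square, without its constant, is the square of the mass
of the Jacobi weight. With `x₁ = cos a`, `x₂ = cos b`, this is the previous lemma for `h φ = (1 -
cos φ)^(α + 1/2) * (1 + cos φ)^(β + 1/2)`, because `(x₁ ± x₂)^2 = (1 ± cos (a + b)) * (1 ± cos (a -
b))`. -/
theorem lintegral_square_eq (α β : ℝ) :
    ∫⁻ z in square, ENNReal.ofReal (|z.1 - z.2| ^ (2 * α + 1) * |z.1 + z.2| ^ (2 * β + 1) /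
      (√(1 - z.1 ^ 2) * √(1 - z.2 ^ 2))) =
      (∫⁻ t in Set.Ioo (-1 : ℝ) 1, ENNReal.ofReal (jacobiWeight α β t)) ^ 2 := by
  have hsq : (volume : Measure (ℝ × ℝ)).restrict square =
      (volume.restrict (Set.Ioo (-1 : ℝ) 1)).prod (volume.restrict (Set.Ioo (-1 : ℝ) 1)) := by
    rw [square, Measure.volume_eq_prod, ← Measure.prod_restrict,
      Measure.restrict_congr_set (Ioo_ae_eq_Icc (a := (-1 : ℝ)) (b := 1))]
  set h : ℝ → ℝ≥0∞ := fun φ =>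
    ENNReal.ofReal ((1 - Real.cos φ) ^ (α + 1 / 2) * (1 + Real.cos φ) ^ (β + 1 / 2)) with hh
  have hone : ∫⁻ t in Set.Ioo (-1 : ℝ) 1, ENNReal.ofReal (jacobiWeight α β t) =
      ∫⁻ φ in Set.Ioo 0 Real.pi, h φ := by
    rw [hh, ← lintegral_Ioo_mul_inv_sqrt
      (fun t => ENNReal.ofReal ((1 - t) ^ (α + 1 / 2) * (1 + t) ^ (β + 1 / 2)))]
    refine setLIntegral_congr_fun measurableSet_Ioo fun t ht => ?_
    have h1 : 0 < 1 - t := by linarith [ht.2]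
    have h2 : 0 < 1 + t := by linarith [ht.1]
    rw [← ENNReal.ofReal_mul (by positivity)]
    congr 1
    rw [show 1 - t ^ 2 = (1 - t) * (1 + t) by ring, Real.sqrt_mul h1.le, Real.rpow_add h1,
      Real.rpow_add h2, ← Real.sqrt_eq_rpow, ← Real.sqrt_eq_rpow, jacobiWeight]
    have := Real.sqrt_pos.mpr h1
    have := Real.sqrt_pos.mpr h2
    field_simp
  rw [hone, ← lintegral_add_mul_sub (by fun_prop) (by simp [hh])
    (fun t => by simp [hh, Real.cos_add_two_pi]), hsq, lintegral_prod _ (by fun_prop)]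
  have hin : ∀ a b : ℝ, h (a + b) * h (a - b) =
      ENNReal.ofReal (|Real.cos a - Real.cos b| ^ (2 * α + 1) *
        |Real.cos a + Real.cos b| ^ (2 * β + 1)) := by
    intro a b
    have n1 : ∀ φ, 0 ≤ 1 - Real.cos φ := fun φ => by linarith [Real.cos_le_one φ]
    have n2 : ∀ φ, 0 ≤ 1 + Real.cos φ := fun φ => by linarith [Real.neg_one_le_cos φ]
    have e1 : (Real.cos a - Real.cos b) ^ 2 =
        (1 - Real.cos (a + b)) * (1 - Real.cos (a - b)) := by
      rw [Real.cos_add, Real.cos_sub]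
      nlinarith [Real.sin_sq_add_cos_sq a, Real.sin_sq_add_cos_sq b]
    have e2 : (Real.cos a + Real.cos b) ^ 2 =
        (1 + Real.cos (a + b)) * (1 + Real.cos (a - b)) := by
      rw [Real.cos_add, Real.cos_sub]
      nlinarith [Real.sin_sq_add_cos_sq a, Real.sin_sq_add_cos_sq b]
    rw [abs_rpow_two_mul_add_one, abs_rpow_two_mul_add_one, e1, e2,
      Real.mul_rpow (n1 _) (n1 _), Real.mul_rpow (n2 _) (n2 _), hh,
      ← ENNReal.ofReal_mul (mul_nonneg (Real.rpow_nonneg (n1 _) _) (Real.rpow_nonneg (n2 _) _))]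
    congr 1
    ring
  simp_rw [hin]
  rw [← lintegral_Ioo_mul_inv_sqrt (fun x => ∫⁻ b in Set.Ioo 0 Real.pi,
    ENNReal.ofReal (|x - Real.cos b| ^ (2 * α + 1) * |x + Real.cos b| ^ (2 * β + 1)))]
  refine lintegral_congr fun x => ?_
  rw [← lintegral_Ioo_mul_inv_sqrt (fun y =>
    ENNReal.ofReal (|x - y| ^ (2 * α + 1) * |x + y| ^ (2 * β + 1))),
    ← lintegral_mul_const' _ _ ENNReal.ofReal_ne_top]
  refine lintegral_congr fun y => ?_
  rw [← ENNReal.ofReal_mul (by positivity), ← ENNReal.ofReal_mul (by positivity), div_eq_mul_inv,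
    mul_inv, mul_comm (√(1 - x ^ 2))⁻¹, ← mul_assoc]

theorem weight_nonneg (α β : ℝ) (z : ℝ × ℝ) : 0 ≤ weight α β z := by
  unfold weight; positivity

theorem lintegral_weight {α β : ℝ} (hα : -1 < α) (hβ : -1 < β) :
    ∫⁻ z in square, ENNReal.ofReal (weight α β z) = 1 := by
  have hc := jacobiConst_pos hα hβ
  have h1 : ∫⁻ t in Set.Ioo (-1 : ℝ) 1, ENNReal.ofReal (jacobiWeight α β t) =
      ENNReal.ofReal (jacobiConst α β)⁻¹ := by
    rw [← ofReal_integral_eq_lintegral_ofReal]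
    · rw [jacobiConst, inv_inv, intervalIntegral.integral_of_le (by norm_num),
        integral_Ioc_eq_integral_Ioo]
    · exact ((intervalIntegrable_iff_integrableOn_Ioo_of_le (by norm_num)).mp
        (intervalIntegrable_jacobiWeight hα hβ))
    · exact ae_restrict_of_forall_mem measurableSet_Ioo fun t ht => (jacobiWeight_pos α β ht).le
  have h2 : ∀ z : ℝ × ℝ, ENNReal.ofReal (weight α β z) = ENNReal.ofReal (jacobiConst α β ^ 2) *
      ENNReal.ofReal (|z.1 - z.2| ^ (2 * α + 1) * |z.1 + z.2| ^ (2 * β + 1) /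
      (√(1 - z.1 ^ 2) * √(1 - z.2 ^ 2))) := by
    intro z
    rw [← ENNReal.ofReal_mul (by positivity), weight, mul_div_assoc]
  simp_rw [h2]
  rw [lintegral_const_mul' _ _ ENNReal.ofReal_ne_top, lintegral_square_eq, h1,
    ← ENNReal.ofReal_pow (by positivity), ← ENNReal.ofReal_mul (by positivity), inv_pow,
    mul_inv_cancel₀ (by positivity), ENNReal.ofReal_one]

theorem measurable_weight (α β : ℝ) : Measurable (weight α β) := by
  unfold weight; fun_prop

theorem integrableOn_weight {α β : ℝ} (hα : -1 < α) (hβ : -1 < β) :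
    IntegrableOn (weight α β) square := by
  refine ⟨(measurable_weight α β).aestronglyMeasurable, ?_⟩
  rw [hasFiniteIntegral_iff_ofReal (Filter.Eventually.of_forall (weight_nonneg α β)),
    lintegral_weight hα hβ]
  exact ENNReal.one_lt_top

theorem integral_weight {α β : ℝ} (hα : -1 < α) (hβ : -1 < β) :
    ∫ z in square, weight α β z = 1 := by
  rw [integral_eq_lintegral_of_nonneg_ae (Filter.Eventually.of_forall (weight_nonneg α β))
    (measurable_weight α β).aestronglyMeasurable, lintegral_weight hα hβ, ENNReal.toReal_one]

/-! ### Moments of the weight function -/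

theorem measurableSet_square : MeasurableSet square := measurableSet_Icc.prod measurableSet_Icc

theorem isCompact_square : IsCompact square := isCompact_Icc.prod isCompact_Icc

theorem integrableOn_mul_weight {α β : ℝ} (hα : -1 < α) (hβ : -1 < β) {f : ℝ × ℝ → ℝ}
    (hf : ContinuousOn f square) : IntegrableOn (fun z => f z * weight α β z) square :=
  (integrableOn_weight hα hβ).continuousOn_mul hf isCompact_square

theorem abs_rpow_mul_pow {e : ℝ} (he : -1 < e) (x : ℝ) (i : ℕ) :
    x ^ (2 * i) * |x| ^ (2 * e + 1) = |x| ^ (2 * (e + i) + 1) := by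
  rcases Nat.eq_zero_or_pos i with rfl | hi
  · simp
  · have : (1 : ℝ) ≤ i := by exact_mod_cast hi
    rw [show 2 * (e + i) + 1 = (2 * e + 1) + ((2 * i : ℕ) : ℝ) by push_cast; ring,
      Real.rpow_add_natCast' (abs_nonneg x) (by push_cast; linarith), pow_mul, pow_mul, sq_abs,
      mul_comm]

/-- The even moments are squares of integrals in one variable: even powers of `x₁ + x₂` and `x₁ -
x₂` only shift the parameters of the weight function, whose total mass is known. -/
theorem integral_even_moment {α β : ℝ} (hα : -1 < α) (hβ : -1 < β) (i j : ℕ) :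
    ∫ z in square, (z.1 + z.2) ^ (2 * j) * (z.1 - z.2) ^ (2 * i) * weight α β z =
      jacobiL hα hβ ((1 - Polynomial.X) ^ i * (1 + Polynomial.X) ^ j) ^ 2 := by
  have hα' : -1 < α + i := by have : (0 : ℝ) ≤ i := i.cast_nonneg; linarith
  have hβ' : -1 < β + j := by have : (0 : ℝ) ≤ j := j.cast_nonneg; linarith
  have hc := jacobiConst_pos hα hβ
  have hc' := jacobiConst_pos hα' hβ'
  have h1 : ∀ z : ℝ × ℝ, (z.1 + z.2) ^ (2 * j) * (z.1 - z.2) ^ (2 * i) * weight α β z =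
      (jacobiConst α β / jacobiConst (α + i) (β + j)) ^ 2 * weight (α + i) (β + j) z := by
    intro z
    rw [weight, weight, ← abs_rpow_mul_pow hα, ← abs_rpow_mul_pow hβ]
    field_simp
  simp_rw [h1]
  rw [integral_const_mul, integral_weight hα' hβ', mul_one]
  congr 1
  have h2 := jacobiL_shift hα hβ hα' hβ' rfl rfl 1
  rw [mul_one] at h2
  have h3 : jacobiL hα' hβ' 1 = 1 := by
    rw [jacobiL_apply]
    simp only [Polynomial.eval_one, one_mul]
    exact inv_mul_cancel₀ fun h0 => hc'.ne' (by rw [jacobiConst, h0, inv_zero])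
  rw [h3] at h2
  field_simp at h2 ⊢
  linarith

theorem setIntegral_square_comp_swap (f : ℝ × ℝ → ℝ) :
    ∫ z in square, f (z.2, z.1) = ∫ z in square, f z := by
  have h := (Measure.measurePreserving_swap (μ := (volume : Measure ℝ))
    (ν := (volume : Measure ℝ))).setIntegral_preimage_emb
    MeasurableEquiv.prodComm.measurableEmbedding f square
  rw [← Measure.volume_eq_prod] at h
  rw [← h]
  congr 2
  ext z
  simp [square, and_comm]

theorem setIntegral_square_comp_neg (f : ℝ × ℝ → ℝ) :
    ∫ z in square, f (-z) = ∫ z in square, f z := by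
  have h := (Measure.measurePreserving_neg
    (volume : Measure (ℝ × ℝ))).setIntegral_preimage_emb
    (MeasurableEquiv.neg (ℝ × ℝ)).measurableEmbedding f square
  rw [← h]
  congr 2
  ext z
  simp [square, and_comm]

/-- The other moments vanish by the symmetries `z ↦ -z` and `(x₁, x₂) ↦ (x₂, x₁)` of the weight. -/
theorem integral_odd_moment {α β : ℝ} {a b : ℕ} (h : ¬(Even a ∧ Even b)) :
    ∫ z in square, (z.1 + z.2) ^ a * (z.1 - z.2) ^ b * weight α β z = 0 := by
  have hw1 : ∀ z : ℝ × ℝ, weight α β (z.2, z.1) = weight α β z := fun z => by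
    simp only [weight]
    rw [abs_sub_comm, add_comm z.2, mul_comm (√(1 - z.2 ^ 2))]
  have hw2 : ∀ z : ℝ × ℝ, weight α β (-z) = weight α β z := fun z => by
    simp only [weight, Prod.fst_neg, Prod.snd_neg, neg_sq]
    rw [show -z.1 - -z.2 = -(z.1 - z.2) by ring, abs_neg,
      show -z.1 + -z.2 = -(z.1 + z.2) by ring, abs_neg]
  have hself : ∀ {x : ℝ}, -x = x → x = 0 := fun h => by linarith
  by_cases hb : Even b
  · have ha : Odd a := by
      rw [← Nat.not_even_iff_odd]; exact fun ha => h ⟨ha, hb⟩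
    apply hself
    conv_rhs => rw [← setIntegral_square_comp_neg]
    rw [← integral_neg]
    refine integral_congr_ae (Filter.Eventually.of_forall fun z => ?_)
    simp only [hw2, Prod.fst_neg, Prod.snd_neg]
    rw [show -z.1 - -z.2 = -(z.1 - z.2) by ring, hb.neg_pow,
      show -z.1 + -z.2 = -(z.1 + z.2) by ring, ha.neg_pow]
    ring
  · rw [Nat.not_even_iff_odd] at hb
    apply hself
    conv_rhs => rw [← setIntegral_square_comp_swap]
    rw [← integral_neg]
    refine integral_congr_ae (Filter.Eventually.of_forall fun z => ?_)
    simp only [hw1]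
    rw [show z.2 - z.1 = -(z.1 - z.2) by ring, hb.neg_pow, add_comm z.2]
    ring

end Integrals

/-! ### Polynomials in two variables -/

@[simp] theorem evalAt_add (p q : MvPolynomial (Fin 2) ℝ) (z : ℝ × ℝ) :
    evalAt (p + q) z = evalAt p z + evalAt q z := map_add _ _ _

@[simp] theorem evalAt_sub (p q : MvPolynomial (Fin 2) ℝ) (z : ℝ × ℝ) :
    evalAt (p - q) z = evalAt p z - evalAt q z := map_sub _ _ _

@[simp] theorem evalAt_mul (p q : MvPolynomial (Fin 2) ℝ) (z : ℝ × ℝ) :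
    evalAt (p * q) z = evalAt p z * evalAt q z := map_mul _ _ _

@[simp] theorem evalAt_pow (p : MvPolynomial (Fin 2) ℝ) (k : ℕ) (z : ℝ × ℝ) :
    evalAt (p ^ k) z = evalAt p z ^ k := map_pow _ _ _

@[simp] theorem evalAt_smul (c : ℝ) (p : MvPolynomial (Fin 2) ℝ) (z : ℝ × ℝ) :
    evalAt (c • p) z = c * evalAt p z := by
  simp [evalAt]

@[simp] theorem evalAt_sum {ι : Type*} (s : Finset ι) (p : ι → MvPolynomial (Fin 2) ℝ)
    (z : ℝ × ℝ) : evalAt (∑ i ∈ s, p i) z = ∑ i ∈ s, evalAt (p i) z := map_sum _ _ _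

@[simp] theorem evalAt_zero (z : ℝ × ℝ) : evalAt 0 z = 0 := map_zero _

@[simp] theorem evalAt_one (z : ℝ × ℝ) : evalAt 1 z = 1 := map_one _

@[simp] theorem evalAt_X_zero (z : ℝ × ℝ) : evalAt (MvPolynomial.X 0) z = z.1 := by
  simp [evalAt]

@[simp] theorem evalAt_X_one (z : ℝ × ℝ) : evalAt (MvPolynomial.X 1) z = z.2 := by
  simp [evalAt]

theorem continuous_evalAt (p : MvPolynomial (Fin 2) ℝ) : Continuous (evalAt p) := by
  refine (MvPolynomial.continuous_eval p).comp (continuous_pi fun i => ?_)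
  fin_cases i
  · exact continuous_fst
  · exact continuous_snd

/-- A polynomial is determined by its values on the square. -/
theorem evalAt_injOn_square {p q : MvPolynomial (Fin 2) ℝ}
    (h : ∀ z ∈ square, evalAt p z = evalAt q z) : p = q := by
  refine MvPolynomial.funext_set (fun _ => Set.Icc (-1 : ℝ) 1)
    (fun _ => Set.Icc_infinite (by norm_num)) fun x hx => ?_
  have := h (x 0, x 1) ⟨hx 0 trivial, hx 1 trivial⟩
  rw [evalAt, evalAt] at this
  have hx' : ![x 0, x 1] = x := by ext i; fin_cases i <;> rfl
  rwa [hx'] at this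

theorem polys_mono {m n : ℕ} (h : m ≤ n) : polys m ≤ polys n := fun p hp => by
  rw [MvPolynomial.mem_restrictTotalDegree] at hp ⊢; exact hp.trans h

theorem mul_mem_polys {m n : ℕ} {p q : MvPolynomial (Fin 2) ℝ} (hp : p ∈ polys m)
    (hq : q ∈ polys n) : p * q ∈ polys (m + n) := by
  rw [MvPolynomial.mem_restrictTotalDegree] at hp hq ⊢
  exact (MvPolynomial.totalDegree_mul _ _).trans (add_le_add hp hq)

theorem pow_mem_polys {m : ℕ} {p : MvPolynomial (Fin 2) ℝ} (hp : p ∈ polys m) (k : ℕ) :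
    p ^ k ∈ polys (k * m) := by
  rw [MvPolynomial.mem_restrictTotalDegree] at hp ⊢
  exact (MvPolynomial.totalDegree_pow _ _).trans (Nat.mul_le_mul_left k hp)

theorem one_mem_polys (m : ℕ) : (1 : MvPolynomial (Fin 2) ℝ) ∈ polys m := by
  rw [MvPolynomial.mem_restrictTotalDegree]; simp

theorem X_mem_polys (i : Fin 2) : (MvPolynomial.X i : MvPolynomial (Fin 2) ℝ) ∈ polys 1 := by
  rw [MvPolynomial.mem_restrictTotalDegree]; simp

/-- The polynomial `(x₁ + x₂)^a (x₁ - x₂)^b`. -/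
def sumDiff (a b : ℕ) : MvPolynomial (Fin 2) ℝ :=
  (MvPolynomial.X 0 + MvPolynomial.X 1) ^ a * (MvPolynomial.X 0 - MvPolynomial.X 1) ^ b

theorem evalAt_sumDiff (a b : ℕ) (z : ℝ × ℝ) :
    evalAt (sumDiff a b) z = (z.1 + z.2) ^ a * (z.1 - z.2) ^ b := by
  simp [sumDiff]

theorem sumDiff_mem_polys (a b : ℕ) : sumDiff a b ∈ polys (a + b) := by
  have h1 := pow_mem_polys (add_mem (X_mem_polys 0) (X_mem_polys 1)) a
  have h2 := pow_mem_polys (sub_mem (X_mem_polys 0) (X_mem_polys 1)) b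
  have h := mul_mem_polys h1 h2
  rwa [mul_one, mul_one] at h

theorem X_mul_mem_span_sumDiff {M : ℕ} {p : MvPolynomial (Fin 2) ℝ}
    (hp : p ∈ Submodule.span ℝ {q | ∃ a b, a + b ≤ M ∧ q = sumDiff a b}) (i : Fin 2) :
    MvPolynomial.X i * p ∈ Submodule.span ℝ {q | ∃ a b, a + b ≤ M + 1 ∧ q = sumDiff a b} := by
  induction hp using Submodule.span_induction with
  | mem q hq =>
    obtain ⟨a, b, hab, rfl⟩ := hq
    have h1 : sumDiff (a + 1) b ∈
        Submodule.span ℝ {q | ∃ a b, a + b ≤ M + 1 ∧ q = sumDiff a b} :=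
      Submodule.subset_span ⟨a + 1, b, by omega, rfl⟩
    have h2 : sumDiff a (b + 1) ∈
        Submodule.span ℝ {q | ∃ a b, a + b ≤ M + 1 ∧ q = sumDiff a b} :=
      Submodule.subset_span ⟨a, b + 1, by omega, rfl⟩
    have e : (MvPolynomial.C (1 / 2) : MvPolynomial (Fin 2) ℝ) * 2 = 1 := by
      rw [show (2 : MvPolynomial (Fin 2) ℝ) = MvPolynomial.C 2 from rfl, ← MvPolynomial.C_mul]
      norm_num
    fin_cases i
    · have : MvPolynomial.X 0 * sumDiff a b =
          (1 / 2 : ℝ) • (sumDiff (a + 1) b + sumDiff a (b + 1)) := by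
        rw [MvPolynomial.smul_eq_C_mul, sumDiff, sumDiff, sumDiff, pow_succ, pow_succ]
        linear_combination (-MvPolynomial.X 0 *
          (MvPolynomial.X 0 + MvPolynomial.X 1) ^ a *
            (MvPolynomial.X 0 - MvPolynomial.X 1) ^ b) * e
      exact this ▸ Submodule.smul_mem _ _ (add_mem h1 h2)
    · have : MvPolynomial.X 1 * sumDiff a b =
          (1 / 2 : ℝ) • (sumDiff (a + 1) b - sumDiff a (b + 1)) := by
        rw [MvPolynomial.smul_eq_C_mul, sumDiff, sumDiff, sumDiff, pow_succ, pow_succ]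
        linear_combination (-MvPolynomial.X 1 *
          (MvPolynomial.X 0 + MvPolynomial.X 1) ^ a *
            (MvPolynomial.X 0 - MvPolynomial.X 1) ^ b) * e
      exact this ▸ Submodule.smul_mem _ _ (sub_mem h1 h2)
  | zero => simp
  | add p q _ _ hp hq => rw [mul_add]; exact add_mem hp hq
  | smul c p _ hp => rw [mul_smul_comm]; exact Submodule.smul_mem _ _ hp

/-- The polynomials of degree at most `M` are spanned by the products
`(x₁ + x₂)^a (x₁ - x₂)^b`. -/
theorem polys_le_span_sumDiff (M : ℕ) :
    polys M ≤ Submodule.span ℝ {q | ∃ a b, a + b ≤ M ∧ q = sumDiff a b} := by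
  have hmon : ∀ k l : ℕ, (MvPolynomial.X 0 ^ k * MvPolynomial.X 1 ^ l : MvPolynomial (Fin 2) ℝ) ∈
      Submodule.span ℝ {q | ∃ a b, a + b ≤ k + l ∧ q = sumDiff a b} := by
    intro k l
    induction k with
    | zero =>
      induction l with
      | zero => exact Submodule.subset_span ⟨0, 0, le_rfl, by simp [sumDiff]⟩
      | succ l ih =>
        have := X_mul_mem_span_sumDiff ih 1
        rwa [pow_zero, one_mul, ← pow_succ', ← one_mul (MvPolynomial.X 1 ^ (l + 1)),
          ← pow_zero (MvPolynomial.X 0)] at this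
    | succ k ih =>
      have := X_mul_mem_span_sumDiff ih 0
      rw [← mul_assoc, ← pow_succ'] at this
      rwa [show k + 1 + l = k + l + 1 by ring]
  intro p hp
  rw [MvPolynomial.mem_restrictTotalDegree] at hp
  rw [p.as_sum]
  refine Submodule.sum_mem _ fun d hd => ?_
  have hdeg : d 0 + d 1 ≤ M := by
    have := (MvPolynomial.le_totalDegree hd).trans hp
    rwa [Finsupp.sum_fintype _ _ (fun _ => rfl), Fin.sum_univ_two] at this
  have e : MvPolynomial.monomial d (MvPolynomial.coeff d p) =
      MvPolynomial.coeff d p • (MvPolynomial.X 0 ^ d 0 * MvPolynomial.X 1 ^ d 1) := by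
    rw [MvPolynomial.monomial_eq, MvPolynomial.smul_eq_C_mul,
      Finsupp.prod_fintype _ _ (fun _ => pow_zero _), Fin.prod_univ_two]
  rw [e]
  refine Submodule.smul_mem _ _ (Submodule.span_mono ?_ (hmon (d 0) (d 1)))
  rintro q ⟨a, b, hab, rfl⟩
  exact ⟨a, b, hab.trans hdeg, rfl⟩

/-- Exponents of degree at most `m` correspond to pairs of natural numbers of sum at most `m`. -/
def degreeLEEquiv (m : ℕ) : {d : Fin 2 →₀ ℕ | (d.sum fun _ e => e) ≤ m} ≃
    {p : ℕ × ℕ // p ∈ (Finset.range (m + 1)).biUnion Finset.HasAntidiagonal.antidiagonal} :=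
  (Finsupp.equivFunOnFinite.trans (finTwoArrowEquiv ℕ)).subtypeEquiv fun d => by
    change (d.sum fun _ e => e) ≤ m ↔ _
    rw [Finsupp.sum_fintype _ _ (fun _ => rfl), Fin.sum_univ_two]
    simp

instance (m : ℕ) : FiniteDimensional ℝ (polys m) := by
  have : Finite {d : Fin 2 →₀ ℕ | (d.sum fun _ e => e) ≤ m} :=
    Finite.of_equiv _ (degreeLEEquiv m).symm
  exact Module.Finite.of_basis (MvPolynomial.basisRestrictSupport ℝ
    {d : Fin 2 →₀ ℕ | (d.sum fun _ e => e) ≤ m})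

theorem finrank_polys (m : ℕ) :
    Module.finrank ℝ (polys m) = ∑ k ∈ Finset.range (m + 1), (k + 1) := by
  rw [(Module.finrank_eq_nat_card_basis (MvPolynomial.basisRestrictSupport ℝ
    {d : Fin 2 →₀ ℕ | (d.sum fun _ e => e) ≤ m}) : Module.finrank ℝ (polys m) = _),
    Nat.card_congr (degreeLEEquiv m), Nat.card_eq_fintype_card,
    Fintype.card_coe, Finset.card_biUnion]
  · simp
  · intro i _ j _ hij
    rw [Function.onFun, Finset.disjoint_left]
    intro p hp hp'
    rw [Finset.HasAntidiagonal.mem_antidiagonal] at hp hp'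
    exact hij (hp ▸ hp')

/-! ### Symmetric functions of `cos (θ₁ - θ₂)` and `cos (θ₁ + θ₂)` -/

theorem cosDiff_add_cosSum {z : ℝ × ℝ} (hz : z ∈ square) :
    cosDiff z + cosSum z = 2 * z.1 * z.2 := by
  rw [cosDiff, cosSum, Real.cos_sub, Real.cos_add, Real.cos_arccos hz.1.1 hz.1.2,
    Real.cos_arccos hz.2.1 hz.2.2]
  ring

theorem cosDiff_mul_cosSum {z : ℝ × ℝ} (hz : z ∈ square) :
    cosDiff z * cosSum z = z.1 ^ 2 + z.2 ^ 2 - 1 := by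
  rw [cosDiff, cosSum, Real.cos_sub, Real.cos_add, Real.cos_arccos hz.1.1 hz.1.2,
    Real.cos_arccos hz.2.1 hz.2.2, Real.sin_arccos, Real.sin_arccos]
  have h1 : √(1 - z.1 ^ 2) ^ 2 = 1 - z.1 ^ 2 := Real.sq_sqrt (by nlinarith [hz.1.1, hz.1.2])
  have h2 : √(1 - z.2 ^ 2) ^ 2 = 1 - z.2 ^ 2 := Real.sq_sqrt (by nlinarith [hz.2.1, hz.2.2])
  linear_combination -√(1 - z.2 ^ 2) ^ 2 * h1 - (1 - z.1 ^ 2) * h2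

theorem sub_sq_eq {z : ℝ × ℝ} (hz : z ∈ square) :
    (z.1 - z.2) ^ 2 = (1 - cosDiff z) * (1 - cosSum z) := by
  linear_combination cosDiff_add_cosSum hz - cosDiff_mul_cosSum hz

theorem add_sq_eq {z : ℝ × ℝ} (hz : z ∈ square) :
    (z.1 + z.2) ^ 2 = (1 + cosDiff z) * (1 + cosSum z) := by
  linear_combination - cosDiff_add_cosSum hz - cosDiff_mul_cosSum hz

/-- Power sums are polynomials in the elementary symmetric functions `2 x₁ x₂` and
`x₁^2 + x₂^2 - 1` of `cos (θ₁ - θ₂)` and `cos (θ₁ + θ₂)`, by Newton's recursion. -/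
theorem exists_powerSum : ∀ k : ℕ, ∃ q ∈ polys (2 * k), ∀ z ∈ square,
    evalAt q z = cosDiff z ^ k + cosSum z ^ k
  | 0 => ⟨(2 : ℝ) • 1, Submodule.smul_mem _ _ (one_mem_polys _), fun z _ => by simp; norm_num⟩
  | 1 => ⟨(2 : ℝ) • (MvPolynomial.X 0 * MvPolynomial.X 1),
      Submodule.smul_mem _ _ (mul_mem_polys (m := 1) (n := 1) (X_mem_polys 0) (X_mem_polys 1)),
      fun z hz => by
        simp [cosDiff_add_cosSum hz, mul_assoc]⟩
  | k + 2 => by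
    obtain ⟨q0, hq0, h0⟩ := exists_powerSum k
    obtain ⟨q1, hq1, h1⟩ := exists_powerSum (k + 1)
    refine ⟨(2 : ℝ) • (MvPolynomial.X 0 * MvPolynomial.X 1) * q1 -
      (MvPolynomial.X 0 ^ 2 + MvPolynomial.X 1 ^ 2 - 1) * q0, sub_mem ?_ ?_, fun z hz => ?_⟩
    · refine polys_mono (by omega) (mul_mem_polys (m := 1 + 1) (Submodule.smul_mem _ _
        (mul_mem_polys (X_mem_polys 0) (X_mem_polys 1))) hq1)
    · exact polys_mono (by omega) (mul_mem_polys (m := 2 * 1)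
        (sub_mem (add_mem (pow_mem_polys (X_mem_polys 0) 2) (pow_mem_polys (X_mem_polys 1) 2))
          (one_mem_polys _)) hq0)
    · simp only [evalAt_sub, evalAt_add, evalAt_mul, evalAt_smul, evalAt_pow, evalAt_X_zero,
        evalAt_X_one, evalAt_one, h0 z hz, h1 z hz]
      linear_combination (-(cosDiff z ^ (k + 1) + cosSum z ^ (k + 1))) * cosDiff_add_cosSum hz +
        (cosDiff z ^ k + cosSum z ^ k) * cosDiff_mul_cosSum hz

theorem exists_symm_monomial {m i j : ℕ} (hi : i ≤ m) (hj : j ≤ m) :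
    ∃ q ∈ polys (2 * m), ∀ z ∈ square, evalAt q z =
      cosDiff z ^ i * cosSum z ^ j + cosDiff z ^ j * cosSum z ^ i := by
  wlog hij : i ≤ j generalizing i j
  · obtain ⟨q, hq, h⟩ := this hj hi (by omega)
    exact ⟨q, hq, fun z hz => by rw [h z hz, add_comm]⟩
  obtain ⟨q, hq, h⟩ := exists_powerSum (j - i)
  refine ⟨(MvPolynomial.X 0 ^ 2 + MvPolynomial.X 1 ^ 2 - 1) ^ i * q, ?_, fun z hz => ?_⟩
  · refine polys_mono (by omega) (mul_mem_polys (pow_mem_polys (m := 2 * 1)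
      (sub_mem (add_mem (pow_mem_polys (X_mem_polys 0) 2) (pow_mem_polys (X_mem_polys 1) 2))
        (one_mem_polys _)) i) hq)
  · simp only [evalAt_sub, evalAt_add, evalAt_mul, evalAt_pow, evalAt_X_zero,
        evalAt_X_one, evalAt_one, h z hz]
    rw [← cosDiff_mul_cosSum hz]
    obtain ⟨d, rfl⟩ := Nat.exists_eq_add_of_le hij
    rw [Nat.add_sub_cancel_left]
    ring

/-- Symmetric products of polynomials in `cos (θ₁ - θ₂)` and `cos (θ₁ + θ₂)` are polynomials in
`(cos θ₁, cos θ₂)`. -/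
theorem exists_symm_polynomial {m : ℕ} {a b : Polynomial ℝ} (ha : a.natDegree ≤ m)
    (hb : b.natDegree ≤ m) : ∃ q ∈ polys (2 * m), ∀ z ∈ square, evalAt q z =
      a.eval (cosDiff z) * b.eval (cosSum z) + b.eval (cosDiff z) * a.eval (cosSum z) := by
  choose! q hq h using fun (i j : ℕ) (hij : i ≤ m ∧ j ≤ m) =>
    exists_symm_monomial (m := m) hij.1 hij.2
  refine ⟨∑ i ∈ Finset.range (m + 1), ∑ j ∈ Finset.range (m + 1),
    (a.coeff i * b.coeff j) • q i j, ?_, fun z hz => ?_⟩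
  · refine Submodule.sum_mem _ fun i hi => Submodule.sum_mem _ fun j hj =>
      Submodule.smul_mem _ _ (hq i j ?_)
    exact ⟨Nat.lt_succ_iff.mp (Finset.mem_range.mp hi), Nat.lt_succ_iff.mp (Finset.mem_range.mp hj)⟩
  · simp only [evalAt_sum, evalAt_smul,
      Polynomial.eval_eq_sum_range' (Nat.lt_succ_iff.mpr ha),
      Polynomial.eval_eq_sum_range' (Nat.lt_succ_iff.mpr hb)]
    rw [Finset.sum_mul_sum, Finset.sum_mul_sum, Finset.sum_comm (s := Finset.range (m + 1))
      (f := fun i j => b.coeff i * cosDiff z ^ i * (a.coeff j * cosSum z ^ j)),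
      ← Finset.sum_add_distrib]
    refine Finset.sum_congr rfl fun i hi => ?_
    rw [← Finset.sum_add_distrib]
    refine Finset.sum_congr rfl fun j hj => ?_
    rw [h i j ⟨Nat.lt_succ_iff.mp (Finset.mem_range.mp hi),
      Nat.lt_succ_iff.mp (Finset.mem_range.mp hj)⟩ z hz]
    ring

/-! ### The nodes -/

/-- The sign of `x₁ + x₂` at the four nodes with the same pair of indices. -/
def signSum (i : Fin 4) : ℝ := ![1, 1, -1, -1] i

/-- The sign of `x₁ - x₂` at the four nodes with the same pair of indices. -/
def signDiff (i : Fin 4) : ℝ := ![1, -1, -1, 1] i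

section

variable {n : ℕ} (θ : Fin n → ℝ) (ν : NodeIndex n)

theorem node_mem_square : node θ ν ∈ square := by
  have hs := Real.cos_mem_Icc ((θ ν.1.1.1 - θ ν.1.1.2) / 2)
  have ht := Real.cos_mem_Icc ((θ ν.1.1.1 + θ ν.1.1.2) / 2)
  obtain ⟨p, i⟩ := ν
  have hneg : ∀ {x : ℝ}, x ∈ Set.Icc (-1 : ℝ) 1 → -x ∈ Set.Icc (-1 : ℝ) 1 := fun h =>
    ⟨by linarith [h.2], by linarith [h.1]⟩
  fin_cases i
  · exact ⟨hs, ht⟩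
  · exact ⟨ht, hs⟩
  · exact ⟨hneg hs, hneg ht⟩
  · exact ⟨hneg ht, hneg hs⟩

theorem node_add : (node θ ν).1 + (node θ ν).2 =
    signSum ν.2 * (2 * Real.cos (θ ν.1.1.1 / 2) * Real.cos (θ ν.1.1.2 / 2)) := by
  obtain ⟨p, i⟩ := ν
  have e1 : (θ p.1.1 - θ p.1.2) / 2 = θ p.1.1 / 2 - θ p.1.2 / 2 := by ring
  have e2 : (θ p.1.1 + θ p.1.2) / 2 = θ p.1.1 / 2 + θ p.1.2 / 2 := by ring
  fin_cases i <;> simp [node, signSum, e1, e2, Real.cos_add, Real.cos_sub] <;> ring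

theorem node_sub : (node θ ν).1 - (node θ ν).2 =
    signDiff ν.2 * (2 * Real.sin (θ ν.1.1.1 / 2) * Real.sin (θ ν.1.1.2 / 2)) := by
  obtain ⟨p, i⟩ := ν
  have e1 : (θ p.1.1 - θ p.1.2) / 2 = θ p.1.1 / 2 - θ p.1.2 / 2 := by ring
  have e2 : (θ p.1.1 + θ p.1.2) / 2 = θ p.1.1 / 2 + θ p.1.2 / 2 := by ring
  fin_cases i <;> simp [node, signDiff, e1, e2, Real.cos_add, Real.cos_sub] <;> ring

theorem sq_two_mul_cos_mul_cos (a b : ℝ) : (2 * Real.cos (a / 2) * Real.cos (b / 2)) ^ 2 =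
    (1 + Real.cos a) * (1 + Real.cos b) := by
  have h : ∀ c : ℝ, 1 + Real.cos c = 2 * Real.cos (c / 2) ^ 2 := fun c => by
    rw [Real.cos_sq, mul_div_cancel₀ c two_ne_zero]; ring
  rw [h, h]; ring

theorem sq_two_mul_sin_mul_sin (a b : ℝ) : (2 * Real.sin (a / 2) * Real.sin (b / 2)) ^ 2 =
    (1 - Real.cos a) * (1 - Real.cos b) := by
  have h : ∀ c : ℝ, 1 - Real.cos c = 2 * Real.sin (c / 2) ^ 2 := fun c => by
    rw [Real.sin_sq, Real.cos_sq, mul_div_cancel₀ c two_ne_zero]; ring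
  rw [h, h]; ring

theorem signSum_sq (i : Fin 4) : signSum i ^ 2 = 1 := by fin_cases i <;> simp [signSum]

theorem signDiff_sq (i : Fin 4) : signDiff i ^ 2 = 1 := by fin_cases i <;> simp [signDiff]

/-- At a node, the pair `(cos (θ₁ - θ₂), cos (θ₁ + θ₂))` is a pair of zeros, up to order. -/
theorem cosDiff_cosSum_node :
    (cosDiff (node θ ν) = Real.cos (θ ν.1.1.1) ∧ cosSum (node θ ν) = Real.cos (θ ν.1.1.2)) ∨
    (cosDiff (node θ ν) = Real.cos (θ ν.1.1.2) ∧ cosSum (node θ ν) = Real.cos (θ ν.1.1.1)) := by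
  have hz := node_mem_square θ ν
  have h1 := add_sq_eq hz
  have h2 := sub_sq_eq hz
  rw [node_add, mul_pow, signSum_sq, one_mul, sq_two_mul_cos_mul_cos] at h1
  rw [node_sub, mul_pow, signDiff_sq, one_mul, sq_two_mul_sin_mul_sin] at h2
  have hsum : cosDiff (node θ ν) + cosSum (node θ ν) =
      Real.cos (θ ν.1.1.1) + Real.cos (θ ν.1.1.2) := by linear_combination (h2 - h1) / 2
  have hprod : (cosDiff (node θ ν) - Real.cos (θ ν.1.1.1)) *
      (cosDiff (node θ ν) - Real.cos (θ ν.1.1.2)) = 0 := by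
    linear_combination (cosDiff (node θ ν)) * hsum + (h1 + h2) / 2
  rcases mul_eq_zero.mp hprod with h | h
  · exact Or.inl ⟨by linarith, by linarith⟩
  · exact Or.inr ⟨by linarith, by linarith⟩

theorem symm_apply_node {F : ℝ → ℝ → ℝ} (hF : ∀ s t, F s t = F t s) :
    F (cosDiff (node θ ν)) (cosSum (node θ ν)) =
      F (Real.cos (θ ν.1.1.1)) (Real.cos (θ ν.1.1.2)) := by
  rcases cosDiff_cosSum_node θ ν with ⟨h1, h2⟩ | ⟨h1, h2⟩
  · rw [h1, h2]
  · rw [h1, h2, hF]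

end

/-! ### Sums over the nodes -/

/-- The weights `1` on the diagonal and `2` off it turn sums over `j ≤ k` into sums over all pairs.
-/
theorem sum_pairs_le {n : ℕ} {f : Fin n → Fin n → ℝ} (hf : ∀ j k, f j k = f k j) :
    ∑ p : {p : Fin n × Fin n // p.1 ≤ p.2}, (if p.1.1 = p.1.2 then 1 else 2) * f p.1.1 p.1.2 =
      ∑ j, ∑ k, f j k := by
  have h1 : ∑ p : {p : Fin n × Fin n // p.1 ≤ p.2},
      (if p.1.1 = p.1.2 then 1 else 2) * f p.1.1 p.1.2 =
      ∑ p : Fin n × Fin n, if p.1 ≤ p.2 then (if p.1 = p.2 then 1 else 2) * f p.1 p.2 else 0 := by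
    rw [← Finset.sum_filter]
    exact (Finset.sum_subtype _ (by simp)
      (fun p : Fin n × Fin n => (if p.1 = p.2 then 1 else 2) * f p.1 p.2)).symm
  have h2 : ∑ p : Fin n × Fin n, (if p.2 < p.1 then f p.1 p.2 else 0) =
      ∑ p : Fin n × Fin n, if p.1 < p.2 then f p.1 p.2 else 0 := by
    rw [← (Equiv.prodComm (Fin n) (Fin n)).sum_comp]
    refine Finset.sum_congr rfl fun p _ => ?_
    simp [hf p.2]
  have h3 : ∑ j, ∑ k, f j k = ∑ p : Fin n × Fin n, (if p.1 ≤ p.2 then f p.1 p.2 else 0) +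
      ∑ p : Fin n × Fin n, (if p.2 < p.1 then f p.1 p.2 else 0) := by
    rw [← Finset.sum_add_distrib, ← Fintype.sum_prod_type']
    refine Finset.sum_congr rfl fun p _ => ?_
    rcases lt_or_ge p.2 p.1 with h | h
    · simp [h, not_le.mpr h]
    · simp [h, not_lt.mpr h]
  rw [h1, h3, h2, ← Finset.sum_add_distrib]
  refine Finset.sum_congr rfl fun p _ => ?_
  rcases lt_trichotomy p.1 p.2 with h | h | h
  · simp [h, h.le, h.ne]; ring
  · simp [h]
  · simp [not_le.mpr h, h.le]

section

variable {α β : ℝ} {n : ℕ} (θ : Fin n → ℝ) {F : ℝ → ℝ → ℝ} (hF : ∀ s t, F s t = F t s)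
include hF

theorem sum_nodes_eq (a b : ℕ) :
    ∑ ν, nodeWeight α β θ ν * (((node θ ν).1 + (node θ ν).2) ^ a *
      ((node θ ν).1 - (node θ ν).2) ^ b * F (cosDiff (node θ ν)) (cosSum (node θ ν))) =
    (∑ i, signSum i ^ a * signDiff i ^ b) * ∑ p : {p : Fin n × Fin n // p.1 ≤ p.2},
      (if p.1.1 = p.1.2 then 1 / 4 else 1 / 2) * gaussWeight α β n θ p.1.1 *
        gaussWeight α β n θ p.1.2 * ((2 * Real.cos (θ p.1.1 / 2) * Real.cos (θ p.1.2 / 2)) ^ a *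
          (2 * Real.sin (θ p.1.1 / 2) * Real.sin (θ p.1.2 / 2)) ^ b *
          F (Real.cos (θ p.1.1)) (Real.cos (θ p.1.2))) := by
  rw [Fintype.sum_prod_type, Finset.mul_sum]
  refine Finset.sum_congr rfl fun p _ => ?_
  rw [Finset.sum_mul]
  refine Finset.sum_congr rfl fun i _ => ?_
  rw [symm_apply_node θ (p, i) hF, node_add, node_sub, nodeWeight, mul_pow, mul_pow]
  ring

/-- Sums over the nodes of functions that are even in `x₁ + x₂` and in `x₁ - x₂` are Gauss sums in
both of the variables `cos (θ₁ - θ₂)` and `cos (θ₁ + θ₂)`. -/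
theorem sum_nodes_even (a b : ℕ) :
    ∑ ν, nodeWeight α β θ ν * (((node θ ν).1 + (node θ ν).2) ^ (2 * a) *
      ((node θ ν).1 - (node θ ν).2) ^ (2 * b) * F (cosDiff (node θ ν)) (cosSum (node θ ν))) =
    ∑ j, ∑ k, gaussWeight α β n θ j * gaussWeight α β n θ k *
      (((1 + Real.cos (θ j)) * (1 + Real.cos (θ k))) ^ a *
        ((1 - Real.cos (θ j)) * (1 - Real.cos (θ k))) ^ b *
        F (Real.cos (θ j)) (Real.cos (θ k))) := by
  have h4 : ∑ i : Fin 4, signSum i ^ (2 * a) * signDiff i ^ (2 * b) = 4 := by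
    simp [pow_mul, signSum_sq, signDiff_sq]
  rw [sum_nodes_eq θ hF, h4, ← sum_pairs_le, Finset.mul_sum]
  · refine Finset.sum_congr rfl fun p _ => ?_
    rw [pow_mul, pow_mul, sq_two_mul_cos_mul_cos, sq_two_mul_sin_mul_sin]
    split_ifs <;> ring
  · intro j k
    rw [hF, mul_comm (1 + Real.cos (θ j)), mul_comm (1 - Real.cos (θ j)),
      mul_comm (gaussWeight α β n θ j)]

theorem sum_nodes_odd {a b : ℕ} (h : ¬(Even a ∧ Even b)) :
    ∑ ν, nodeWeight α β θ ν * (((node θ ν).1 + (node θ ν).2) ^ a *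
      ((node θ ν).1 - (node θ ν).2) ^ b * F (cosDiff (node θ ν)) (cosSum (node θ ν))) = 0 := by
  have h0 : ∑ i : Fin 4, signSum i ^ a * signDiff i ^ b = 0 := by
    simp only [Fin.sum_univ_four, signSum, signDiff, Matrix.cons_val, one_pow]
    by_cases ha : Even a
    · have hb : Odd b := by rw [← Nat.not_even_iff_odd]; exact fun hb => h ⟨ha, hb⟩
      rw [ha.neg_one_pow, hb.neg_one_pow]; norm_num
    · rw [Nat.not_even_iff_odd] at ha
      rw [ha.neg_one_pow]; ring
  rw [sum_nodes_eq θ hF, h0, zero_mul]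

end

/-! ### The cubature rule -/

theorem sum_nodes_even_moment {α β : ℝ} {n : ℕ} (θ : Fin n → ℝ) (a b : ℕ) :
    ∑ ν, nodeWeight α β θ ν * (((node θ ν).1 + (node θ ν).2) ^ (2 * a) *
      ((node θ ν).1 - (node θ ν).2) ^ (2 * b)) =
    (∑ k, gaussWeight α β n θ k *
      ((1 - Polynomial.X) ^ b * (1 + Polynomial.X) ^ a : Polynomial ℝ).eval
        (Real.cos (θ k))) ^ 2 := by
  have h := sum_nodes_even (α := α) (β := β) θ (F := fun _ _ => 1) (fun _ _ => rfl) a b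
  simp only [mul_one] at h
  rw [h, sq, Finset.sum_mul_sum]
  refine Finset.sum_congr rfl fun j _ => Finset.sum_congr rfl fun k _ => ?_
  simp only [Polynomial.eval_mul, Polynomial.eval_pow, Polynomial.eval_sub, Polynomial.eval_add,
    Polynomial.eval_one, Polynomial.eval_X, mul_pow]
  ring

section

variable {α β : ℝ} (hα : -1 < α) (hβ : -1 < β) {n : ℕ} {θ : Fin n → ℝ}
include hα hβ

theorem cubature_sumDiff (hθ : IsZeroAngles α β n θ) {a b : ℕ} (hab : a + b ≤ 4 * n - 1)
    (hn : 1 ≤ n) :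
    ∫ z in square, evalAt (sumDiff a b) z * weight α β z =
      ∑ ν, nodeWeight α β θ ν * evalAt (sumDiff a b) (node θ ν) := by
  simp only [evalAt_sumDiff]
  by_cases h : Even a ∧ Even b
  · obtain ⟨⟨a, rfl⟩, ⟨b, rfl⟩⟩ := h
    rw [← two_mul, ← two_mul, integral_even_moment hα hβ, sum_nodes_even_moment,
      gauss_jacobi hα hβ hθ]
    exact degree_lt_of_natDegree_lt ((natDegree_one_sub_X_pow_mul_le _ _).trans_lt (by omega))
  · have h0 := sum_nodes_odd (α := α) (β := β) θ (F := fun _ _ => 1) (fun _ _ => rfl) h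
    simp only [mul_one] at h0
    rw [integral_odd_moment h, h0]

theorem integrableOn_evalAt_mul_weight (p : MvPolynomial (Fin 2) ℝ) :
    IntegrableOn (fun z => evalAt p z * weight α β z) square :=
  integrableOn_mul_weight hα hβ (continuous_evalAt p).continuousOn

theorem cubature_exact (hθ : IsZeroAngles α β n θ) (hn : 1 ≤ n) {p : MvPolynomial (Fin 2) ℝ}
    (hp : p ∈ polys (4 * n - 1)) :
    ∫ z in square, evalAt p z * weight α β z = ∑ ν, nodeWeight α β θ ν * evalAt p (node θ ν) := by
  replace hp := polys_le_span_sumDiff _ hp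
  induction hp using Submodule.span_induction with
  | mem q hq =>
    obtain ⟨a, b, hab, rfl⟩ := hq
    exact cubature_sumDiff hα hβ hθ hab hn
  | zero => simp
  | add p q _ _ ihp ihq =>
    simp only [evalAt_add, add_mul, mul_add, Finset.sum_add_distrib]
    rw [integral_add (integrableOn_evalAt_mul_weight hα hβ p)
      (integrableOn_evalAt_mul_weight hα hβ q), ihp, ihq]
  | smul c p _ ihp =>
    simp only [evalAt_smul, mul_assoc, mul_left_comm _ c]
    rw [integral_const_mul, ihp, Finset.mul_sum]

/-- The rule misses the integral of `(x₁ + x₂)^(4n)`: by `sum_nodes_even_moment` and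
`integral_even_moment` the two sides are the squares of a Gauss sum and of the integral of
`(1 + t)^(2n)`, which is larger by the positive error term. -/
theorem cubature_not_exact (hθ : IsZeroAngles α β n θ) :
    ∫ z in square, evalAt (sumDiff (4 * n) 0) z * weight α β z ≠
      ∑ ν, nodeWeight α β θ ν * evalAt (sumDiff (4 * n) 0) (node θ ν) := by
  simp only [evalAt_sumDiff]
  rw [show 4 * n = 2 * (2 * n) by ring, show (0 : ℕ) = 2 * 0 by rfl, integral_even_moment hα hβ,
    sum_nodes_even_moment]
  have hdeg := natDegree_one_sub_X_pow_mul_le 0 (2 * n)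
  have hcoef : ((1 - Polynomial.X) ^ 0 * (1 + Polynomial.X) ^ (2 * n) : Polynomial ℝ).coeff
      (2 * n) = 1 := by
    rw [pow_zero, one_mul, Polynomial.coeff_one_add_X_pow, Nat.choose_self, Nat.cast_one]
  rw [gauss_jacobi_error hα hβ hθ (hdeg.trans (by omega)), hcoef]
  have h1 := (isOrthonormalSeq_jacobi hα hβ).coeff_ne_zero n
  have h2 : 0 < 1 / (jacobiONPoly α β n).coeff n ^ 2 := by positivity
  have h3 : 0 ≤ ∑ k, gaussWeight α β n θ k * ((1 - Polynomial.X) ^ 0 *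
      (1 + Polynomial.X) ^ (2 * n) : Polynomial ℝ).eval (Real.cos (θ k)) := by
    refine Finset.sum_nonneg fun k _ => mul_nonneg (gaussWeight_pos hα hβ hθ k).le ?_
    simp only [pow_zero, one_mul, Polynomial.eval_pow]
    exact (even_two_mul n).pow_nonneg _
  intro h
  nlinarith

end

/-! ### Kernels on the square -/

/-- The symmetrized product of a kernel in one variable, as a kernel on the square. -/
def symmKernel (k : ℝ → ℝ → ℝ) (z w : ℝ × ℝ) : ℝ :=
  1 / 2 * (k (cosDiff z) (cosDiff w) * k (cosSum z) (cosSum w) +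
    k (cosDiff z) (cosSum w) * k (cosSum z) (cosDiff w))

/-- The kernel on the square built from four kernels in one variable, one for each type of parity
in `x₁ - x₂` (first index) and in `x₁ + x₂` (second index). -/
def parityKernel (k : Fin 2 → Fin 2 → ℝ → ℝ → ℝ) (z w : ℝ × ℝ) : ℝ :=
  ∑ i : Fin 2, ∑ j : Fin 2, (z.1 + z.2) ^ (j : ℕ) * (z.1 - z.2) ^ (i : ℕ) *
    ((w.1 + w.2) ^ (j : ℕ) * (w.1 - w.2) ^ (i : ℕ)) * symmKernel (k i j) z w

/-- The scaled Jacobi kernels from which `kernelOdd` is built. -/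
def oddKernels (α β : ℝ) (n : ℕ) (i j : Fin 2) (s t : ℝ) : ℝ :=
  jacobiConst (α + (i : ℕ)) (β + (j : ℕ)) / jacobiConst α β *
    jacobiKernel (α + (i : ℕ)) (β + (j : ℕ)) (n - i * j) s t

/-- The kernels from which `kernelStar` with the coefficients `bCoeff` is built. -/
def starKernels (α β : ℝ) (n : ℕ) (i j : Fin 2) : ℝ → ℝ → ℝ :=
  if i = 1 ∧ j = 1 then starKernel α β n else oddKernels α β n i j

theorem symmKernel_const_mul (c : ℝ) (k : ℝ → ℝ → ℝ) (z w : ℝ × ℝ) :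
    symmKernel (fun s t => c * k s t) z w = c ^ 2 * symmKernel k z w := by
  simp only [symmKernel]; ring

theorem kernelOdd_eq {α β : ℝ} (hα : -1 < α) (hβ : -1 < β) (n : ℕ) (z w : ℝ × ℝ) :
    kernelOdd α β n z w = parityKernel (oddKernels α β n) z w := by
  have hc := (jacobiConst_pos hα hβ).ne'
  have hk : ∀ i j : Fin 2, symmKernel (oddKernels α β n i j) z w =
      dConst α β i j * kernelK (α + (i : ℕ)) (β + (j : ℕ)) (n - i * j) z w := fun i j => by
    change symmKernel (fun s t => _ * jacobiKernel _ _ _ s t) z w = _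
    rw [symmKernel_const_mul, dConst, div_pow]
    rfl
  have h00 : dConst α β 0 0 = 1 := by simp [dConst, hc]
  simp only [parityKernel, Fin.sum_univ_two, hk, kernelOdd]
  simp [h00]
  ring

theorem dConst_one_one (α β : ℝ) :
    dConst α β 1 1 = (jacobiConst (α + 1) (β + 1) / jacobiConst α β) ^ 2 := by
  simp [dConst, div_pow]

theorem Q₂_of_lt (α β : ℝ) {m k : ℕ} (hk : k < m) (z : ℝ × ℝ) :
    Q₂ α β (m + 1) k z = jacobiConst (α + 1) (β + 1) / jacobiConst α β / √2 *
      (z.1 ^ 2 - z.2 ^ 2) *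
      (jacobiON (α + 1) (β + 1) m (cosDiff z) * jacobiON (α + 1) (β + 1) k (cosSum z) +
        jacobiON (α + 1) (β + 1) k (cosDiff z) * jacobiON (α + 1) (β + 1) m (cosSum z)) := by
  rw [Q₂, if_neg (by omega), Nat.add_sub_cancel, div_div, mul_comm √2]
  ring

theorem Q₂_last (α β : ℝ) (m : ℕ) (z : ℝ × ℝ) :
    Q₂ α β (m + 1) m z = jacobiConst (α + 1) (β + 1) / jacobiConst α β * (z.1 ^ 2 - z.2 ^ 2) *
      (jacobiON (α + 1) (β + 1) m (cosDiff z) * jacobiON (α + 1) (β + 1) m (cosSum z)) := by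
  have h20 : √(2 : ℝ) ≠ 0 := by positivity
  rw [Q₂, if_pos rfl, Nat.add_sub_cancel, ← div_div, div_right_comm]
  field_simp
  ring

theorem jacobiKernel_succ (α β : ℝ) (N : ℕ) (s t : ℝ) :
    jacobiKernel α β (N + 1) s t = jacobiKernel α β N s t + jacobiON α β N s * jacobiON α β N t :=
  Finset.sum_range_succ _ _

/-- The last coefficient of `kernelStar` is the square of the other ones, which differ from it by
the factor in the closed form. -/
theorem bCoeff_sub_sq {α β : ℝ} (hα : -1 < α) (hβ : -1 < β) {n : ℕ} (hn : 1 ≤ n) :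
    n * (1 + α + β + n) / (1 + α + β + 2 * n) ^ 2 =
      (1 + α + β + n) / (1 + α + β + 2 * n) - ((1 + α + β + n) / (1 + α + β + 2 * n)) ^ 2 := by
  have hn1 : (1 : ℝ) ≤ n := by exact_mod_cast hn
  have hden : 1 + α + β + 2 * (n : ℝ) ≠ 0 := by linarith
  field_simp
  ring

/-- The closed form of `kernelStar` with the coefficients `bCoeff`: the products `Q_k(z) Q_k(w)`
with `k < n - 1` are the mixed terms, with one factor of degree `n - 1`, in `K_{n-1}^{α+1,β+1} -
K_{n-2}^{α+1,β+1}`. -/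
theorem kernelStar_eq_closed {α β : ℝ} (hα : -1 < α) (hβ : -1 < β) {n : ℕ} (hn : 1 ≤ n)
    (z w : ℝ × ℝ) :
    kernelStar α β n (bCoeff α β n) z w =
        kernelOdd α β n z w +
          (1 + α + β + n) / (1 + α + β + 2 * n) * dConst α β 1 1 *
            (z.1 ^ 2 - z.2 ^ 2) * (w.1 ^ 2 - w.2 ^ 2) *
            (kernelK (α + 1) (β + 1) n z w - kernelK (α + 1) (β + 1) (n - 1) z w) -
          n * (1 + α + β + n) / (1 + α + β + 2 * n) ^ 2 *
            Q₂ α β n (n - 1) z * Q₂ α β n (n - 1) w := by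
  obtain ⟨m, rfl⟩ : ∃ m, n = m + 1 := ⟨n - 1, by omega⟩
  have h2 : √2 ^ 2 = (2 : ℝ) := Real.sq_sqrt (by norm_num)
  have h20 : √(2 : ℝ) ≠ 0 := by positivity
  rw [bCoeff_sub_sq hα hβ hn]
  set r := (1 + α + β + ((m + 1 : ℕ) : ℝ)) / (1 + α + β + 2 * ((m + 1 : ℕ) : ℝ)) with hr
  rw [kernelStar, add_sub_assoc, add_right_inj]
  simp only [bCoeff, Nat.add_sub_cancel, ← hr]
  rw [Fin.sum_univ_castSucc]
  simp only [Fin.val_castSucc, Fin.val_last, if_true]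
  set κ := jacobiConst (α + 1) (β + 1) / jacobiConst α β with hκ
  set q := jacobiON (α + 1) (β + 1) m with hq
  have hsum : ∑ k : Fin m, (if (k : ℕ) + 1 = m + 1 then r ^ 2 else r) *
      Q₂ α β (m + 1) k z * Q₂ α β (m + 1) k w =
      r * (κ ^ 2 / 2) * (z.1 ^ 2 - z.2 ^ 2) * (w.1 ^ 2 - w.2 ^ 2) *
        ∑ k ∈ Finset.range m, (q (cosDiff z) * jacobiON (α + 1) (β + 1) k (cosSum z) +
        jacobiON (α + 1) (β + 1) k (cosDiff z) * q (cosSum z)) *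
        (q (cosDiff w) * jacobiON (α + 1) (β + 1) k (cosSum w) +
        jacobiON (α + 1) (β + 1) k (cosDiff w) * q (cosSum w)) := by
    rw [Finset.mul_sum, Finset.sum_range]
    refine Finset.sum_congr rfl fun k _ => ?_
    have : (k : ℕ) + 1 ≠ m + 1 := by have := k.2; omega
    rw [if_neg this, Q₂_of_lt α β k.2, Q₂_of_lt α β k.2, ← hκ, ← hq]
    field_simp
    rw [h2]
    ring
  have hsplit : ∑ k ∈ Finset.range m, (q (cosDiff z) * jacobiON (α + 1) (β + 1) k (cosSum z) +
        jacobiON (α + 1) (β + 1) k (cosDiff z) * q (cosSum z)) *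
        (q (cosDiff w) * jacobiON (α + 1) (β + 1) k (cosSum w) +
        jacobiON (α + 1) (β + 1) k (cosDiff w) * q (cosSum w)) =
      q (cosDiff z) * q (cosDiff w) * jacobiKernel (α + 1) (β + 1) m (cosSum z) (cosSum w) +
      q (cosDiff z) * q (cosSum w) * jacobiKernel (α + 1) (β + 1) m (cosSum z) (cosDiff w) +
      q (cosSum z) * q (cosDiff w) * jacobiKernel (α + 1) (β + 1) m (cosDiff z) (cosSum w) +
      q (cosSum z) * q (cosSum w) * jacobiKernel (α + 1) (β + 1) m (cosDiff z) (cosDiff w) := by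
    simp only [jacobiKernel, Finset.mul_sum, ← Finset.sum_add_distrib]
    exact Finset.sum_congr rfl fun k _ => by ring
  rw [hsum, hsplit, dConst_one_one, Q₂_last, Q₂_last, kernelK, kernelK, ← hκ, ← hq]
  simp only [jacobiKernel_succ, ← hq]
  ring

/-- The coefficients `bCoeff` are those for which the part of `kernelStar` that is odd in `x₁ + x₂`
and in `x₁ - x₂` is a symmetrized product of a kernel in one variable, namely `starKernel`. -/
theorem kernelStar_eq {α β : ℝ} (hα : -1 < α) (hβ : -1 < β) {n : ℕ} (hn : 1 ≤ n)
    (z w : ℝ × ℝ) :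
    kernelStar α β n (bCoeff α β n) z w = parityKernel (starKernels α β n) z w := by
  rw [kernelStar_eq_closed hα hβ hn, kernelOdd_eq hα hβ]
  obtain ⟨m, rfl⟩ : ∃ m, n = m + 1 := ⟨n - 1, by omega⟩
  set r := (1 + α + β + ((m + 1 : ℕ) : ℝ)) / (1 + α + β + 2 * ((m + 1 : ℕ) : ℝ)) with hr
  set κ := jacobiConst (α + 1) (β + 1) / jacobiConst α β with hκ
  set q := jacobiON (α + 1) (β + 1) m with hq
  have hodd : ∀ s t, oddKernels α β (m + 1) 1 1 s t =
      κ * jacobiKernel (α + 1) (β + 1) m s t := fun s t => by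
    simp [oddKernels, hκ]
  have hstar : ∀ s t, starKernel α β (m + 1) s t =
      κ * (jacobiKernel (α + 1) (β + 1) m s t + r * (q s * q t)) := fun s t => by
    simp only [starKernel, Nat.add_sub_cancel, hκ, hr, hq]
  rw [bCoeff_sub_sq hα hβ hn, Nat.add_sub_cancel, Q₂_last, Q₂_last, dConst_one_one, ← hκ, ← hq,
    ← hr]
  simp only [parityKernel, Fin.sum_univ_two, starKernels]
  simp only [symmKernel, kernelK, jacobiKernel_succ, ← hq, hodd, hstar, and_true, and_false,
    if_true, zero_ne_one, if_false, Fin.val_one, Fin.val_zero]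
  ring

/-! ### Kernels at the nodes -/

section

variable {α β : ℝ} (hα : -1 < α) (hβ : -1 < β) {n : ℕ} {θ : Fin n → ℝ}

theorem IsZeroAngles.one_sub_cos_pos (hθ : IsZeroAngles α β n θ) (k : Fin n) :
    0 < 1 - Real.cos (θ k) := by
  have h := Real.cos_lt_cos_of_nonneg_of_le_pi le_rfl (hθ.2 k).1.2.le (hθ.2 k).1.1
  rw [Real.cos_zero] at h
  linarith

theorem IsZeroAngles.one_add_cos_pos (hθ : IsZeroAngles α β n θ) (k : Fin n) :
    0 < 1 + Real.cos (θ k) := by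
  have h := Real.cos_lt_cos_of_nonneg_of_le_pi (hθ.2 k).1.1.le le_rfl (hθ.2 k).1.2
  rw [Real.cos_pi] at h
  linarith

theorem symmKernel_node (k : ℝ → ℝ → ℝ) (ν ν' : NodeIndex n) :
    symmKernel k (node θ ν) (node θ ν') =
      1 / 2 * (k (Real.cos (θ ν.1.1.1)) (Real.cos (θ ν'.1.1.1)) *
          k (Real.cos (θ ν.1.1.2)) (Real.cos (θ ν'.1.1.2)) +
        k (Real.cos (θ ν.1.1.1)) (Real.cos (θ ν'.1.1.2)) *
          k (Real.cos (θ ν.1.1.2)) (Real.cos (θ ν'.1.1.1))) := by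
  rw [symmKernel]
  rcases cosDiff_cosSum_node θ ν with ⟨h1, h2⟩ | ⟨h1, h2⟩ <;>
  rcases cosDiff_cosSum_node θ ν' with ⟨h3, h4⟩ | ⟨h3, h4⟩ <;>
    rw [h1, h2, h3, h4] <;> ring

include hα hβ

/-- If each of the four kernels in one variable is diagonal at the zeros of `P_n^{(α,β)}`, the
kernel on the square is diagonal at the nodes: for equal pairs of indices, the signs at the four
nodes are the characters of a group of order four. -/
theorem nodeWeight_mul_parityKernel (hθ : IsZeroAngles α β n θ)
    {k : Fin 2 → Fin 2 → ℝ → ℝ → ℝ}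
    (hk : ∀ (i j : Fin 2) (a b : Fin n), gaussWeight α β n θ b *
      ((1 - Real.cos (θ b)) ^ (i : ℕ) * (1 + Real.cos (θ b)) ^ (j : ℕ)) *
        k i j (Real.cos (θ a)) (Real.cos (θ b)) = if a = b then 1 else 0)
    (ν ν' : NodeIndex n) :
    nodeWeight α β θ ν' * parityKernel k (node θ ν) (node θ ν') = if ν = ν' then 1 else 0 := by
  have hl := fun a => (gaussWeight_pos hα hβ hθ a).ne'
  have hm := fun a => (hθ.one_sub_cos_pos a).ne'
  have hp := fun a => (hθ.one_add_cos_pos a).ne'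
  have hne : ∀ (i j : Fin 2) (a b : Fin n), a ≠ b →
      k i j (Real.cos (θ a)) (Real.cos (θ b)) = 0 := fun i j a b hab => by
    have h := hk i j a b
    rw [if_neg hab] at h
    exact (mul_eq_zero.mp h).resolve_left
      (mul_ne_zero (hl b) (mul_ne_zero (pow_ne_zero _ (hm b)) (pow_ne_zero _ (hp b))))
  have hself : ∀ (i j : Fin 2) (a : Fin n), k i j (Real.cos (θ a)) (Real.cos (θ a)) =
      (gaussWeight α β n θ a *
        ((1 - Real.cos (θ a)) ^ (i : ℕ) * (1 + Real.cos (θ a)) ^ (j : ℕ)))⁻¹ := fun i j a => by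
    have h := hk i j a a
    rw [if_pos rfl] at h
    exact eq_inv_of_mul_eq_one_right h
  obtain ⟨⟨⟨a, b⟩, hab⟩, c⟩ := ν
  obtain ⟨⟨⟨a', b'⟩, hab'⟩, c'⟩ := ν'
  simp only at hab hab'
  by_cases hpair : a = a' ∧ b = b'
  -- each of the four kernels contributes a quarter of the product of the signs
  · obtain ⟨rfl, rfl⟩ := hpair
    have hterm : ∀ i j : Fin 2, nodeWeight α β θ (⟨⟨(a, b), hab'⟩, c'⟩ : NodeIndex n) *
        (((node θ (⟨⟨(a, b), hab⟩, c⟩ : NodeIndex n)).1 +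
            (node θ (⟨⟨(a, b), hab⟩, c⟩ : NodeIndex n)).2) ^ (j : ℕ) *
          ((node θ (⟨⟨(a, b), hab⟩, c⟩ : NodeIndex n)).1 -
            (node θ (⟨⟨(a, b), hab⟩, c⟩ : NodeIndex n)).2) ^ (i : ℕ) *
        (((node θ (⟨⟨(a, b), hab'⟩, c'⟩ : NodeIndex n)).1 +
            (node θ (⟨⟨(a, b), hab'⟩, c'⟩ : NodeIndex n)).2) ^ (j : ℕ) *
          ((node θ (⟨⟨(a, b), hab'⟩, c'⟩ : NodeIndex n)).1 -
            (node θ (⟨⟨(a, b), hab'⟩, c'⟩ : NodeIndex n)).2) ^ (i : ℕ)) *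
        symmKernel (k i j) (node θ (⟨⟨(a, b), hab⟩, c⟩ : NodeIndex n))
          (node θ (⟨⟨(a, b), hab'⟩, c'⟩ : NodeIndex n))) =
        1 / 4 * ((signSum c * signSum c') ^ (j : ℕ) * (signDiff c * signDiff c') ^ (i : ℕ)) := by
      intro i j
      rw [symmKernel_node, node_add, node_add, node_sub, node_sub]
      simp only [nodeWeight]
      have e : (signSum c * (2 * Real.cos (θ a / 2) * Real.cos (θ b / 2))) ^ (j : ℕ) *
          (signDiff c * (2 * Real.sin (θ a / 2) * Real.sin (θ b / 2))) ^ (i : ℕ) *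
          ((signSum c' * (2 * Real.cos (θ a / 2) * Real.cos (θ b / 2))) ^ (j : ℕ) *
          (signDiff c' * (2 * Real.sin (θ a / 2) * Real.sin (θ b / 2))) ^ (i : ℕ)) =
          (signSum c * signSum c') ^ (j : ℕ) * (signDiff c * signDiff c') ^ (i : ℕ) *
          (((1 + Real.cos (θ a)) * (1 + Real.cos (θ b))) ^ (j : ℕ) *
            ((1 - Real.cos (θ a)) * (1 - Real.cos (θ b))) ^ (i : ℕ)) := by
        rw [← sq_two_mul_cos_mul_cos, ← sq_two_mul_sin_mul_sin]
        generalize 2 * Real.cos (θ a / 2) * Real.cos (θ b / 2) = A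
        generalize 2 * Real.sin (θ a / 2) * Real.sin (θ b / 2) = B
        simp only [mul_pow]
        ring
      rw [e]
      have := hl a
      have := hl b
      have := pow_ne_zero (i : ℕ) (hm a)
      have := pow_ne_zero (i : ℕ) (hm b)
      have := pow_ne_zero (j : ℕ) (hp a)
      have := pow_ne_zero (j : ℕ) (hp b)
      by_cases h : a = b
      · subst h
        rw [if_pos rfl, hself]
        simp only [mul_pow ((1 : ℝ) + _), mul_pow ((1 : ℝ) - _)]
        field_simp
        norm_num
      · rw [if_neg h, hself, hself, hne i j a b h, zero_mul, add_zero]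
        simp only [mul_pow ((1 : ℝ) + _), mul_pow ((1 : ℝ) - _)]
        field_simp
        ring
    rw [parityKernel, Finset.mul_sum]
    simp only [Finset.mul_sum, hterm]
    simp only [Fin.sum_univ_two]
    have hcc : ((⟨⟨(a, b), hab⟩, c⟩ : NodeIndex n) = ⟨⟨(a, b), hab'⟩, c'⟩) ↔ c = c' := by simp
    rw [if_congr hcc rfl rfl]
    fin_cases c <;> fin_cases c' <;> simp [signSum, signDiff] <;> norm_num
  · have hν : (⟨⟨(a, b), hab⟩, c⟩ : NodeIndex n) ≠ ⟨⟨(a', b'), hab'⟩, c'⟩ := by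
      intro h
      simp only [Prod.mk.injEq, Subtype.mk.injEq] at h
      exact hpair h.1
    -- some factor of each product sits off the diagonal; for the second product this uses that the
    -- pairs of indices are ordered
    rw [if_neg hν, parityKernel]
    refine mul_eq_zero_of_right _ (Finset.sum_eq_zero fun i _ => Finset.sum_eq_zero fun j _ =>
      mul_eq_zero_of_right _ ?_)
    rw [symmKernel_node]
    have h1 : k i j (Real.cos (θ a)) (Real.cos (θ a')) *
        k i j (Real.cos (θ b)) (Real.cos (θ b')) = 0 := by
      by_cases h : a = a'
      · rw [hne i j b b' fun h' => hpair ⟨h, h'⟩, mul_zero]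
      · rw [hne i j a a' h, zero_mul]
    have h2 : k i j (Real.cos (θ a)) (Real.cos (θ b')) *
        k i j (Real.cos (θ b)) (Real.cos (θ a')) = 0 := by
      by_cases h : a = b'
      · by_cases h' : b = a'
        · subst h h'
          have := le_antisymm hab hab'
          exact absurd ⟨this, this.symm⟩ hpair
        · rw [hne i j b a' h', mul_zero]
      · rw [hne i j a b' h, zero_mul]
    simp only [h1, h2, add_zero, mul_zero]

/-- The kernels of `kernelStar` reproduce with respect to the Gauss sums. -/
theorem starKernels_reproducing (hθ : IsZeroAngles α β n θ) (i j : Fin 2) {g : Polynomial ℝ}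
    (hg : g.degree < n) (t : ℝ) :
    ∑ k, gaussWeight α β n θ k *
      ((1 - Real.cos (θ k)) ^ (i : ℕ) * (1 + Real.cos (θ k)) ^ (j : ℕ)) *
      starKernels α β n i j t (Real.cos (θ k)) * g.eval (Real.cos (θ k)) = g.eval t := by
  by_cases h : i = 1 ∧ j = 1
  · obtain ⟨rfl, rfl⟩ := h
    exact discrete_reproducing_star hα hβ hθ hg t
  · rw [starKernels, if_neg h]
    have hij : (i : ℕ) * j = 0 ∧ (i : ℕ) + j ≤ 1 := by
      fin_cases i <;> fin_cases j <;> simp at h ⊢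
    simp only [oddKernels, hij.1, Nat.sub_zero]
    exact discrete_reproducing hα hβ hθ rfl rfl (by omega) hg t

/-- The fundamental interpolation polynomials take the values `0` and `1` at the nodes. -/
theorem nodeWeight_mul_kernelStar (hθ : IsZeroAngles α β n θ) (hn : 1 ≤ n) (ν ν' : NodeIndex n) :
    nodeWeight α β θ ν' * kernelStar α β n (bCoeff α β n) (node θ ν) (node θ ν') =
      if ν = ν' then 1 else 0 := by
  rw [kernelStar_eq hα hβ hn]
  refine nodeWeight_mul_parityKernel hα hβ hθ (fun i j a b => ?_) ν ν'
  exact kernel_eq_ite_of_reproducing hθ.cos_injective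
    (fun g hg t => starKernels_reproducing hα hβ hθ i j hg t) a b

theorem nodeWeight_ne_zero (hθ : IsZeroAngles α β n θ) (ν : NodeIndex n) :
    nodeWeight α β θ ν ≠ 0 := by
  have h1 := gaussWeight_pos hα hβ hθ ν.1.1.1
  have h2 := gaussWeight_pos hα hβ hθ ν.1.1.2
  rw [nodeWeight]
  split_ifs <;> positivity

/-- The nodes are distinct because `kernelStar` separates them. -/
theorem node_injective (hθ : IsZeroAngles α β n θ) (hn : 1 ≤ n) :
    Function.Injective (node θ) := by
  intro ν ν' h
  have h1 := nodeWeight_mul_kernelStar hα hβ hθ hn ν ν'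
  have h2 := nodeWeight_mul_kernelStar hα hβ hθ hn ν' ν'
  rw [h, h2, if_pos rfl] at h1
  by_contra hne
  rw [if_neg hne] at h1
  exact one_ne_zero h1

theorem isCubatureRule (hθ : IsZeroAngles α β n θ) (hn : 1 ≤ n) :
    IsCubatureRule (weight α β) (4 * n - 1) (node θ) (nodeWeight α β θ) where
  injective := node_injective hα hβ hθ hn
  mem_square := node_mem_square θ
  weight_ne_zero := nodeWeight_ne_zero hα hβ hθ
  exact_of_mem p hp := ⟨integrableOn_evalAt_mul_weight hα hβ p, cubature_exact hα hβ hθ hn hp⟩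
  exists_not_exact := ⟨sumDiff (4 * n) 0,
    polys_mono (by omega) (sumDiff_mem_polys (4 * n) 0),
    integrableOn_evalAt_mul_weight hα hβ _, cubature_not_exact hα hβ hθ⟩

end

/-! ### The reproducing kernel -/

/-- The discrete form of the reproducing property on the square: only the kernel with the parity of
`(x₁ + x₂)^a (x₁ - x₂)^b` contributes, and its contribution factors into Gauss sums. -/
theorem sum_nodes_parityKernel_mul_sumDiff {α β : ℝ} {n : ℕ} {θ : Fin n → ℝ}
    {k : Fin 2 → Fin 2 → ℝ → ℝ → ℝ} {N : ℕ} (i j : Fin 2)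
    (hk : ∀ g : Polynomial ℝ, g.degree < N → ∀ t,
      ∑ l, gaussWeight α β n θ l *
        ((1 - Real.cos (θ l)) ^ (i : ℕ) * (1 + Real.cos (θ l)) ^ (j : ℕ)) *
        k i j t (Real.cos (θ l)) * g.eval (Real.cos (θ l)) = g.eval t)
    {a b : ℕ} (hab : a + b < N) {z : ℝ × ℝ} (hz : z ∈ square) :
    ∑ ν, nodeWeight α β θ ν * (parityKernel k z (node θ ν) *
      evalAt (sumDiff (2 * a + j) (2 * b + i)) (node θ ν)) =
      evalAt (sumDiff (2 * a + j) (2 * b + i)) z := by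
  have hsymm : ∀ i' j' s t, 1 / 2 * (k i' j' (cosDiff z) s * k i' j' (cosSum z) t +
      k i' j' (cosDiff z) t * k i' j' (cosSum z) s) =
      1 / 2 * (k i' j' (cosDiff z) t * k i' j' (cosSum z) s +
      k i' j' (cosDiff z) s * k i' j' (cosSum z) t) := fun i' j' s t => by ring
  have hsplit : ∑ ν, nodeWeight α β θ ν * (parityKernel k z (node θ ν) *
      evalAt (sumDiff (2 * a + j) (2 * b + i)) (node θ ν)) =
      ∑ i' : Fin 2, ∑ j' : Fin 2, (z.1 + z.2) ^ (j' : ℕ) * (z.1 - z.2) ^ (i' : ℕ) *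
        ∑ ν, nodeWeight α β θ ν * (((node θ ν).1 + (node θ ν).2) ^ (2 * a + j + j') *
          ((node θ ν).1 - (node θ ν).2) ^ (2 * b + i + i') *
          (fun s t => 1 / 2 * (k i' j' (cosDiff z) s * k i' j' (cosSum z) t +
            k i' j' (cosDiff z) t * k i' j' (cosSum z) s))
            (cosDiff (node θ ν)) (cosSum (node θ ν))) := by
    simp only [Finset.mul_sum]
    rw [← Fintype.sum_prod_type', Finset.sum_comm]
    refine Finset.sum_congr rfl fun ν _ => ?_
    rw [parityKernel, Finset.sum_mul, Finset.mul_sum, Fintype.sum_prod_type]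
    refine Finset.sum_congr rfl fun i' _ => ?_
    rw [Finset.sum_mul, Finset.mul_sum]
    refine Finset.sum_congr rfl fun j' _ => ?_
    rw [evalAt_sumDiff, symmKernel, pow_add _ (2 * a + (j : ℕ)), pow_add _ (2 * b + (i : ℕ))]
    ring
  rw [hsplit, Finset.sum_eq_single i, Finset.sum_eq_single j]
  · rw [show 2 * a + (j : ℕ) + j = 2 * (a + j) by ring,
      show 2 * b + (i : ℕ) + i = 2 * (b + i) by ring, sum_nodes_even θ (hsymm i j)]
    have hg := hk ((1 - Polynomial.X) ^ b * (1 + Polynomial.X) ^ a)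
      (degree_lt_of_natDegree_lt ((natDegree_one_sub_X_pow_mul_le _ _).trans_lt (by omega)))
    simp only [Polynomial.eval_mul, Polynomial.eval_pow, Polynomial.eval_sub, Polynomial.eval_add,
      Polynomial.eval_one, Polynomial.eval_X] at hg
    rw [evalAt_sumDiff, pow_add, pow_add, pow_mul, pow_mul, add_sq_eq hz, sub_sq_eq hz,
      mul_pow, mul_pow]
    have hprod : ∀ s t, ((1 - s) ^ b * (1 + s) ^ a) * ((1 - t) ^ b * (1 + t) ^ a) =
        ∑ l, ∑ l', gaussWeight α β n θ l * gaussWeight α β n θ l' *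
          (((1 + Real.cos (θ l)) * (1 + Real.cos (θ l'))) ^ (a + (j : ℕ)) *
          ((1 - Real.cos (θ l)) * (1 - Real.cos (θ l'))) ^ (b + (i : ℕ)) *
          (k i j s (Real.cos (θ l)) * k i j t (Real.cos (θ l')))) := fun s t => by
      rw [← hg s, ← hg t, Finset.sum_mul_sum]
      refine Finset.sum_congr rfl fun l _ => Finset.sum_congr rfl fun l' _ => ?_
      simp only [mul_pow, pow_add]
      ring
    have h1 := hprod (cosDiff z) (cosSum z)
    have h2 := h1
    rw [Finset.sum_comm] at h2
    have h3 : ((1 - cosDiff z) ^ b * (1 + cosDiff z) ^ a) *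
        ((1 - cosSum z) ^ b * (1 + cosSum z) ^ a) =
        1 / 2 * (((1 - cosDiff z) ^ b * (1 + cosDiff z) ^ a) *
        ((1 - cosSum z) ^ b * (1 + cosSum z) ^ a) + ((1 - cosDiff z) ^ b * (1 + cosDiff z) ^ a) *
        ((1 - cosSum z) ^ b * (1 + cosSum z) ^ a)) := by ring
    have h4 : (1 + cosDiff z) ^ a * (1 + cosSum z) ^ a * (z.1 + z.2) ^ (j : ℕ) *
        ((1 - cosDiff z) ^ b * (1 - cosSum z) ^ b * (z.1 - z.2) ^ (i : ℕ)) =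
        (z.1 + z.2) ^ (j : ℕ) * (z.1 - z.2) ^ (i : ℕ) *
        (((1 - cosDiff z) ^ b * (1 + cosDiff z) ^ a) *
        ((1 - cosSum z) ^ b * (1 + cosSum z) ^ a)) := by ring
    rw [h4, h3]
    congr 1
    nth_rewrite 1 [h1]
    rw [h2, ← Finset.sum_add_distrib, Finset.mul_sum]
    refine Finset.sum_congr rfl fun l _ => ?_
    rw [← Finset.sum_add_distrib, Finset.mul_sum]
    refine Finset.sum_congr rfl fun l' _ => ?_
    rw [mul_comm (1 + Real.cos (θ l')), mul_comm (1 - Real.cos (θ l'))]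
    ring
  · intro j' _ hj'
    rw [sum_nodes_odd θ (hsymm i j'), mul_zero]
    fin_cases j <;> fin_cases j' <;> simp [parity_simps] at hj' ⊢
  · simp
  · intro i' _ hi'
    refine Finset.sum_eq_zero fun j' _ => ?_
    rw [sum_nodes_odd θ (hsymm i' j'), mul_zero]
    fin_cases i <;> fin_cases i' <;> simp [parity_simps] at hi' ⊢
  · simp

theorem jacobiKernel_comm (α β : ℝ) (N : ℕ) (s t : ℝ) :
    jacobiKernel α β N s t = jacobiKernel α β N t s :=
  Finset.sum_congr rfl fun _ _ => mul_comm _ _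

theorem kernelK_comm (α β : ℝ) (N : ℕ) (z w : ℝ × ℝ) :
    kernelK α β N z w = kernelK α β N w z := by
  simp only [kernelK, jacobiKernel_comm α β N (cosDiff w), jacobiKernel_comm α β N (cosSum w)]
  ring

theorem kernelOdd_comm (α β : ℝ) (n : ℕ) (z w : ℝ × ℝ) :
    kernelOdd α β n z w = kernelOdd α β n w z := by
  simp only [kernelOdd, kernelK_comm _ _ _ z w]
  ring

theorem polynomial_kernelK {α β : ℝ} (hα : -1 < α) (hβ : -1 < β) (N : ℕ) (w : ℝ × ℝ) :
    ∃ q ∈ polys (2 * (N - 1)), ∀ z ∈ square, evalAt q z = kernelK α β N z w := by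
  have hp := isOrthonormalSeq_jacobi hα hβ
  obtain ⟨q, hq, h⟩ := exists_symm_polynomial
    (natDegree_le_pred_of_degree_lt (hp.degree_sum_C_mul_lt N
      fun i => (jacobiONPoly α β i).eval (cosDiff w)))
    (natDegree_le_pred_of_degree_lt (hp.degree_sum_C_mul_lt N
      fun i => (jacobiONPoly α β i).eval (cosSum w)))
  refine ⟨(1 / 2 : ℝ) • q, Submodule.smul_mem _ _ hq, fun z hz => ?_⟩
  have e : ∀ s t, (∑ i ∈ Finset.range N, Polynomial.C ((jacobiONPoly α β i).eval t) *
      jacobiONPoly α β i).eval s = jacobiKernel α β N s t := fun s t => by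
    simp only [Polynomial.eval_finsetSum, Polynomial.eval_mul, Polynomial.eval_C,
      eval_jacobiONPoly, jacobiKernel]
    exact Finset.sum_congr rfl fun _ _ => mul_comm _ _
  rw [evalAt_smul, h z hz, e, e, e, e, kernelK]

theorem polynomial_kernelOdd {α β : ℝ} (hα : -1 < α) (hβ : -1 < β) {n : ℕ} (hn : 1 ≤ n)
    (w : ℝ × ℝ) :
    ∃ q ∈ polys (2 * n - 1), ∀ z ∈ square, evalAt q z = kernelOdd α β n z w := by
  have hα' : -1 < α + 1 := by linarith
  have hβ' : -1 < β + 1 := by linarith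
  obtain ⟨q1, hq1, h1⟩ := polynomial_kernelK hα hβ n w
  obtain ⟨q3, hq3, h3⟩ := polynomial_kernelK hα hβ' n w
  obtain ⟨q4, hq4, h4⟩ := polynomial_kernelK hα' hβ n w
  -- for `n = 1` the second term vanishes, and the degree bound on `K_{n-2}` says nothing
  obtain ⟨q2, hq2, h2⟩ : ∃ q ∈ polys (2 * n - 1), ∀ z ∈ square,
      evalAt q z = (z.1 ^ 2 - z.2 ^ 2) * kernelK (α + 1) (β + 1) (n - 1) z w := by
    rcases hn.eq_or_lt with rfl | hn2
    · exact ⟨0, zero_mem _, fun z _ => by simp [kernelK, jacobiKernel]⟩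
    · obtain ⟨q2, hq2, h2⟩ := polynomial_kernelK hα' hβ' (n - 1) w
      refine ⟨(MvPolynomial.X 0 ^ 2 - MvPolynomial.X 1 ^ 2) * q2, polys_mono (by omega)
        (mul_mem_polys (m := 2 * 1) (sub_mem (pow_mem_polys (X_mem_polys 0) 2)
          (pow_mem_polys (X_mem_polys 1) 2)) hq2), fun z hz => ?_⟩
      simp [h2 z hz]
  refine ⟨q1 + (dConst α β 1 1 * (w.1 ^ 2 - w.2 ^ 2)) • q2 +
    (dConst α β 0 1 * (w.1 + w.2)) • ((MvPolynomial.X 0 + MvPolynomial.X 1) * q3) +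
    (dConst α β 1 0 * (w.1 - w.2)) • ((MvPolynomial.X 0 - MvPolynomial.X 1) * q4),
    add_mem (add_mem (add_mem ?_ ?_) ?_) ?_, fun z hz => ?_⟩
  · exact polys_mono (by omega) hq1
  · exact Submodule.smul_mem _ _ hq2
  · exact Submodule.smul_mem _ _ (polys_mono (by omega)
      (mul_mem_polys (add_mem (X_mem_polys 0) (X_mem_polys 1)) hq3))
  · exact Submodule.smul_mem _ _ (polys_mono (by omega)
      (mul_mem_polys (sub_mem (X_mem_polys 0) (X_mem_polys 1)) hq4))
  · simp only [evalAt_add, evalAt_sub, evalAt_mul, evalAt_smul, evalAt_X_zero, evalAt_X_one,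
      h1 z hz, h2 z hz, h3 z hz, h4 z hz, kernelOdd]
    ring

section

variable {α β : ℝ} (hα : -1 < α) (hβ : -1 < β) {n : ℕ} {θ : Fin n → ℝ}
include hα hβ

theorem sum_nodes_kernelOdd_mul (hθ : IsZeroAngles α β n θ) {p : MvPolynomial (Fin 2) ℝ}
    (hp : p ∈ polys (2 * n - 1)) (hn : 1 ≤ n) {z : ℝ × ℝ} (hz : z ∈ square) :
    ∑ ν, nodeWeight α β θ ν * (kernelOdd α β n z (node θ ν) * evalAt p (node θ ν)) =
      evalAt p z := by
  simp only [kernelOdd_eq hα hβ]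
  replace hp := polys_le_span_sumDiff _ hp
  induction hp using Submodule.span_induction with
  | mem q hq =>
    obtain ⟨a, b, hab, rfl⟩ := hq
    have ha := Nat.div_add_mod a 2
    have hb := Nat.div_add_mod b 2
    have ha2 := Nat.mod_lt a two_pos
    have hb2 := Nat.mod_lt b two_pos
    have hij : b % 2 * (a % 2) ≤ 1 := by
      have := Nat.mul_le_mul (Nat.lt_succ_iff.mp hb2) (Nat.lt_succ_iff.mp ha2)
      simpa using this
    have hcase : b % 2 * (a % 2) = 0 ∨ (b % 2 = 1 ∧ a % 2 = 1) := by
      rcases Nat.mod_two_eq_zero_or_one a with h | h <;>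
      rcases Nat.mod_two_eq_zero_or_one b with h' | h' <;> simp [h, h']
    have hN : a / 2 + b / 2 < n - b % 2 * (a % 2) := by
      rcases hcase with h | ⟨h, h'⟩
      · rw [h]; omega
      · rw [h, h']; omega
    have hdeg : b % 2 + a % 2 + 2 * (n - b % 2 * (a % 2)) ≤ 2 * n + 1 := by
      rcases hcase with h | ⟨h, h'⟩
      · have : b % 2 + a % 2 ≤ 1 := by
          rcases mul_eq_zero.mp h with h | h <;> omega
        rw [h]; omega
      · rw [h, h']; omega
    -- the remainders of `b` and `a` modulo `2` say which of the four kernels is concerned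
    have h := sum_nodes_parityKernel_mul_sumDiff (α := α) (β := β) (θ := θ)
      (k := oddKernels α β n) (N := n - b % 2 * (a % 2)) ⟨b % 2, hb2⟩ ⟨a % 2, ha2⟩
      (fun g hg t => discrete_reproducing hα hβ hθ rfl rfl hdeg hg t) hN hz
    simpa only [ha, hb] using h
  | zero => simp
  | add p q _ _ ihp ihq =>
    simp only [evalAt_add, mul_add, Finset.sum_add_distrib]
    rw [ihp, ihq]
  | smul c p _ ihp =>
    simp only [evalAt_smul, mul_left_comm _ c]
    rw [← Finset.mul_sum, ihp]

/-- Since `𝒦_{2n-1}(z, ·) p` has degree at most `4n - 2`, the cubature rule turns the reproducing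
property into its discrete form. -/
theorem isReproducingKernel_kernelOdd (hn : 1 ≤ n) :
    IsReproducingKernel (weight α β) (2 * n - 1) (kernelOdd α β n) where
  polynomial z _ := by
    obtain ⟨q, hq, h⟩ := polynomial_kernelOdd hα hβ hn z
    exact ⟨q, hq, fun w hw => by rw [h w hw, kernelOdd_comm]⟩
  reproducing p hp z hz := by
    obtain ⟨θ, hθ⟩ := exists_isZeroAngles hα hβ n
    obtain ⟨q, hq, h⟩ := polynomial_kernelOdd hα hβ hn z
    have he : ∀ w ∈ square, kernelOdd α β n z w * evalAt p w = evalAt (q * p) w := fun w hw => by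
      rw [evalAt_mul, h w hw, kernelOdd_comm]
    have hc : Set.EqOn (fun w => evalAt (q * p) w * weight α β w)
        (fun w => kernelOdd α β n z w * evalAt p w * weight α β w) square := fun w hw => by
      simp only [he w hw]
    refine ⟨(integrableOn_evalAt_mul_weight hα hβ (q * p)).congr_fun hc measurableSet_square, ?_⟩
    rw [← setIntegral_congr_fun measurableSet_square hc,
      cubature_exact hα hβ hθ hn (polys_mono (by omega) (mul_mem_polys hq hp)),
      ← sum_nodes_kernelOdd_mul hα hβ hθ hp hn hz]
    refine Finset.sum_congr rfl fun ν _ => ?_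
    rw [he _ (node_mem_square θ ν)]

end

/-! ### Uniqueness of the coefficients -/

/-- The functions `(s, t) ↦ (q_m(s) q_k(t) + q_k(s) q_m(t))^2`, `k ≤ m`, are linearly independent on
the products of `m + 1` points at which `q_m` does not vanish. -/
theorem IsOrthonormalSeq.eq_zero_of_sum_mul_sq_eq_zero {L : Polynomial ℝ →ₗ[ℝ] ℝ}
    {q : ℕ → Polynomial ℝ} (hq : IsOrthonormalSeq L q) {m : ℕ} {x : Fin (m + 1) → ℝ}
    (hx : Function.Injective x) (hm : ∀ j, (q m).eval (x j) ≠ 0) {c : ℕ → ℝ}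
    (h : ∀ j l, ∑ k ∈ Finset.range (m + 1), c k * ((q m).eval (x j) * (q k).eval (x l) +
      (q k).eval (x j) * (q m).eval (x l)) ^ 2 = 0) {k : ℕ} (hk : k < m + 1) : c k = 0 := by
  -- the points on the diagonal
  have h1 : ∀ j, ∑ k ∈ Finset.range (m + 1), c k * (q k).eval (x j) ^ 2 = 0 := by
    intro j
    have e : 4 * (q m).eval (x j) ^ 2 *
        ∑ k ∈ Finset.range (m + 1), c k * (q k).eval (x j) ^ 2 = 0 := by
      rw [← h j j, Finset.mul_sum]
      exact Finset.sum_congr rfl fun k _ => by ring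
    exact (mul_eq_zero.mp e).resolve_left (by have := hm j; positivity)
  -- off the diagonal only the mixed term of the square remains
  have h2 : ∀ j l, ∑ k ∈ Finset.range (m + 1),
      c k * ((q k).eval (x j) * (q k).eval (x l)) = 0 := by
    intro j l
    have e : 2 * ((q m).eval (x j) * (q m).eval (x l)) * ∑ k ∈ Finset.range (m + 1),
        c k * ((q k).eval (x j) * (q k).eval (x l)) = 0 := by
      have e' := h j l
      have : ∑ k ∈ Finset.range (m + 1), c k * ((q m).eval (x j) * (q k).eval (x l) +
          (q k).eval (x j) * (q m).eval (x l)) ^ 2 =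
          (q m).eval (x j) ^ 2 * ∑ k ∈ Finset.range (m + 1), c k * (q k).eval (x l) ^ 2 +
          (q m).eval (x l) ^ 2 * ∑ k ∈ Finset.range (m + 1), c k * (q k).eval (x j) ^ 2 +
          2 * ((q m).eval (x j) * (q m).eval (x l)) * ∑ k ∈ Finset.range (m + 1),
            c k * ((q k).eval (x j) * (q k).eval (x l)) := by
        simp only [Finset.mul_sum, ← Finset.sum_add_distrib]
        exact Finset.sum_congr rfl fun k _ => by ring
      rw [this, h1, h1] at e'
      linarith
    exact (mul_eq_zero.mp e).resolve_left
      (mul_ne_zero two_ne_zero (mul_ne_zero (hm j) (hm l)))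
  have hzero : ∀ {f : Polynomial ℝ}, f.degree < (m + 1 : ℕ) → (∀ l, f.eval (x l) = 0) → f = 0 := by
    intro f hf hf0
    refine Polynomial.eq_zero_of_natDegree_lt_card_of_eval_eq_zero f hx hf0 ?_
    rw [Fintype.card_fin]
    exact Nat.lt_succ_of_le (natDegree_le_pred_of_degree_lt hf)
  -- as a polynomial in `x l` the sum has degree at most `m`, so its expansion is trivial
  have h3 : ∀ j, c k * (q k).eval (x j) = 0 := by
    intro j
    have hR : ∑ k ∈ Finset.range (m + 1), Polynomial.C (c k * (q k).eval (x j)) * q k = 0 := by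
      refine hzero (hq.degree_sum_C_mul_lt _ _) fun l => ?_
      simp only [Polynomial.eval_finsetSum, Polynomial.eval_mul, Polynomial.eval_C, mul_assoc]
      exact h2 j l
    have := congrArg (fun f => L (f * q k)) hR
    simp only [Finset.sum_mul, map_sum, mul_assoc, zero_mul, map_zero] at this
    rw [Finset.sum_eq_single k] at this
    · rwa [apply_C_mul, hq.apply_mul, if_pos rfl, mul_one] at this
    · intro i _ hi
      rw [apply_C_mul, hq.apply_mul, if_neg hi, mul_zero]
    · intro hk'; exact absurd (Finset.mem_range.mpr hk) hk'
  by_contra hc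
  refine hq.ne_zero k (hzero ?_ fun l => (mul_eq_zero.mp (h3 l)).resolve_left hc)
  rw [hq.degree_eq]
  exact_mod_cast hk

section

variable {α β : ℝ} (hα : -1 < α) (hβ : -1 < β)
include hα hβ

/-- The zeros of `P_{m+1}^{(α,β)}` are simple, so they are not zeros of its derivative, which is a
multiple of `P_m^{(α+1,β+1)}`; here this is read off from Gauss quadrature. -/
theorem eval_jacobiONPoly_ne_zero {m : ℕ} {θ : Fin (m + 1) → ℝ} (hθ : IsZeroAngles α β (m + 1) θ)
    (j : Fin (m + 1)) : (jacobiONPoly (α + 1) (β + 1) m).eval (Real.cos (θ j)) ≠ 0 := by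
  intro h0
  have hα' : -1 < α + 1 := by linarith
  have hβ' : -1 < β + 1 := by linarith
  have hq := isOrthonormalSeq_jacobi hα' hβ'
  have hx := hθ.cos_injective
  set ℓ := Lagrange.basis Finset.univ (fun k => Real.cos (θ k)) j with hℓ
  have hdeg : ℓ.degree = m := by
    rw [hℓ, Lagrange.degree_basis hx.injOn (Finset.mem_univ j)]
    simp
  have hlt : ℓ.degree < (m + 1 : ℕ) := by
    rw [hdeg]; exact_mod_cast Nat.lt_succ_self m
  have hcoeff : ℓ.coeff m ≠ 0 := Polynomial.coeff_ne_zero_of_eq_degree hdeg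
  have h := sum_gaussWeight_mul_last hα hβ hθ hlt
  rw [hq.apply_mul_eq_coeff_div hlt, Finset.sum_eq_zero, mul_zero] at h
  · have hm0 : (0 : ℝ) ≤ m := m.cast_nonneg
    have h1 : 1 + α + β + ((m : ℝ) + 1) ≠ 0 := by linarith
    have h2 : 1 + α + β + 2 * ((m : ℝ) + 1) ≠ 0 := by linarith
    exact mul_ne_zero (div_ne_zero h2 h1) (div_ne_zero hcoeff (hq.coeff_ne_zero m)) h.symm
  · intro k _
    by_cases hk : k = j
    · subst hk; simp [h0]
    · have : ℓ.eval (Real.cos (θ k)) = 0 := by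
        rw [hℓ]
        exact Lagrange.eval_basis_of_ne (v := fun k => Real.cos (θ k)) (Ne.symm hk)
          (Finset.mem_univ k)
      simp [this]

theorem coefficients_unique {n : ℕ} {θ : Fin n → ℝ} (hθ : IsZeroAngles α β n θ) (hn : 1 ≤ n)
    (b : Fin n → ℝ) :
    (∀ ν, nodeWeight α β θ ν = (kernelStar α β n b (node θ ν) (node θ ν))⁻¹) ↔
      b = bCoeff α β n := by
  have hstar : ∀ ν, nodeWeight α β θ ν =
      (kernelStar α β n (bCoeff α β n) (node θ ν) (node θ ν))⁻¹ := fun ν =>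
    eq_inv_of_mul_eq_one_left (by rw [nodeWeight_mul_kernelStar hα hβ hθ hn, if_pos rfl])
  refine ⟨fun h => ?_, fun h => h ▸ hstar⟩
  obtain ⟨m, rfl⟩ : ∃ m, n = m + 1 := ⟨n - 1, by omega⟩
  have hdiff : ∀ ν, ∑ k, (b k - bCoeff α β (m + 1) k) * Q₂ α β (m + 1) k (node θ ν) ^ 2 = 0 := by
    intro ν
    have e := inv_injective ((h ν).symm.trans (hstar ν))
    simp only [kernelStar, add_right_inj] at e
    rw [← sub_eq_zero, ← Finset.sum_sub_distrib] at e
    rw [← e]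
    exact Finset.sum_congr rfl fun k _ => by ring
  have hα' : -1 < α + 1 := by linarith
  have hβ' : -1 < β + 1 := by linarith
  have hq := isOrthonormalSeq_jacobi hα' hβ'
  have hc := jacobiConst_pos hα hβ
  have hc' := jacobiConst_pos hα' hβ'
  -- the coefficients after removal of the common factors of the squares
  let c : ℕ → ℝ := fun k => if hk : k < m + 1 then
    (b ⟨k, hk⟩ - bCoeff α β (m + 1) ⟨k, hk⟩) * (if k + 1 = m + 1 then √2 / 2 else 1) ^ 2 else 0
  have hle : ∀ j l : Fin (m + 1), j ≤ l → ∑ k ∈ Finset.range (m + 1),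
      c k * ((jacobiONPoly (α + 1) (β + 1) m).eval (Real.cos (θ j)) *
        (jacobiONPoly (α + 1) (β + 1) k).eval (Real.cos (θ l)) +
      (jacobiONPoly (α + 1) (β + 1) k).eval (Real.cos (θ j)) *
        (jacobiONPoly (α + 1) (β + 1) m).eval (Real.cos (θ l))) ^ 2 = 0 := by
    intro j l hjl
    let ν : NodeIndex (m + 1) := (⟨(j, l), hjl⟩, 0)
    have hν := hdiff ν
    have h1 := add_sq_eq (node_mem_square θ ν)
    have h2 := sub_sq_eq (node_mem_square θ ν)
    have e1 := symm_apply_node θ ν (F := fun s t => (1 + s) * (1 + t)) (fun _ _ => mul_comm _ _)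
    have e2 := symm_apply_node θ ν (F := fun s t => (1 - s) * (1 - t)) (fun _ _ => mul_comm _ _)
    rw [e1] at h1
    rw [e2] at h2
    have hσ : ((node θ ν).1 ^ 2 - (node θ ν).2 ^ 2) ≠ 0 := by
      rw [sq_sub_sq]
      refine mul_ne_zero (fun h0 => ?_) (fun h0 => ?_)
      · rw [h0] at h1
        exact (mul_pos (hθ.one_add_cos_pos j) (hθ.one_add_cos_pos l)).ne' (by linarith)
      · rw [h0] at h2
        exact (mul_pos (hθ.one_sub_cos_pos j) (hθ.one_sub_cos_pos l)).ne' (by linarith)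
    have hfac : (jacobiConst (α + 1) (β + 1) / (√2 * jacobiConst α β) *
        ((node θ ν).1 ^ 2 - (node θ ν).2 ^ 2)) ^ 2 ≠ 0 := by
      refine pow_ne_zero 2 (mul_ne_zero ?_ hσ)
      positivity
    refine (mul_eq_zero.mp (?_ : _ * _ = (0 : ℝ))).resolve_left hfac
    rw [← hν, Finset.mul_sum, Finset.sum_range]
    refine Finset.sum_congr rfl fun k _ => ?_
    have e3 := symm_apply_node θ ν (F := fun s t =>
      (jacobiON (α + 1) (β + 1) m s * jacobiON (α + 1) (β + 1) k t +
        jacobiON (α + 1) (β + 1) k s * jacobiON (α + 1) (β + 1) m t)) (fun _ _ => by ring)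
    simp only [c, dif_pos k.2, eval_jacobiONPoly, Fin.eta]
    rw [Q₂, Nat.add_sub_cancel, e3]
    ring
  have hzero := fun (k : ℕ) (hk : k < m + 1) =>
    hq.eq_zero_of_sum_mul_sq_eq_zero (c := c) hθ.cos_injective
      (eval_jacobiONPoly_ne_zero hα hβ hθ) (fun j l => by
        rcases le_total j l with hjl | hjl
        · exact hle j l hjl
        · rw [← hle l j hjl]
          exact Finset.sum_congr rfl fun k _ => by ring) hk
  funext k
  have h0 := hzero k k.2
  simp only [c, dif_pos k.2, Fin.eta] at h0
  refine sub_eq_zero.mp ((mul_eq_zero.mp h0).resolve_right (pow_ne_zero 2 ?_))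
  split_ifs <;> positivity

end

/-! ### Interpolation -/

theorem card_nodeIndex {n : ℕ} (hn : 1 ≤ n) :
    Fintype.card (NodeIndex n) = Module.finrank ℝ (polys (2 * n - 1)) + n := by
  have h1 : Fintype.card {p : Fin n × Fin n // p.1 ≤ p.2} = ∑ k ∈ Finset.range n, (k + 1) := by
    rw [Fintype.card_subtype, Finset.card_filter, Fintype.sum_prod_type_right, Finset.sum_range]
    refine Finset.sum_congr rfl fun k _ => ?_
    rw [← Finset.card_filter]
    have : Finset.univ.filter (fun j : Fin n => j ≤ k) = Finset.Iic k := by ext; simp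
    rw [this, Fin.card_Iic]
  have h2 : ∀ m : ℕ, (∑ k ∈ Finset.range m, (k + 1)) * 4 =
      ∑ k ∈ Finset.range (2 * m), (k + 1) + m := by
    intro m
    induction m with
    | zero => simp
    | succ m ih =>
      rw [show 2 * (m + 1) = 2 * m + 1 + 1 by ring, Finset.sum_range_succ, Finset.sum_range_succ,
        Finset.sum_range_succ, add_mul, ih]
      ring
  rw [Fintype.card_prod, h1, Fintype.card_fin, h2, finrank_polys,
    show 2 * n - 1 + 1 = 2 * n by omega]

section

variable {α β : ℝ} (hα : -1 < α) (hβ : -1 < β)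
include hα hβ

theorem exists_polynomial_Q₂ (n k : ℕ) (hk : k < n) :
    ∃ q : MvPolynomial (Fin 2) ℝ, ∀ z ∈ square, evalAt q z = Q₂ α β n k z := by
  have hq := isOrthonormalSeq_jacobi (α := α + 1) (β := β + 1) (by linarith) (by linarith)
  obtain ⟨q, -, h⟩ := exists_symm_polynomial (m := n - 1)
    (hq.natDegree_eq (n - 1)).le ((hq.natDegree_eq k).le.trans (by omega))
  refine ⟨((if k + 1 = n then √2 / 2 else 1) *
    (jacobiConst (α + 1) (β + 1) / (√2 * jacobiConst α β))) •
    ((MvPolynomial.X 0 ^ 2 - MvPolynomial.X 1 ^ 2) * q), fun z hz => ?_⟩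
  simp only [evalAt_smul, evalAt_mul, evalAt_sub, evalAt_pow, evalAt_X_zero, evalAt_X_one, h z hz,
    eval_jacobiONPoly, Q₂]
  ring

theorem polynomial_kernelStar {n : ℕ} (hn : 1 ≤ n) (b : Fin n → ℝ) (w : ℝ × ℝ) :
    ∃ q ∈ piStar α β n, ∀ z ∈ square, evalAt q z = kernelStar α β n b z w := by
  obtain ⟨q, hq, h⟩ := polynomial_kernelOdd hα hβ hn w
  choose p hp using fun k : Fin n => exists_polynomial_Q₂ hα hβ n k k.2
  refine ⟨q + ∑ k, (b k * Q₂ α β n k w) • p k, add_mem (Submodule.mem_sup_left hq)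
    (Submodule.mem_sup_right (Submodule.sum_mem _ fun k _ => Submodule.smul_mem _ _
      (Submodule.subset_span ⟨k, k.2, hp k⟩))), fun z hz => ?_⟩
  rw [evalAt_add, h z hz, evalAt_sum, kernelStar]
  congr 1
  refine Finset.sum_congr rfl fun k _ => ?_
  rw [evalAt_smul, hp k z hz]
  ring

theorem finrank_piStar_le (n : ℕ) : FiniteDimensional ℝ (piStar α β n) ∧
    Module.finrank ℝ (piStar α β n) ≤ Module.finrank ℝ (polys (2 * n - 1)) + n := by
  choose p hp using fun k : Fin n => exists_polynomial_Q₂ hα hβ n k k.2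
  have hset : {q | ∃ k < n, ∀ z ∈ square, evalAt q z = Q₂ α β n k z} = Set.range p := by
    ext q
    constructor
    · rintro ⟨k, hk, h⟩
      exact ⟨⟨k, hk⟩, evalAt_injOn_square fun z hz => by rw [hp _ z hz, h z hz]⟩
    · rintro ⟨k, rfl⟩
      exact ⟨k, k.2, hp k⟩
  rw [piStar, hset]
  have : FiniteDimensional ℝ (Submodule.span ℝ (Set.range p)) :=
    FiniteDimensional.span_of_finite ℝ (Set.finite_range p)
  refine ⟨inferInstance, (Submodule.finrank_add_le_finrank_add_finrank _ _).trans ?_⟩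
  gcongr
  have h := finrank_range_le_card (R := ℝ) p
  rwa [Fintype.card_fin] at h

theorem interpolation {n : ℕ} {θ : Fin n → ℝ} (hθ : IsZeroAngles α β n θ) (hn : 1 ≤ n)
    (f : ℝ × ℝ → ℝ) : ∃ L ∈ piStar α β n,
      (∀ ν, evalAt L (node θ ν) = f (node θ ν)) ∧
      (∀ L' ∈ piStar α β n, (∀ ν, evalAt L' (node θ ν) = f (node θ ν)) → L' = L) ∧
      ∀ z ∈ square, evalAt L z = ∑ ν, f (node θ ν) * fundamental α β θ ν z := by
  choose p hp h using fun ν => polynomial_kernelStar hα hβ hn (bCoeff α β n) (node θ ν)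
  have hval : ∀ (c : NodeIndex n → ℝ) (ν : NodeIndex n),
      evalAt (∑ ν', (c ν' * nodeWeight α β θ ν') • p ν') (node θ ν) = c ν := by
    intro c ν
    rw [evalAt_sum, Finset.sum_eq_single ν]
    · rw [evalAt_smul, h _ _ (node_mem_square θ ν), mul_assoc,
        nodeWeight_mul_kernelStar hα hβ hθ hn, if_pos rfl, mul_one]
    · intro ν' _ hν'
      rw [evalAt_smul, h _ _ (node_mem_square θ ν), mul_assoc,
        nodeWeight_mul_kernelStar hα hβ hθ hn, if_neg hν'.symm, mul_zero]
    · simp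
  have hmem : ∀ c : NodeIndex n → ℝ, ∑ ν', (c ν' * nodeWeight α β θ ν') • p ν' ∈ piStar α β n :=
    fun c => Submodule.sum_mem _ fun ν _ => Submodule.smul_mem _ _ (hp ν)
  -- evaluation at the nodes is onto, hence injective, by the count of the nodes
  let T : piStar α β n →ₗ[ℝ] (NodeIndex n → ℝ) :=
    { toFun := fun q ν => evalAt (q : MvPolynomial (Fin 2) ℝ) (node θ ν)
      map_add' := fun q q' => funext fun ν => evalAt_add _ _ _
      map_smul' := fun c q => funext fun ν => evalAt_smul _ _ _ }
  have hsurj : Function.Surjective T := fun c => ⟨⟨_, hmem c⟩, funext (hval c)⟩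
  obtain ⟨hfin, hrank⟩ := finrank_piStar_le hα hβ n
  have hinj : Function.Injective T := by
    rw [LinearMap.injective_iff_surjective_of_finrank_eq_finrank]
    · exact hsurj
    · refine le_antisymm ?_ (LinearMap.finrank_le_finrank_of_surjective hsurj)
      rw [Module.finrank_fintype_fun_eq_card, card_nodeIndex hn]
      exact hrank
  refine ⟨_, hmem fun ν => f (node θ ν), hval _, fun L' hL' h' => ?_, fun z hz => ?_⟩
  · have : T ⟨L', hL'⟩ = T ⟨_, hmem fun ν => f (node θ ν)⟩ := by
      funext ν
      exact (h' ν).trans (hval (fun ν => f (node θ ν)) ν).symm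
    exact congrArg Subtype.val (hinj this)
  · rw [evalAt_sum]
    refine Finset.sum_congr rfl fun ν _ => ?_
    rw [evalAt_smul, h ν z hz, fundamental, mul_assoc]

end

end MinCub

end

open MinCub

theorem mainTheorem4 (α β : ℝ) (hα : -1 < α) (hβ : -1 < β) (n : ℕ) (hn : 1 ≤ n) :
    -- `P_n^{(α,β)}` has `n` distinct zeros `cos θ_k`
    (∃ θ : Fin n → ℝ, IsZeroAngles α β n θ) ∧
    -- `𝒦_{2n-1}^{α,β}` is the reproducing kernel
    IsReproducingKernel (MinCub.weight α β) (2 * n - 1) (kernelOdd α β n) ∧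
    -- the closed form of `𝒦*_{2n}`
    (∀ z ∈ square, ∀ w ∈ square,
      kernelStar α β n (bCoeff α β n) z w =
        kernelOdd α β n z w +
          (1 + α + β + n) / (1 + α + β + 2 * n) * dConst α β 1 1 *
            (z.1 ^ 2 - z.2 ^ 2) * (w.1 ^ 2 - w.2 ^ 2) *
            (kernelK (α + 1) (β + 1) n z w - kernelK (α + 1) (β + 1) (n - 1) z w) -
          n * (1 + α + β + n) / (1 + α + β + 2 * n) ^ 2 *
            Q₂ α β n (n - 1) z * Q₂ α β n (n - 1) w) ∧
    ∀ θ : Fin n → ℝ, IsZeroAngles α β n θ →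
      -- the nodes are those of the minimal cubature rule of degree `4n-1`
      IsCubatureRule (MinCub.weight α β) (4 * n - 1) (node θ) (nodeWeight α β θ) ∧
      Fintype.card (NodeIndex n) = Module.finrank ℝ (polys (2 * n - 1)) + n ∧
      -- the coefficients `b_{k,n}` of `𝒦*_{2n}` are determined by the cubature weights
      (∀ b : Fin n → ℝ,
        (∀ ν, nodeWeight α β θ ν = (kernelStar α β n b (node θ ν) (node θ ν))⁻¹) ↔
          b = bCoeff α β n) ∧
      -- existence, uniqueness and the formula for the interpolation polynomial
      ∀ f : ℝ × ℝ → ℝ, ∃ L ∈ piStar α β n,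
        (∀ ν, evalAt L (node θ ν) = f (node θ ν)) ∧
        (∀ L' ∈ piStar α β n, (∀ ν, evalAt L' (node θ ν) = f (node θ ν)) → L' = L) ∧
        ∀ z ∈ square, evalAt L z = ∑ ν, f (node θ ν) * fundamental α β θ ν z := by
  refine ⟨exists_isZeroAngles hα hβ n, isReproducingKernel_kernelOdd hα hβ hn,
    fun z _ w _ => kernelStar_eq_closed hα hβ hn z w, fun θ hθ => ?_⟩
  exact ⟨isCubatureRule hα hβ hθ hn, card_nodeIndex hn, coefficients_unique hα hβ hθ hn,
    interpolation hα hβ hθ hn⟩
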